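/- All vector spaces are over $\mathbb{Q}$; a CDGA is a commutative differential graded algebra, graded in degrees $\ge 0$ with differential of degree $+1$. Let $A = (H^*(S^2\times S^3;\mathbb{Q}),0)$, i.e. the CDGA with basis $1,x_2,y_3,x_2y_3$ in degrees $0,2,3,5$, with $x_2^2=0$, $y_3^2=0$, and zero differential. It is a 1-connected Poincaré duality CDGA of formal dimension $n=5$ with orientation $\varepsilon(x_2y_3)=1$ and fundamental class $\omega=x_2y_3$. Its diagonal class is $$\Delta=\sum_i(-1)^{|a_i|}a_i\otimes a_i^* = 1\otimes x_2y_3+x_2\otimes y_3-y_3\otimes x_2-x_2y_3\otimes 1\in (A\otimes A)^5,$$ where $\{a_i\}$ is a homogeneous basis and $\{a_i^*\}$ is its Poincaré dual basis. Let $C(\Delta^!)=A\otimes A\oplus_{\Delta^!} ss^{-n}A$ be the mapping cone of the morphism of $A\otimes A$-dgmodules $\Delta^!\colon s^{-n}A\to A\otimes A$, $s^{-n}a\mapsto\Delta\cdot(1\otimes a)$. For $\xi\in(A\otimes A)^{2n-2}=(A\otimes A)^8$, let $C(\xi)$ be the CDGA whose underlying $A\otimes A$-dgmodule is $C(\Delta^!)/C(\Delta^!)^{\ge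 2n-1}$, with the unique product compatible with the $A\otimes A$-module structure such that $ss^{-n}1\cdot ss^{-n}1=\xi$; it comes with the CDGA morphism $A\otimes A\to C(\xi)$ induced by the inclusion of $A\otimes A$ in $C(\Delta^!)$. Let $\Phi\colon H^{n-2}(A)\to H^{2n-2}(A\otimes A)/([\Delta])$ be the map $[a]\mapsto[a\otimes\omega]$. For $x\in H^{n-2}(A)=H^3(A)\cong\mathbb{Q}$ write $C(x)$ for $C(\xi)$, where $\xi\in(A\otimes A)^{2n-2}$ is any element whose class modulo $([\Delta])$ is $\Phi(x)$. Two CDGAs $C(\xi)$, $C(\xi')$ are weakly equivalent under $A\otimes A$, written $C(\xi)\simeq_{A\otimes A}C(\xi')$, if there are a relative Sullivan algebra $A\otimes A\to (A\otimes A\otimes\Lambda Z,D)$ and CDGA quasi-isomorphisms $(A\otimes A\otimes\Lambda Z,D)\to C(\xi)$ and $(A\otimes A\otimes\Lambda Z,D)\to C(\xi')$ whose restrictions to $A\otimes A$ are the given morphisms $A\otimes A\to C(\xi)$ and $A\otimes A\to C(\xi')$. Then for all $x,x'\in H^3(A)$ (and for every choice of elements $\xi,\xi'$ representing $\Phi(x),\Phi(x')$),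 $$C(x)\simeq_{A\otimes A}C(x')\iff x=x'.$$ -/

import Mathlib

open scoped TensorProduct DirectSum

namespace RHT

/-- A commutative differential graded algebra over `ℚ`, graded in degrees `≥ 0`, with a differential
of degree `+1`. -/
structure CDGA where
  carrier : Type
  [ring : Ring carrier]
  [algebra : Algebra ℚ carrier]
  gr : ℕ → Submodule ℚ carrier
  [graded : GradedAlgebra gr]
  d : carrier →ₗ[ℚ] carrier
  d_mem : ∀ {k : ℕ} {a : carrier}, a ∈ gr k → d a ∈ gr (k + 1)
  d_d : ∀ a : carrier, d (d a) = 0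
  leibniz : ∀ {k : ℕ} {a : carrier}, a ∈ gr k → ∀ b : carrier,
    d (a * b) = d a * b + (-1 : ℚ) ^ k • (a * d b)
  graded_comm : ∀ {i j : ℕ} {a b : carrier}, a ∈ gr i → b ∈ gr j →
    a * b = (-1 : ℚ) ^ (i * j) • (b * a)

instance : CoeSort CDGA Type := ⟨CDGA.carrier⟩

attribute [instance] CDGA.ring CDGA.algebra CDGA.graded

/-- Morphisms of CDGAs. -/
structure CDGAHom (A B : CDGA) where
  toAlgHom : A →ₐ[ℚ] B
  map_gr : ∀ {k : ℕ} {a : A}, a ∈ A.gr k → toAlgHom a ∈ B.gr k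
  map_d : ∀ a : A, toAlgHom (A.d a) = B.d (toAlgHom a)

namespace CDGAHom

instance (A B : CDGA) : CoeFun (CDGAHom A B) (fun _ => A → B) := ⟨fun f => f.toAlgHom⟩

/-- Composition `g ∘ f`. -/
def comp {A B C : CDGA} (g : CDGAHom B C) (f : CDGAHom A B) : CDGAHom A C where
  toAlgHom := g.toAlgHom.comp f.toAlgHom
  map_gr h := g.map_gr (f.map_gr h)
  map_d a := by simp [f.map_d, g.map_d]

end CDGAHom

namespace CDGA

/-! ### Cohomology -/

/-- The cocycles of degree `k`. -/
def cocycles (A : CDGA) (k : ℕ) : Submodule ℚ A := A.gr k ⊓ LinearMap.ker A.d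

/-- The coboundaries of degree `k`. -/
def coboundaries (A : CDGA) (k : ℕ) : Submodule ℚ A := A.gr k ⊓ LinearMap.range A.d

/-- The cohomology `H^k(A)`. -/
abbrev H (A : CDGA) (k : ℕ) : Type :=
  A.cocycles k ⧸ (A.coboundaries k).submoduleOf (A.cocycles k)

/-- The cohomology class of a cocycle. -/
def cls (A : CDGA) {k : ℕ} (a : A.cocycles k) : A.H k := Submodule.Quotient.mk a

end CDGA

namespace CDGAHom

/-- The map induced on cocycles. -/
def cocyclesMap {A B : CDGA} (f : CDGAHom A B) (k : ℕ) : A.cocycles k →ₗ[ℚ] B.cocycles k :=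
  f.toAlgHom.toLinearMap.restrict (fun a ha => by
    refine ⟨f.map_gr ha.1, ?_⟩
    have h : A.d a = 0 := ha.2
    simp [← f.map_d, h])

/-- The map induced on cohomology. -/
def cohomologyMap {A B : CDGA} (f : CDGAHom A B) (k : ℕ) : A.H k →ₗ[ℚ] B.H k :=
  Submodule.mapQ _ _ (f.cocyclesMap k) (by
    rintro ⟨a, ha⟩ ⟨h1, ⟨b, hb⟩⟩
    refine ⟨f.map_gr ha.1, ⟨f b, ?_⟩⟩
    rw [← f.map_d]
    exact congrArg f hb)

/-- A quasi-isomorphism is a morphism inducing isomorphisms in cohomology in every degree. -/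
def IsQuasiIso {A B : CDGA} (f : CDGAHom A B) : Prop :=
  ∀ k, Function.Bijective (f.cohomologyMap k)

end CDGAHom

/-! ### Free graded commutative algebras and relative Sullivan algebras -/

/-- The relations `v w = (-1)^{|v| |w|} w v` in the tensor algebra of a graded vector space. -/
inductive FreeCGA.Rel (V : ℕ → Type) [∀ p, AddCommGroup (V p)] [∀ p, Module ℚ (V p)] :
    TensorAlgebra ℚ (⨁ p, V p) → TensorAlgebra ℚ (⨁ p, V p) → Prop
  | swap (i j : ℕ) (v : V i) (w : V j) :
      FreeCGA.Rel V
        (TensorAlgebra.ι ℚ (DirectSum.lof ℚ ℕ V i v) * TensorAlgebra.ι ℚ (DirectSum.lof ℚ ℕ V j w))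
        ((-1 : ℚ) ^ (i * j) •
          (TensorAlgebra.ι ℚ (DirectSum.lof ℚ ℕ V j w) *
            TensorAlgebra.ι ℚ (DirectSum.lof ℚ ℕ V i v)))

/-- The free graded commutative algebra `ΛV` on a graded vector space `V`. -/
abbrev FreeCGA (V : ℕ → Type) [∀ p, AddCommGroup (V p)] [∀ p, Module ℚ (V p)] : Type :=
  RingQuot (FreeCGA.Rel V)

/-- The algebra map `ΛV → E` extending the inclusion of a graded subspace `V` of `E`. -/
noncomputable def FreeCGA.toCDGA (E : CDGA) (V : ℕ → Submodule ℚ E) (hV : ∀ p, V p ≤ E.gr p) :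
    FreeCGA (fun p => V p) →ₐ[ℚ] E :=
  RingQuot.liftAlgHom ℚ
    ⟨TensorAlgebra.lift ℚ (DirectSum.toModule ℚ ℕ E (fun p => (V p).subtype)), by
      rintro _ _ ⟨i, j, v, w⟩
      simpa using E.graded_comm (hV i v.2) (hV j w.2)⟩

/-- The linear map `B ⊗ ΛV → E`, `b ⊗ w ↦ i(b) w`, for a morphism `i : B → E` and a graded
subspace `V` of `E`. -/
noncomputable def relFreeMap {B E : CDGA} (i : CDGAHom B E) (V : ℕ → Submodule ℚ E)
    (hV : ∀ p, V p ≤ E.gr p) : B ⊗[ℚ] FreeCGA (fun p => V p) →ₗ[ℚ] E :=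
  TensorProduct.lift
    ((LinearMap.mul ℚ E).compl₁₂ i.toAlgHom.toLinearMap (FreeCGA.toCDGA E V hV).toLinearMap)

/-- `i : B → E` is (the inclusion of the base into) a relative Sullivan algebra
`E = (B ⊗ ΛV, D)`: `H⁰(B) = ℚ`, `V` is a graded subspace of `E` concentrated in positive degrees,
the multiplication `B ⊗ ΛV → E` is an isomorphism, and `V` is the increasing union of graded
subspaces `V(0) ⊆ V(1) ⊆ ⋯` such that `D V(0) ⊆ B` and `D V(k+1) ⊆ B ⊗ ΛV(k)`. Here
`B ⊗ ΛV(k)` is the subalgebra generated by `B` and `V(k)`. -/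
structure IsRelativeSullivan {B E : CDGA} (i : CDGAHom B E) : Prop where
  base_nontrivial : Nontrivial B
  base_connected : ∀ b ∈ B.cocycles 0, ∃ q : ℚ, b = algebraMap ℚ B q
  exists_generators : ∃ (V : ℕ → Submodule ℚ E) (hV : ∀ p, V p ≤ E.gr p),
    V 0 = ⊥ ∧
    Function.Bijective (relFreeMap i V hV) ∧
    ∃ F : ℕ → ℕ → Submodule ℚ E,
      (∀ k p, F k p ≤ F (k + 1) p) ∧
      (∀ p, ⨆ k, F k p = V p) ∧
      (∀ p, ∀ v ∈ F 0 p, E.d v ∈ Set.range i) ∧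
      (∀ k p, ∀ v ∈ F (k + 1) p,
        E.d v ∈ Algebra.adjoin ℚ (Set.range i ∪ ⋃ q, (F k q : Set E)))

/-- Two CDGAs `C` and `C'` under `B` are weakly equivalent under `B` if there are a relative
Sullivan algebra `B → (B ⊗ ΛV, D)` and quasi-isomorphisms `(B ⊗ ΛV, D) → C`,
`(B ⊗ ΛV, D) → C'` that are compatible with the maps from `B`. -/
def WeaklyEquivalentUnder {B C C' : CDGA} (f : CDGAHom B C) (f' : CDGAHom B C') : Prop :=
  ∃ (E : CDGA) (i : CDGAHom B E), IsRelativeSullivan i ∧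
    ∃ (φ : CDGAHom E C) (φ' : CDGAHom E C'), φ.IsQuasiIso ∧ φ'.IsQuasiIso ∧
      φ.comp i = f ∧ φ'.comp i = f'

end RHT

namespace RHT

/-! ### Tensor products -/

/-- A family of submodules that spans and is separated by projections is a decomposition. -/
theorem isInternal_of_proj {M : Type} [AddCommGroup M] [Module ℚ M] (𝓜 : ℕ → Submodule ℚ M)
    (π : ℕ → M →ₗ[ℚ] M) (h1 : ∀ k, ∀ x ∈ 𝓜 k, π k x = x)
    (h2 : ∀ j k, j ≠ k → ∀ x ∈ 𝓜 j, π k x = 0) (h3 : ∀ x, x ∈ ⨆ k, 𝓜 k) :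
    DirectSum.IsInternal 𝓜 := by
  rw [DirectSum.isInternal_submodule_iff_iSupIndep_and_iSup_eq_top]
  refine ⟨?_, eq_top_iff.2 fun x _ => h3 x⟩
  intro k
  rw [Submodule.disjoint_def]
  intro x hx hx'
  have : (⨆ j, ⨆ (_ : j ≠ k), 𝓜 j) ≤ LinearMap.ker (π k) :=
    iSup_le fun j => iSup_le fun hj => fun y hy => h2 j k hj y hy
  rw [← h1 k x hx]
  exact this hx'

namespace CDGA

variable (A A' : CDGA)

/-- The sign involution `a ↦ (-1)^{|a|} a`. -/
noncomputable def sgn : A →ₗ[ℚ] A :=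
  DirectSum.toModule ℚ ℕ A (fun k => (-1 : ℚ) ^ k • (A.gr k).subtype) ∘ₗ
    (DirectSum.decomposeLinearEquiv A.gr).toLinearMap

/-- The projection to the component of degree `k`. -/
noncomputable def proj (k : ℕ) : A →ₗ[ℚ] A := GradedAlgebra.proj A.gr k

theorem sgn_apply {A : CDGA} {k : ℕ} {a : A} (ha : a ∈ A.gr k) : A.sgn a = (-1 : ℚ) ^ k • a := by
  lift a to A.gr k using ha
  simp [sgn]

theorem proj_same {A : CDGA} {k : ℕ} {a : A} (ha : a ∈ A.gr k) : A.proj k a = a := by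
  simp [proj, GradedAlgebra.proj_apply, DirectSum.decompose_of_mem_same _ ha]

theorem proj_ne {A : CDGA} {j k : ℕ} {a : A} (ha : a ∈ A.gr j) (h : j ≠ k) : A.proj k a = 0 := by
  simp [proj, GradedAlgebra.proj_apply, DirectSum.decompose_of_mem_ne _ ha h]

theorem proj_mem (k : ℕ) (a : A) : A.proj k a ∈ A.gr k := by
  simp [proj, GradedAlgebra.proj_apply]

theorem hom_induction {A : CDGA} {P : A → Prop} (h0 : P 0)
    (h : ∀ k, ∀ a ∈ A.gr k, P a) (hadd : ∀ a b, P a → P b → P (a + b)) (a : A) : P a :=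
  DirectSum.Decomposition.inductionOn A.gr h0 (fun m => h _ m m.2) hadd a

/-- The underlying algebra of `A ⊗ A'`, with the multiplication
`(a ⊗ b)(a' ⊗ b') = (-1)^{|b||a'|} a a' ⊗ b b'`. -/
abbrev TensorCarrier : Type := A.gr ᵍ⊗[ℚ] A'.gr

variable {A A'}

/-- The element `a ⊗ b`. -/
noncomputable abbrev tm (a : A) (b : A') : TensorCarrier A A' := GradedTensorProduct.tmul ℚ a b

theorem tm_mul_tm {i j : ℕ} (a : A) {b : A'} (hb : b ∈ A'.gr j) {a' : A} (ha' : a' ∈ A.gr i)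
    (b' : A') : tm a b * tm a' b' = (-1 : ℚ) ^ (j * i) • tm (a * a') (b * b') := by
  lift b to A'.gr j using hb
  lift a' to A.gr i using ha'
  rw [GradedTensorProduct.tmul_coe_mul_coe_tmul]
  rcases Nat.even_or_odd (j * i) with h | h
  · simp [h.neg_one_pow]
  · simp [h.neg_one_pow]

variable (A A') in
/-- `(A ⊗ A')^k = ⨁_{i+j=k} A^i ⊗ A'^j`. -/
noncomputable def tensorGr (k : ℕ) : Submodule ℚ (TensorCarrier A A') :=
  Submodule.span ℚ {z | ∃ i j, i + j = k ∧ ∃ a ∈ A.gr i, ∃ b ∈ A'.gr j, z = tm a b}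

theorem tm_mem {i j k : ℕ} (h : i + j = k) {a : A} (ha : a ∈ A.gr i) {b : A'} (hb : b ∈ A'.gr j) :
    tm a b ∈ tensorGr A A' k :=
  Submodule.subset_span ⟨i, j, h, a, ha, b, hb, rfl⟩

theorem tm_add_left (a a' : A) (b : A') : tm (a + a') b = tm a b + tm a' b :=
  congrArg (GradedTensorProduct.of ℚ A.gr A'.gr) (TensorProduct.add_tmul a a' b)

theorem tm_add_right (a : A) (b b' : A') : tm a (b + b') = tm a b + tm a b' :=
  congrArg (GradedTensorProduct.of ℚ A.gr A'.gr) (TensorProduct.tmul_add a b b')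

theorem tm_smul_left (q : ℚ) (a : A) (b : A') : tm (q • a) b = q • tm a b := rfl

theorem tm_smul_right (q : ℚ) (a : A) (b : A') : tm a (q • b) = q • tm a b :=
  congrArg (GradedTensorProduct.of ℚ A.gr A'.gr) (TensorProduct.tmul_smul q a b)

theorem tm_zero_left (b : A') : tm (0 : A) b = 0 := by
  simp [tm]

theorem tm_zero_right (a : A) : tm a (0 : A') = 0 := by
  simp [tm]

theorem tensor_induction {P : TensorCarrier A A' → Prop} (h0 : P 0)
    (h : ∀ i j, ∀ a ∈ A.gr i, ∀ b ∈ A'.gr j, P (tm a b)) (hadd : ∀ x y, P x → P y → P (x + y))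
    (z : TensorCarrier A A') : P z := by
  refine TensorProduct.induction_on (motive := fun z => P z) z h0 (fun a b => ?_) hadd
  change P (tm a b)
  refine hom_induction (P := fun a => P (tm a b)) (by simpa [tm_zero_left] using h0) ?_ ?_ a
  · intro i a ha
    refine hom_induction (P := fun b => P (tm a b)) (by simpa [tm_zero_right] using h0) ?_ ?_ b
    · intro j b hb
      exact h i j a ha b hb
    · intro b b' h1 h2
      rw [tm_add_right]
      exact hadd _ _ h1 h2
  · intro a a' h1 h2
    rw [tm_add_left]
    exact hadd _ _ h1 h2

theorem tensorGr_induction {k : ℕ} {P : TensorCarrier A A' → Prop} (h0 : P 0)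
    (h : ∀ i j, i + j = k → ∀ a ∈ A.gr i, ∀ b ∈ A'.gr j, P (tm a b))
    (hadd : ∀ x y, P x → P y → P (x + y)) {z : TensorCarrier A A'} (hz : z ∈ tensorGr A A' k) :
    P z := by
  have key : ∀ q : ℚ, P (q • z) := by
    refine Submodule.span_induction (p := fun z _ => ∀ q : ℚ, P (q • z)) ?_ ?_ ?_ ?_ hz
    · rintro _ ⟨i, j, hij, a, ha, b, hb, rfl⟩ q
      rw [← tm_smul_left]
      exact h i j hij _ (Submodule.smul_mem _ _ ha) b hb
    · intro q
      rwa [smul_zero]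
    · intro x y _ _ hx hy q
      rw [smul_add]
      exact hadd _ _ (hx q) (hy q)
    · intro r x _ hx q
      rw [smul_smul]
      exact hx _
  simpa using key 1

variable (A A') in
/-- The linear map `f ⊗ g`, without signs. -/
noncomputable def tmap {B B' : CDGA} (f : A →ₗ[ℚ] B) (g : A' →ₗ[ℚ] B') :
    TensorCarrier A A' →ₗ[ℚ] TensorCarrier B B' :=
  (GradedTensorProduct.of ℚ B.gr B'.gr).toLinearMap ∘ₗ TensorProduct.map f g ∘ₗ
    (GradedTensorProduct.of ℚ A.gr A'.gr).symm.toLinearMap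

@[simp]
theorem tmap_tm {B B' : CDGA} (f : A →ₗ[ℚ] B) (g : A' →ₗ[ℚ] B') (a : A) (b : A') :
    tmap A A' f g (tm a b) = tm (f a) (g b) := rfl

instance tensorGradedMonoid : SetLike.GradedMonoid (tensorGr A A') where
  one_mem := tm_mem (zero_add 0) (SetLike.one_mem_graded A.gr) (SetLike.one_mem_graded A'.gr)
  mul_mem := by
    intro k l x y hx hy
    refine tensorGr_induction (P := fun x => x * y ∈ tensorGr A A' (k + l)) ?_ ?_ ?_ hx
    · simp
    · intro i j hij a ha b hb
      refine tensorGr_induction (P := fun y => tm a b * y ∈ tensorGr A A' (k + l)) ?_ ?_ ?_ hy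
      · simp
      · intro i' j' hij' a' ha' b' hb'
        rw [tm_mul_tm a hb ha' b']
        refine Submodule.smul_mem _ _ (tm_mem (i := i + i') (j := j + j') (by omega) ?_ ?_)
        · exact SetLike.mul_mem_graded ha ha'
        · exact SetLike.mul_mem_graded hb hb'
      · intro x y h1 h2
        rw [mul_add]
        exact Submodule.add_mem _ h1 h2
    · intro x y h1 h2
      rw [add_mul]
      exact Submodule.add_mem _ h1 h2

theorem tensor_isInternal : DirectSum.IsInternal (tensorGr A A') := by
  refine isInternal_of_proj _
    (fun k => ∑ p ∈ Finset.HasAntidiagonal.antidiagonal k, tmap A A' (A.proj p.1) (A'.proj p.2)) ?_ ?_ ?_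
  · intro k x hx
    refine tensorGr_induction (P := fun x => (∑ p ∈ Finset.HasAntidiagonal.antidiagonal k,
      tmap A A' (A.proj p.1) (A'.proj p.2)) x = x) ?_ ?_ ?_ hx
    · simp
    · intro i j hij a ha b hb
      rw [LinearMap.sum_apply, Finset.sum_eq_single (i, j)]
      · simp [proj_same ha, proj_same hb]
      · rintro ⟨i', j'⟩ hp hne
        have : i ≠ i' := by
          rintro rfl
          simp only [Finset.HasAntidiagonal.mem_antidiagonal] at hp
          apply hne
          ext <;> simp
          omega
        simp [proj_ne ha this]
      · intro h
        simp [hij] at h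
    · intro x y h1 h2
      rw [map_add, h1, h2]
  · intro l k hlk x hx
    refine tensorGr_induction (P := fun x => (∑ p ∈ Finset.HasAntidiagonal.antidiagonal k,
      tmap A A' (A.proj p.1) (A'.proj p.2)) x = 0) ?_ ?_ ?_ hx
    · simp
    · intro i j hij a ha b hb
      rw [LinearMap.sum_apply, Finset.sum_eq_zero]
      rintro ⟨i', j'⟩ hp
      simp only [Finset.HasAntidiagonal.mem_antidiagonal] at hp
      by_cases h : i = i'
      · have : j ≠ j' := by omega
        simp [proj_ne hb this]
      · simp [proj_ne ha h]
    · intro x y h1 h2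
      rw [map_add, h1, h2, add_zero]
  · intro x
    refine tensor_induction ?_ ?_ ?_ x
    · exact Submodule.zero_mem _
    · intro i j a ha b hb
      exact Submodule.mem_iSup_of_mem (i + j) (tm_mem rfl ha hb)
    · intro x y
      exact Submodule.add_mem _

noncomputable instance tensorGraded : GradedAlgebra (tensorGr A A') :=
  { tensorGradedMonoid, tensor_isInternal.chooseDecomposition with }

variable (A A') in
/-- The differential `d(a ⊗ b) = da ⊗ b + (-1)^{|a|} a ⊗ db`. -/
noncomputable def tensorD : TensorCarrier A A' →ₗ[ℚ] TensorCarrier A A' :=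
  tmap A A' A.d LinearMap.id + tmap A A' A.sgn A'.d

theorem tensorD_tm {i : ℕ} {a : A} (ha : a ∈ A.gr i) (b : A') :
    tensorD A A' (tm a b) = tm (A.d a) b + (-1 : ℚ) ^ i • tm a (A'.d b) := by
  simp only [tensorD, LinearMap.add_apply, tmap_tm, sgn_apply ha, LinearMap.id_apply, tm_smul_left]

variable (A A') in
/-- The tensor product of two CDGAs. -/
noncomputable abbrev tensor : CDGA where
  carrier := TensorCarrier A A'
  gr := tensorGr A A'
  d := tensorD A A'
  d_mem := by
    intro k z hz
    refine tensorGr_induction (P := fun z => tensorD A A' z ∈ tensorGr A A' (k + 1)) ?_ ?_ ?_ hz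
    · simp
    · intro i j hij a ha b hb
      rw [tensorD_tm ha]
      exact Submodule.add_mem _ (tm_mem (by omega) (A.d_mem ha) hb)
        (Submodule.smul_mem _ _ (tm_mem (by omega) ha (A'.d_mem hb)))
    · intro x y h1 h2
      rw [map_add]
      exact Submodule.add_mem _ h1 h2
  d_d := by
    intro z
    refine tensor_induction (P := fun z => tensorD A A' (tensorD A A' z) = 0) ?_ ?_ ?_ z
    · simp
    · intro i j a ha b hb
      rw [tensorD_tm ha, map_add, map_smul, tensorD_tm (A.d_mem ha), tensorD_tm ha, A.d_d, A'.d_d,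
        tm_zero_left, tm_zero_right, pow_succ]
      module
    · intro x y h1 h2
      rw [map_add, map_add, h1, h2, add_zero]
  leibniz := by
    intro k x hx y
    refine tensorGr_induction (P := fun x => tensorD A A' (x * y) =
      tensorD A A' x * y + (-1 : ℚ) ^ k • (x * tensorD A A' y)) ?_ ?_ ?_ hx
    · simp
    · intro i j hij a ha b hb
      refine tensor_induction (P := fun y => tensorD A A' (tm a b * y) =
        tensorD A A' (tm a b) * y + (-1 : ℚ) ^ k • (tm a b * tensorD A A' y)) ?_ ?_ ?_ y
      · simp
      · intro i' j' a' ha' b' hb'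
        subst hij
        rw [tm_mul_tm a hb ha' b', map_smul, tensorD_tm (SetLike.mul_mem_graded ha ha'),
          tensorD_tm ha, tensorD_tm ha', A.leibniz ha, A'.leibniz hb, add_mul, mul_add,
          smul_mul_assoc, mul_smul_comm, tm_mul_tm _ hb ha', tm_mul_tm _ (A'.d_mem hb) ha',
          tm_mul_tm _ hb (A.d_mem ha'), tm_mul_tm _ hb ha', tm_add_left, tm_add_right,
          tm_smul_left, tm_smul_right]
        simp only [smul_add, smul_smul, ← pow_add]
        have e1 : (-1 : ℚ) ^ (j * i' + i) = (-1) ^ (i + j + j * (i' + 1)) := by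
          rw [show i + j + j * (i' + 1) = (j * i' + i) + 2 * j by ring, pow_add _ _ (2 * j)]
          simp
        have e2 : (-1 : ℚ) ^ (j * i' + (i + i')) = (-1) ^ (i + (j + 1) * i') := by
          congr 1
          ring
        have e3 : (-1 : ℚ) ^ (j * i' + (i + i' + j)) = (-1) ^ (i + j + (i' + j * i')) := by
          congr 1
          ring
        simp only [e1, e2, e3]
        abel
      · intro x y h1 h2
        simp only [mul_add, map_add, h1, h2, smul_add]
        abel
    · intro x y h1 h2
      simp only [add_mul, map_add, h1, h2, smul_add]
      abel
  graded_comm := by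
    intro k l x y hx hy
    refine tensorGr_induction (P := fun x => x * y = (-1 : ℚ) ^ (k * l) • (y * x)) ?_ ?_ ?_ hx
    · simp
    · intro i j hij a ha b hb
      refine tensorGr_induction (P := fun y => tm a b * y = (-1 : ℚ) ^ (k * l) • (y * tm a b))
        ?_ ?_ ?_ hy
      · simp
      · intro i' j' hij' a' ha' b' hb'
        subst hij hij'
        rw [tm_mul_tm _ hb ha', tm_mul_tm _ hb' ha, A.graded_comm ha ha', A'.graded_comm hb hb',
          tm_smul_left, tm_smul_right]
        simp only [smul_smul, ← pow_add]
        congr 1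
        rw [← add_assoc, show (i + j) * (i' + j') + j' * i = (j * i' + i * i' + j * j') + 2 * (i * j') by ring,
          pow_add _ _ (2 * (i * j'))]
        simp
      · intro x y h1 h2
        simp only [mul_add, add_mul, h1, h2, smul_add]
    · intro x y h1 h2
      simp only [mul_add, add_mul, h1, h2, smul_add]

end CDGA

end RHT

namespace RHT

open CDGA

/-! ### Poincaré duality and the diagonal class -/

/-- `A⁰ = ℚ` and `A¹ = 0`. -/
structure CDGA.IsOneConnected (A : CDGA) : Prop where
  nontrivial : Nontrivial A
  gr_zero : ∀ a ∈ A.gr 0, ∃ q : ℚ, a = algebraMap ℚ A q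
  gr_one : A.gr 1 = ⊥

/-- An orientation making `A` a Poincaré duality CDGA of formal dimension `n`. The linear form
`ε : Aⁿ → ℚ` is extended by zero to the other degrees. -/
structure PoincareDuality (A : CDGA) (n : ℕ) where
  ε : A →ₗ[ℚ] ℚ
  ε_of_ne : ∀ {k : ℕ} {a : A}, a ∈ A.gr k → k ≠ n → ε a = 0
  ε_d : ∀ a : A, ε (A.d a) = 0
  nondegenerate : ∀ {k : ℕ} {a : A}, a ∈ A.gr k → a ≠ 0 →
    ∃ l, k + l = n ∧ ∃ b ∈ A.gr l, ε (a * b) ≠ 0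

/-- A finite homogeneous basis `a_i` of a Poincaré duality CDGA with its Poincaré dual basis
`a_i^*`, characterised by `ε(a_i a_j^*) = δ_{ij}`. -/
structure DualBasis {A : CDGA} {n : ℕ} (P : PoincareDuality A n) where
  ι : Type
  [fintype : Fintype ι]
  basis : Module.Basis ι ℚ A
  dual : ι → A
  deg : ι → ℕ
  codeg : ι → ℕ
  deg_add_codeg : ∀ i, deg i + codeg i = n
  basis_mem : ∀ i, basis i ∈ A.gr (deg i)
  dual_mem : ∀ i, dual i ∈ A.gr (codeg i)
  ε_same : ∀ i, P.ε (basis i * dual i) = 1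
  ε_ne : ∀ i j, i ≠ j → P.ε (basis i * dual j) = 0

attribute [instance] DualBasis.fintype

namespace DualBasis

variable {A : CDGA} {n : ℕ} {P : PoincareDuality A n} (D : DualBasis P)

/-- The diagonal class `Δ = ∑ (-1)^{|a_i|} a_i ⊗ a_i^*`. -/
noncomputable def diag : TensorCarrier A A :=
  ∑ i, (-1 : ℚ) ^ D.deg i • tm (D.basis i) (D.dual i)

theorem diag_mem : D.diag ∈ tensorGr A A n :=
  Submodule.sum_mem _ fun i _ => Submodule.smul_mem _ _
    (tm_mem (D.deg_add_codeg i) (D.basis_mem i) (D.dual_mem i))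

theorem expand (c : A) : c = ∑ j, P.ε (c * D.dual j) • D.basis j := by
  classical
  have h : ∀ j, P.ε (c * D.dual j) = D.basis.repr c j := by
    intro j
    conv_lhs => rw [← D.basis.sum_repr c]
    rw [Finset.sum_mul, map_sum, Finset.sum_eq_single j]
    · simp [D.ε_same]
    · intro i _ hij
      simp [D.ε_ne i j hij]
    · simp
  simp only [h]
  exact (D.basis.sum_repr c).symm

theorem eq_zero_of_pair (P : PoincareDuality A n) (e : A) (h : ∀ b, P.ε (b * e) = 0) : e = 0 := by
  classical
  have key : ∀ k, A.proj k e = 0 := by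
    intro k
    by_contra hne
    obtain ⟨l, hl, b, hb, hb'⟩ := P.nondegenerate (A.proj_mem k e) hne
    apply hb'
    rw [A.graded_comm (A.proj_mem k e) hb, map_smul]
    have : P.ε (b * e) = P.ε (b * A.proj k e) := by
      refine hom_induction (P := fun e => P.ε (b * e) = P.ε (b * A.proj k e)) ?_ ?_ ?_ e
      · simp
      · intro m a ha
        by_cases hm : m = k
        · subst hm
          rw [proj_same ha]
        · rw [proj_ne ha hm, mul_zero, map_zero]
          exact P.ε_of_ne (SetLike.mul_mem_graded hb ha) (by omega)
      · intro x y h1 h2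
        simp only [mul_add, map_add, h1, h2]
    rw [← this, h, smul_zero]
  rw [← DirectSum.sum_support_decompose A.gr e]
  exact Finset.sum_eq_zero fun k _ => by simpa [proj, GradedAlgebra.proj_apply] using key k

theorem expand_dual (c : A) : c = ∑ i, P.ε (D.basis i * c) • D.dual i := by
  classical
  rw [← sub_eq_zero]
  refine eq_zero_of_pair P _ fun b => ?_
  rw [← D.basis.sum_repr b, Finset.sum_mul, map_sum]
  refine Finset.sum_eq_zero fun i _ => ?_
  have : P.ε (D.basis i * ∑ j, P.ε (D.basis j * c) • D.dual j) = P.ε (D.basis i * c) := by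
    rw [Finset.mul_sum, map_sum, Finset.sum_eq_single i]
    · simp [D.ε_same]
    · intro j _ hj
      simp [D.ε_ne i j hj.symm]
    · simp
  rw [smul_mul_assoc, map_smul, mul_sub, map_sub, this, sub_self, smul_zero]

theorem tm_sum_left {κ : Type} (s : Finset κ) (f : κ → A) (b : A) :
    tm (∑ i ∈ s, f i) b = ∑ i ∈ s, tm (f i) b := by
  classical
  induction s using Finset.induction_on with
  | empty => simp [tm_zero_left]
  | insert a s ha ih => rw [Finset.sum_insert ha, Finset.sum_insert ha, tm_add_left, ih]

theorem tm_sum_right {κ : Type} (s : Finset κ) (a : A) (f : κ → A) :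
    tm a (∑ i ∈ s, f i) = ∑ i ∈ s, tm a (f i) := by
  classical
  induction s using Finset.induction_on with
  | empty => simp [tm_zero_right]
  | insert a s ha ih => rw [Finset.sum_insert ha, Finset.sum_insert ha, tm_add_right, ih]

theorem diag_mul_left {k : ℕ} {a : A} (ha : a ∈ A.gr k) :
    D.diag * tm a 1 = D.diag * tm 1 a := by
  have hL : D.diag * tm a 1 = ∑ i, ∑ j,
      ((-1 : ℚ) ^ (D.deg i + D.codeg i * k) * P.ε (D.basis i * a * D.dual j)) •
        tm (D.basis j) (D.dual i) := by
    rw [diag, Finset.sum_mul]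
    refine Finset.sum_congr rfl fun i _ => ?_
    rw [smul_mul_assoc, tm_mul_tm _ (D.dual_mem i) ha, mul_one]
    conv_lhs => rw [D.expand (D.basis i * a)]
    simp only [tm_sum_left, tm_smul_left, Finset.smul_sum, smul_smul, pow_add]
    simp only [mul_assoc]
  have hR : D.diag * tm 1 a = ∑ j, ∑ i,
      ((-1 : ℚ) ^ D.deg j * P.ε (D.basis i * (D.dual j * a))) • tm (D.basis j) (D.dual i) := by
    rw [diag, Finset.sum_mul]
    refine Finset.sum_congr rfl fun j _ => ?_
    rw [smul_mul_assoc, tm_mul_tm _ (D.dual_mem j) (SetLike.one_mem_graded A.gr), mul_one]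
    conv_lhs => rw [D.expand_dual (D.dual j * a)]
    simp only [tm_sum_right, tm_smul_right, Finset.smul_sum, smul_smul, mul_zero, pow_zero,
      one_mul]
  rw [hL, hR, Finset.sum_comm]
  refine Finset.sum_congr rfl fun j _ => Finset.sum_congr rfl fun i _ => ?_
  congr 1
  rw [A.graded_comm (D.dual_mem j) ha, mul_smul_comm, map_smul, smul_eq_mul, ← mul_assoc,
    ← pow_add, ← mul_assoc]
  by_cases h : D.deg i + k + D.codeg j = n
  · have h1 := D.deg_add_codeg i
    have h2 := D.deg_add_codeg j
    have h3 : D.codeg i = k + D.codeg j := by omega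
    have h4 : D.deg j = D.deg i + k := by omega
    rw [h3, h4, show D.deg i + (k + D.codeg j) * k = (D.deg i + D.codeg j * k) + k * k by ring,
      show D.deg i + k + D.codeg j * k = (D.deg i + D.codeg j * k) + k by ring, pow_add,
      pow_add _ _ k]
    congr 2
    rcases Nat.even_or_odd k with hk | hk
    · rw [hk.neg_one_pow, (hk.mul_left k).neg_one_pow]
    · rw [hk.neg_one_pow, (hk.mul hk).neg_one_pow]
  · rw [P.ε_of_ne (SetLike.mul_mem_graded (SetLike.mul_mem_graded (D.basis_mem i) ha)
      (D.dual_mem j)) h, mul_zero, mul_zero]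

theorem d_diag : tensorD A A D.diag = 0 := by
  have h1 : tensorD A A D.diag = ∑ i, ((-1 : ℚ) ^ D.deg i • tm (A.d (D.basis i)) (D.dual i) +
      tm (D.basis i) (A.d (D.dual i))) := by
    rw [diag, map_sum]
    refine Finset.sum_congr rfl fun i _ => ?_
    rw [map_smul]
    rw [tensorD_tm (D.basis_mem i), smul_add, smul_smul, ← pow_add,
      (Even.add_self (D.deg i)).neg_one_pow, one_smul]
  have hL : ∑ i, (-1 : ℚ) ^ D.deg i • tm (A.d (D.basis i)) (D.dual i) = ∑ i, ∑ j,
      ((-1 : ℚ) ^ D.deg i * P.ε (A.d (D.basis i) * D.dual j)) • tm (D.basis j) (D.dual i) := by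
    refine Finset.sum_congr rfl fun i _ => ?_
    conv_lhs => rw [D.expand (A.d (D.basis i))]
    simp only [tm_sum_left, tm_smul_left, Finset.smul_sum, smul_smul]
  have hR : ∑ j, tm (D.basis j) (A.d (D.dual j)) = ∑ j, ∑ i,
      P.ε (D.basis i * A.d (D.dual j)) • tm (D.basis j) (D.dual i) := by
    refine Finset.sum_congr rfl fun j _ => ?_
    conv_lhs => rw [D.expand_dual (A.d (D.dual j))]
    simp only [tm_sum_right, tm_smul_right]
  rw [h1, Finset.sum_add_distrib, hL, hR, Finset.sum_comm, ← Finset.sum_add_distrib]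
  refine Finset.sum_eq_zero fun j _ => ?_
  rw [← Finset.sum_add_distrib]
  refine Finset.sum_eq_zero fun i _ => ?_
  rw [← add_smul]
  have h := P.ε_d (D.basis i * D.dual j)
  rw [A.leibniz (D.basis_mem i), map_add, map_smul, smul_eq_mul] at h
  have : (-1 : ℚ) ^ D.deg i * P.ε (A.d (D.basis i) * D.dual j) +
      P.ε (D.basis i * A.d (D.dual j)) = 0 := by
    have e : (-1 : ℚ) ^ D.deg i * (-1 : ℚ) ^ D.deg i = 1 := by
      rw [← pow_add, (Even.add_self (D.deg i)).neg_one_pow]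
    linear_combination (-1 : ℚ) ^ D.deg i * h - P.ε (D.basis i * A.d (D.dual j)) * e
  simp [this]

end DualBasis

/-- The multiplication `μ : A ⊗ A → A`, `a ⊗ b ↦ a b`. -/
noncomputable def CDGA.mulHom (A : CDGA) : TensorCarrier A A →ₐ[ℚ] A :=
  GradedTensorProduct.lift A.gr A.gr (AlgHom.id ℚ A) (AlgHom.id ℚ A) (by
    intro i j a b
    have h := A.graded_comm a.2 b.2
    simp only [AlgHom.coe_id, id_eq]
    rw [h, mul_comm j i]
    rcases Nat.even_or_odd (i * j) with h | h
    · simp [h.neg_one_pow]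
    · simp [h.neg_one_pow])

theorem CDGA.mulHom_tm (A : CDGA) (a b : A) : A.mulHom (tm a b) = a * b := rfl

theorem CDGA.mulHom_mem {A : CDGA} {k : ℕ} {z : TensorCarrier A A} (hz : z ∈ tensorGr A A k) :
    A.mulHom z ∈ A.gr k := by
  refine tensorGr_induction (P := fun z => A.mulHom z ∈ A.gr k) ?_ ?_ ?_ hz
  · simp
  · intro i j hij a ha b hb
    rw [mulHom_tm]
    exact hij ▸ SetLike.mul_mem_graded ha hb
  · intro x y h1 h2
    rw [map_add]
    exact Submodule.add_mem _ h1 h2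

theorem CDGA.mulHom_d {A : CDGA} (z : TensorCarrier A A) :
    A.mulHom (tensorD A A z) = A.d (A.mulHom z) := by
  refine tensor_induction (P := fun z => A.mulHom (tensorD A A z) = A.d (A.mulHom z)) ?_ ?_ ?_ z
  · simp
  · intro i j a ha b hb
    rw [tensorD_tm ha, map_add, map_smul]
    simp only [mulHom_tm]
    exact (A.leibniz ha b).symm
  · intro x y h1 h2
    simp only [map_add, h1, h2]

theorem CDGA.one_tm_mul (A : CDGA) (a b : A) :
    (tm 1 a * tm 1 b : TensorCarrier A A) = tm 1 (a * b) :=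
  (map_mul (GradedTensorProduct.includeRight A.gr A.gr) a b).symm

theorem DualBasis.diag_mul {A : CDGA} {n : ℕ} {P : PoincareDuality A n} (D : DualBasis P)
    (z : TensorCarrier A A) : D.diag * z = D.diag * tm 1 (A.mulHom z) := by
  refine tensor_induction (P := fun z => D.diag * z = D.diag * tm 1 (A.mulHom z)) ?_ ?_ ?_ z
  · rw [map_zero, tm_zero_right]
  · intro i j a ha b hb
    rw [mulHom_tm, ← one_tm_mul, ← mul_assoc, ← D.diag_mul_left ha, mul_assoc]
    congr 1
    exact (GradedTensorProduct.tmul_one_mul_one_tmul A.gr A.gr a b).symm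
  · intro x y h1 h2
    rw [map_add, tm_add_right, mul_add, mul_add, h1, h2]

end RHT

namespace RHT

open CDGA

/-! ### The mapping cone of `Δ^!` and the CDGAs `C(ξ)` -/

/-- The vector space underlying the mapping cone `C(Δ^!) = A ⊗ A ⊕ s s⁻ⁿ A`. The pair `(z, x)`
stands for `z + s s⁻ⁿ x`. -/
abbrev Cone (A : CDGA) : Type := TensorCarrier A A × A

namespace Cone

/-- `(s s⁻ⁿ A)^k = A^{k-(n-1)}`. -/
def ssGr (A : CDGA) (n k : ℕ) : Submodule ℚ A := if n - 1 ≤ k then A.gr (k - (n - 1)) else ⊥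

/-- The degree `k` part of the mapping cone. -/
noncomputable def gr (A : CDGA) (n k : ℕ) : Submodule ℚ (Cone A) :=
  (tensorGr A A k).prod (ssGr A n k)

/-- The submodule `C(Δ^!)^{≥ 2n-1}`. -/
noncomputable def top (A : CDGA) (n : ℕ) : Submodule ℚ (Cone A) :=
  ⨆ k, ⨆ (_ : 2 * n - 1 ≤ k), gr A n k

variable {A : CDGA} {n : ℕ}

theorem ss_mem {j k : ℕ} (h : j + (n - 1) = k) {x : A} (hx : x ∈ A.gr j) : x ∈ ssGr A n k := by
  have h1 : n - 1 ≤ k := by omega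
  have h2 : k - (n - 1) = j := by omega
  rwa [ssGr, if_pos h1, h2]

theorem ss_cases {k : ℕ} {x : A} (hx : x ∈ ssGr A n k) :
    x = 0 ∨ ∃ j, j + (n - 1) = k ∧ x ∈ A.gr j := by
  unfold ssGr at hx
  split_ifs at hx with h
  · exact Or.inr ⟨k - (n - 1), by omega, hx⟩
  · exact Or.inl hx

theorem inl_mem {k : ℕ} {z : TensorCarrier A A} (hz : z ∈ tensorGr A A k) :
    ((z, 0) : Cone A) ∈ gr A n k := ⟨hz, Submodule.zero_mem _⟩

theorem inr_mem {j k : ℕ} (h : j + (n - 1) = k) {x : A} (hx : x ∈ A.gr j) :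
    ((0, x) : Cone A) ∈ gr A n k := ⟨Submodule.zero_mem _, ss_mem h hx⟩

theorem gr_le_top {k : ℕ} (hk : 2 * n - 1 ≤ k) : gr A n k ≤ top A n :=
  le_iSup_of_le k (le_iSup_of_le hk le_rfl)

theorem top_le {S : Submodule ℚ (Cone A)} (h : ∀ k, 2 * n - 1 ≤ k → ∀ c ∈ gr A n k, c ∈ S) :
    top A n ≤ S :=
  iSup_le fun k => iSup_le fun hk => h k hk

theorem cone_induction (n : ℕ) {Q : Cone A → Prop} (h0 : Q 0)
    (h : ∀ k, ∀ c ∈ gr A n k, Q c) (hadd : ∀ x y, Q x → Q y → Q (x + y)) (c : Cone A) : Q c := by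
  obtain ⟨z, x⟩ := c
  have hz : Q (z, 0) := by
    refine tensor_induction (P := fun z => Q (z, 0)) h0 ?_ ?_ z
    · intro i j a ha b hb
      exact h (i + j) _ (inl_mem (tm_mem rfl ha hb))
    · intro x y h1 h2
      simpa using hadd _ _ h1 h2
  have hx : Q (0, x) := by
    refine hom_induction (P := fun x => Q (0, x)) h0 ?_ ?_ x
    · intro j a ha
      exact h (j + (n - 1)) _ (inr_mem rfl ha)
    · intro x y h1 h2
      simpa using hadd _ _ h1 h2
  simpa using hadd _ _ hz hx

theorem proj_zero_mul (a b : A) : A.proj 0 (a * b) = A.proj 0 a * A.proj 0 b :=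
  map_mul (GradedRing.projZeroRingHom A.gr) a b

/-- The differential of the mapping cone, `δ(z + s s⁻ⁿ x) = dz + Δ (1 ⊗ x) + s s⁻ⁿ dx`, for
`n` odd. (For any `n` the mapping cone convention gives `-s d(s⁻ⁿ x) = (-1)^{n+1} s s⁻ⁿ dx`.) -/
noncomputable def δ {P : PoincareDuality A n} (D : DualBasis P) : Cone A →ₗ[ℚ] Cone A where
  toFun c := (tensorD A A c.1 + D.diag * tm 1 c.2, A.d c.2)
  map_add' c c' := by
    ext
    · simp only [Prod.fst_add, Prod.snd_add, map_add, tm_add_right, mul_add]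
      abel
    · simp
  map_smul' q c := by
    ext
    · simp [tm_smul_right]
    · simp

/-- The product on the mapping cone of `Δ^!`, for `n` odd, whose reduction modulo
`C(Δ^!)^{≥ 2n-1}` is the product of `C(ξ)`. For homogeneous elements it is characterised by
* `(a ⊗ b) · (a' ⊗ b') = (-1)^{|a'||b|} a a' ⊗ b b'`,
* `(a ⊗ b) · s s⁻ⁿ x = s s⁻ⁿ (a b x) = (-1)^{|b||x|} s s⁻ⁿ (a x b)`,
* `s s⁻ⁿ x · (a ⊗ b) = s s⁻ⁿ (x a b) = (-1)^{|a||x|} s s⁻ⁿ (a x b)`,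
* `s s⁻ⁿ x · s s⁻ⁿ x' = 0` if `|x| + |x'| ≥ 1`,
* `s s⁻ⁿ 1 · s s⁻ⁿ 1 = ξ`. -/
noncomputable def mul (ξ : TensorCarrier A A) : Cone A →ₗ[ℚ] Cone A →ₗ[ℚ] Cone A :=
  LinearMap.mk₂ ℚ
    (fun c c' => (c.1 * c'.1 + ξ * tm (A.proj 0 c.2 * A.proj 0 c'.2) 1,
      A.mulHom c.1 * c'.2 + c.2 * A.mulHom c'.1))
    (by
      intro c c' e
      ext
      · simp only [Prod.fst_add, Prod.snd_add, map_add, add_mul, mul_add, tm_add_left]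
        abel
      · simp only [Prod.fst_add, Prod.snd_add, map_add, add_mul]
        abel)
    (by
      intro q c e
      ext
      · simp [tm_smul_left]
      · simp only [Prod.smul_fst, Prod.smul_snd, map_smul, smul_mul_assoc, smul_add])
    (by
      intro c c' e
      ext
      · simp only [Prod.fst_add, Prod.snd_add, map_add, mul_add, tm_add_left]
        abel
      · simp only [Prod.fst_add, Prod.snd_add, map_add, mul_add]
        abel)
    (by
      intro q c e
      ext
      · simp [tm_smul_left]
      · simp only [Prod.smul_fst, Prod.smul_snd, map_smul, mul_smul_comm, smul_add])

theorem mul_apply (ξ : TensorCarrier A A) (c c' : Cone A) :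
    mul ξ c c' = (c.1 * c'.1 + ξ * tm (A.proj 0 c.2 * A.proj 0 c'.2) 1,
      A.mulHom c.1 * c'.2 + c.2 * A.mulHom c'.1) := rfl

theorem tm_one_mem {k : ℕ} {a : A} (ha : a ∈ A.gr k) : tm a 1 ∈ tensorGr A A k :=
  tm_mem (add_zero k) ha (SetLike.one_mem_graded A.gr)

theorem one_tm_mem {k : ℕ} {a : A} (ha : a ∈ A.gr k) : tm 1 a ∈ tensorGr A A k :=
  tm_mem (zero_add k) (SetLike.one_mem_graded A.gr) ha

theorem proj_zero_mul_mem (a b : A) : A.proj 0 a * A.proj 0 b ∈ A.gr 0 := by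
  rw [← proj_zero_mul]
  exact A.proj_mem 0 _

theorem xi_mem {ξ : TensorCarrier A A} (hξ : ξ ∈ tensorGr A A (2 * n - 2)) (a b : A) :
    ξ * tm (A.proj 0 a * A.proj 0 b) 1 ∈ tensorGr A A (2 * n - 2) := by
  simpa using SetLike.mul_mem_graded hξ (tm_one_mem (proj_zero_mul_mem a b))

theorem mul_mem {ξ : TensorCarrier A A} (hξ : ξ ∈ tensorGr A A (2 * n - 2)) {k l : ℕ}
    {c c' : Cone A} (hc : c ∈ gr A n k) (hc' : c' ∈ gr A n l) : mul ξ c c' ∈ gr A n (k + l) := by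
  obtain ⟨z, x⟩ := c
  obtain ⟨z', x'⟩ := c'
  obtain ⟨hz, hx⟩ := hc
  obtain ⟨hz', hx'⟩ := hc'
  simp only at hz hx hz' hx'
  refine ⟨Submodule.add_mem _ (SetLike.mul_mem_graded hz hz') ?_, Submodule.add_mem _ ?_ ?_⟩
  · simp only
    rcases ss_cases hx with rfl | ⟨j, hj, hx⟩
    · simp [tm_zero_left]
    rcases ss_cases hx' with rfl | ⟨j', hj', hx'⟩
    · simp [tm_zero_left]
    by_cases h : j = 0
    · by_cases h' : j' = 0
      · have := xi_mem hξ x x'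
        rwa [show k + l = 2 * n - 2 by omega]
      · rw [proj_ne hx' h', mul_zero, tm_zero_left, mul_zero]
        exact Submodule.zero_mem _
    · rw [proj_ne hx h, zero_mul, tm_zero_left, mul_zero]
      exact Submodule.zero_mem _
  · rcases ss_cases hx' with rfl | ⟨j', hj', hx'⟩
    · simp
    · exact ss_mem (j := k + j') (by omega) (SetLike.mul_mem_graded (mulHom_mem hz) hx')
  · rcases ss_cases hx with rfl | ⟨j, hj, hx⟩
    · simp
    · exact ss_mem (j := j + l) (by omega) (SetLike.mul_mem_graded hx (mulHom_mem hz'))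

theorem mul_top_left {ξ : TensorCarrier A A} (hξ : ξ ∈ tensorGr A A (2 * n - 2)) {c : Cone A}
    (hc : c ∈ top A n) (c' : Cone A) : mul ξ c c' ∈ top A n := by
  refine cone_induction n (Q := fun c' => mul ξ c c' ∈ top A n)
    (by rw [map_zero]; exact Submodule.zero_mem _) ?_ ?_ c'
  · intro l c' hc'
    have : top A n ≤ (top A n).comap ((mul ξ).flip c') :=
      top_le fun k hk c hc => by
        rw [Submodule.mem_comap, LinearMap.flip_apply]
        exact gr_le_top (by omega) (mul_mem hξ hc hc')
    exact this hc
  · intro x y h1 h2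
    rw [map_add]
    exact Submodule.add_mem _ h1 h2

theorem mul_top_right {ξ : TensorCarrier A A} (hξ : ξ ∈ tensorGr A A (2 * n - 2)) {c : Cone A}
    (hc : c ∈ top A n) (c' : Cone A) : mul ξ c' c ∈ top A n := by
  refine cone_induction n (Q := fun c' => mul ξ c' c ∈ top A n)
    (by rw [LinearMap.map_zero₂]; exact Submodule.zero_mem _) ?_ ?_ c'
  · intro l c' hc'
    have : top A n ≤ (top A n).comap (mul ξ c') :=
      top_le fun k hk c hc => gr_le_top (by omega) (mul_mem hξ hc' hc)
    exact this hc
  · intro x y h1 h2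
    rw [map_add, LinearMap.add_apply]
    exact Submodule.add_mem _ h1 h2

theorem inl_top {k : ℕ} (hk : 2 * n - 1 ≤ k) {z : TensorCarrier A A} (hz : z ∈ tensorGr A A k) :
    ((z, 0) : Cone A) ∈ top A n := gr_le_top hk (inl_mem hz)

/-- Elements of `A` of degree at least `n` give elements of degree at least `2n-1`. -/
theorem inr_top (hn : 1 ≤ n) {k : ℕ} (hk : n ≤ k) {a : A} (ha : a ∈ A.gr k) (b c : A) :
    ((0, b * a * c) : Cone A) ∈ top A n := by
  refine hom_induction (P := fun b => ((0, b * a * c) : Cone A) ∈ top A n) ?_ ?_ ?_ b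
  · simp only [zero_mul]
    exact Submodule.zero_mem _
  · intro i b hb
    refine hom_induction (P := fun c => ((0, b * a * c) : Cone A) ∈ top A n) ?_ ?_ ?_ c
    · simp only [mul_zero]
      exact Submodule.zero_mem _
    · intro j c hc
      exact gr_le_top (k := i + k + j + (n - 1)) (by omega)
        (inr_mem rfl (SetLike.mul_mem_graded (SetLike.mul_mem_graded hb ha) hc))
    · intro x y h1 h2
      rw [mul_add]
      simpa using Submodule.add_mem _ h1 h2
  · intro x y h1 h2
    rw [add_mul, add_mul]
    simpa using Submodule.add_mem _ h1 h2

theorem three_le {P : PoincareDuality A n} (hn : Odd n) (hA : A.IsOneConnected) : 3 ≤ n := by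
  by_contra h
  have h1 : n = 1 := by
    obtain ⟨m, rfl⟩ := hn
    omega
  have := hA.nontrivial
  obtain ⟨l, hl, b, hb, hb'⟩ := P.nondegenerate (SetLike.one_mem_graded A.gr) one_ne_zero
  rw [show l = 1 by omega, hA.gr_one, Submodule.mem_bot] at hb
  simp [hb] at hb'

theorem xi_mul (hn : 1 ≤ n) (hA : A.IsOneConnected) {ξ : TensorCarrier A A}
    (hξ : ξ ∈ tensorGr A A (2 * n - 2)) {s : A} (hs : s ∈ A.gr 0) (z : TensorCarrier A A) :
    ((ξ * tm s 1 * z - ξ * tm (s * A.proj 0 (A.mulHom z)) 1, 0) : Cone A) ∈ top A n ∧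
    ((z * (ξ * tm s 1) - ξ * tm (A.proj 0 (A.mulHom z) * s) 1, 0) : Cone A) ∈ top A n := by
  have hξs : ξ * tm s 1 ∈ tensorGr A A (2 * n - 2) := by
    simpa using SetLike.mul_mem_graded hξ (tm_one_mem hs)
  refine tensor_induction (P := fun z =>
    ((ξ * tm s 1 * z - ξ * tm (s * A.proj 0 (A.mulHom z)) 1, 0) : Cone A) ∈ top A n ∧
    ((z * (ξ * tm s 1) - ξ * tm (A.proj 0 (A.mulHom z) * s) 1, 0) : Cone A) ∈ top A n) ?_ ?_ ?_ z
  · simp [tm_zero_left]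
    exact Submodule.zero_mem _
  · intro i j a ha b hb
    by_cases hij : i + j = 0
    · obtain ⟨rfl, rfl⟩ : i = 0 ∧ j = 0 := by omega
      obtain ⟨q, rfl⟩ := hA.gr_zero a ha
      obtain ⟨r, rfl⟩ := hA.gr_zero b hb
      have e : (tm (algebraMap ℚ A q) (algebraMap ℚ A r) : TensorCarrier A A) = (q * r) • 1 := by
        simp only [Algebra.algebraMap_eq_smul_one, tm_smul_left, tm_smul_right, smul_smul, mul_comm r q]
        rfl
      have e1 : A.proj 0 (1 : A) = 1 := proj_same (SetLike.one_mem_graded A.gr)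
      rw [e, map_smul, map_one, map_smul, e1]
      simp [tm_smul_left]
      exact Submodule.zero_mem _
    · have hp : A.proj 0 (A.mulHom (tm a b)) = 0 := by
        rw [mulHom_tm]
        exact proj_ne (SetLike.mul_mem_graded ha hb) hij
      rw [hp, mul_zero, zero_mul, tm_zero_left, mul_zero, sub_zero, sub_zero]
      exact ⟨inl_top (by omega) (SetLike.mul_mem_graded hξs (tm_mem rfl ha hb)),
        inl_top (by omega) (SetLike.mul_mem_graded (tm_mem rfl ha hb) hξs)⟩
  · rintro x y ⟨h1, h2⟩ ⟨h3, h4⟩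
    constructor
    · convert! Submodule.add_mem _ h1 h3 using 1
      ext
      · simp only [Prod.mk_add_mk, map_add, mul_add, tm_add_left]
        abel
      · simp
    · convert! Submodule.add_mem _ h2 h4 using 1
      ext
      · simp only [Prod.mk_add_mk, map_add, mul_add, add_mul, tm_add_left]
        abel
      · simp

theorem mul_assoc_mod (hn : 2 ≤ n) (hA : A.IsOneConnected) {ξ : TensorCarrier A A}
    (hξ : ξ ∈ tensorGr A A (2 * n - 2)) (c c' c'' : Cone A) :
    mul ξ (mul ξ c c') c'' - mul ξ c (mul ξ c' c'') ∈ top A n := by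
  obtain ⟨z, x⟩ := c
  obtain ⟨z', x'⟩ := c'
  obtain ⟨z'', x''⟩ := c''
  have h1 := (xi_mul (show 1 ≤ n by omega) hA hξ (proj_zero_mul_mem x x') z'').1
  have h2 := (xi_mul (show 1 ≤ n by omega) hA hξ (proj_zero_mul_mem x' x'') z).2
  have h3 := inr_top (show 1 ≤ n by omega) (k := 2 * n - 2) (by omega) (mulHom_mem (xi_mem hξ x x')) 1 x''
  have h4 := inr_top (show 1 ≤ n by omega) (k := 2 * n - 2) (by omega) (mulHom_mem (xi_mem hξ x' x'')) x 1
  convert! Submodule.sub_mem _ (Submodule.add_mem _ h1 h3) (Submodule.add_mem _ h2 h4) using 1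
  ext
  · simp only [mul_apply, Prod.fst_sub, Prod.fst_add, map_add, proj_zero_mul, mul_add, add_mul,
      tm_add_left, mul_assoc]
    abel
  · simp only [mul_apply, Prod.snd_sub, Prod.snd_add, map_add, map_mul, mul_add, add_mul,
      mul_assoc, one_mul, mul_one]
    abel

theorem mul_comm_gr (hn : Odd n) (ξ : TensorCarrier A A) {k l : ℕ} {c c' : Cone A}
    (hc : c ∈ gr A n k) (hc' : c' ∈ gr A n l) :
    mul ξ c c' = (-1 : ℚ) ^ (k * l) • mul ξ c' c := by
  obtain ⟨z, x⟩ := c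
  obtain ⟨z', x'⟩ := c'
  obtain ⟨hz, hx⟩ := hc
  obtain ⟨hz', hx'⟩ := hc'
  simp only at hz hx hz' hx'
  have hne : Even (n - 1) := by
    obtain ⟨m, rfl⟩ := hn
    exact ⟨m, by omega⟩
  have sgn_eq : ∀ {a b : ℕ}, (Even a ↔ Even b) → (-1 : ℚ) ^ a = (-1) ^ b := by
    intro a b h
    rcases Nat.even_or_odd a with ha | ha
    · rw [ha.neg_one_pow, (h.1 ha).neg_one_pow]
    · rw [ha.neg_one_pow, Odd.neg_one_pow]
      rw [← Nat.not_even_iff_odd] at ha ⊢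
      exact fun hb => ha (h.2 hb)
  have e1 : A.proj 0 x * A.proj 0 x' = (-1 : ℚ) ^ (k * l) • (A.proj 0 x' * A.proj 0 x) := by
    rcases ss_cases hx with rfl | ⟨j, hj, hx⟩
    · simp
    rcases ss_cases hx' with rfl | ⟨j', hj', hx'⟩
    · simp
    by_cases h : j = 0
    · have := A.graded_comm (A.proj_mem 0 x) (A.proj_mem 0 x')
      rw [this, sgn_eq (a := 0 * 0) (b := k * l)]
      subst h
      rw [zero_add] at hj
      subst hj
      simp [hne.mul_right]
    · rw [proj_ne hx h]
      simp
  have e2 : A.mulHom z * x' = (-1 : ℚ) ^ (k * l) • (x' * A.mulHom z) := by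
    rcases ss_cases hx' with rfl | ⟨j', hj', hx'⟩
    · simp
    rw [A.graded_comm (mulHom_mem hz) hx', sgn_eq]
    rw [← hj', Nat.even_mul, Nat.even_mul, Nat.even_add]
    simp [hne]
  have e3 : x * A.mulHom z' = (-1 : ℚ) ^ (k * l) • (A.mulHom z' * x) := by
    rcases ss_cases hx with rfl | ⟨j, hj, hx⟩
    · simp
    rw [A.graded_comm hx (mulHom_mem hz'), sgn_eq]
    rw [← hj, Nat.even_mul, Nat.even_mul, Nat.even_add]
    simp [hne]
  have e4 := (tensor A A).graded_comm hz hz'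
  ext
  · simp only [mul_apply, Prod.smul_fst, smul_add, e1, e4, tm_smul_left, mul_smul_comm]
  · simp only [mul_apply, Prod.smul_snd, smul_add, e2, e3]
    abel

section

variable {P : PoincareDuality A n} (D : DualBasis P)

theorem δ_apply (c : Cone A) : δ D c = (tensorD A A c.1 + D.diag * tm 1 c.2, A.d c.2) := rfl

theorem d_one : A.d 1 = 0 := by
  have h := A.leibniz (k := 0) (SetLike.one_mem_graded A.gr) 1
  simpa using h

theorem tensorD_one_tm (x : A) : tensorD A A (tm 1 x) = tm 1 (A.d x) := by
  rw [tensorD_tm (SetLike.one_mem_graded A.gr), d_one, tm_zero_left]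
  simp

theorem δ_δ (hn : Odd n) (c : Cone A) : δ D (δ D c) = 0 := by
  have h := (tensor A A).leibniz D.diag_mem (tm 1 c.2)
  simp only [D.d_diag, zero_mul, zero_add, hn.neg_one_pow, tensorD_one_tm] at h
  have h' := (tensor A A).d_d c.1
  simp only at h'
  ext
  · simp [δ_apply, h, h']
  · simp [δ_apply, A.d_d]

theorem δ_mem (hn : Odd n) {k : ℕ} {c : Cone A} (hc : c ∈ gr A n k) : δ D c ∈ gr A n (k + 1) := by
  have h1 : 1 ≤ n := hn.pos
  obtain ⟨z, x⟩ := c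
  obtain ⟨hz, hx⟩ := hc
  simp only at hz hx
  refine ⟨Submodule.add_mem _ ((tensor A A).d_mem hz) ?_, ?_⟩
  · rcases ss_cases hx with rfl | ⟨j, hj, hx⟩
    · simp [tm_zero_right]
    · have := SetLike.mul_mem_graded D.diag_mem (one_tm_mem hx)
      rwa [show k + 1 = n + j by omega]
  · rcases ss_cases hx with rfl | ⟨j, hj, hx⟩
    · simp [δ_apply]
    · exact ss_mem (by omega) (A.d_mem hx)

theorem δ_top (hn : Odd n) {c : Cone A} (hc : c ∈ top A n) : δ D c ∈ top A n := by
  have : top A n ≤ (top A n).comap (δ D) :=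
    top_le fun k hk c hc => gr_le_top (by omega) (δ_mem D hn hc)
  exact this hc

theorem leibniz_mod (hn : Odd n) {ξ : TensorCarrier A A}
    (hξ : ξ ∈ tensorGr A A (2 * n - 2)) {k : ℕ} {c : Cone A} (hc : c ∈ gr A n k) (c' : Cone A) :
    δ D (mul ξ c c') - (mul ξ (δ D c) c' + (-1 : ℚ) ^ k • mul ξ c (δ D c')) ∈ top A n := by
  have h1 : 1 ≤ n := hn.pos
  obtain ⟨z, x⟩ := c
  obtain ⟨z', x'⟩ := c'
  obtain ⟨hz, hx⟩ := hc
  simp only at hz hx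
  have t1 : ((tensorD A A (ξ * tm (A.proj 0 x * A.proj 0 x') 1), 0) : Cone A) ∈ top A n :=
    inl_top (k := 2 * n - 2 + 1) (by omega) ((tensor A A).d_mem (xi_mem hξ x x'))
  have hΔ : A.mulHom D.diag ∈ A.gr n := mulHom_mem D.diag_mem
  have t2 := inr_top h1 le_rfl hΔ 1 (x * x')
  have t3 := inr_top h1 le_rfl hΔ x x'
  have p0 : ∀ a : A, A.proj 0 (A.d a) = 0 := by
    intro a
    refine hom_induction (P := fun a => A.proj 0 (A.d a) = 0) (by simp) ?_ ?_ a
    · intro j a ha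
      exact proj_ne (A.d_mem ha) (by omega)
    · intro x y h1 h2
      rw [map_add, map_add, h1, h2, add_zero]
  have e1 : tensorD A A (z * z') = tensorD A A z * z' + (-1 : ℚ) ^ k • (z * tensorD A A z') :=
    (tensor A A).leibniz hz z'
  have e2 : D.diag * tm 1 (x * A.mulHom z') = D.diag * tm 1 x * z' := by
    rw [mul_assoc, D.diag_mul (tm 1 x * z'), map_mul, mulHom_tm, one_mul]
  have e3 : D.diag * tm 1 (A.mulHom z * x') = (-1 : ℚ) ^ k • (z * (D.diag * tm 1 x')) := by
    have hc : z * D.diag = (-1 : ℚ) ^ (k * n) • (D.diag * z) :=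
      (tensor A A).graded_comm hz D.diag_mem
    rw [← one_tm_mul, ← mul_assoc, ← D.diag_mul, ← mul_assoc z, hc, smul_mul_assoc, smul_smul,
      ← pow_add]
    have : Even (k + k * n) := by
      rw [Nat.even_add, Nat.even_mul]
      have := Nat.not_even_iff_odd.2 hn
      tauto
    rw [this.neg_one_pow, one_smul]
  have e4 : A.d (A.mulHom z * x') =
      A.d (A.mulHom z) * x' + (-1 : ℚ) ^ k • (A.mulHom z * A.d x') := A.leibniz (mulHom_mem hz) x'
  have e5 : A.d (x * A.mulHom z') =
      A.d x * A.mulHom z' + (-1 : ℚ) ^ k • (x * A.d (A.mulHom z')) := by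
    rcases ss_cases hx with rfl | ⟨j, hj, hx⟩
    · simp
    rw [A.leibniz hx]
    have hne : Even (n - 1) := by
      obtain ⟨m, rfl⟩ := hn
      exact ⟨m, by omega⟩
    rw [← hj, pow_add, hne.neg_one_pow, mul_one]
  convert! Submodule.sub_mem _ (Submodule.sub_mem _ t1 t2)
    (Submodule.smul_mem _ ((-1 : ℚ) ^ k) t3) using 1
  ext
  · simp only [mul_apply, δ_apply, Prod.fst_sub, Prod.fst_add, Prod.smul_fst, map_add, tm_add_right,
      mul_add, add_mul, e1, e2, e3, p0, mul_zero, zero_mul, tm_zero_left, smul_add, smul_zero]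
    abel
  · simp only [mul_apply, δ_apply, Prod.snd_sub, Prod.snd_add, Prod.smul_snd, map_add,
      map_mul, mulHom_d, mulHom_tm, mul_add, add_mul, e4, e5, one_mul, smul_add, mul_assoc]
    abel

end

/-- The projection of the cone to its part of degree `k`. -/
noncomputable def pr (A : CDGA) (n k : ℕ) : Cone A →ₗ[ℚ] Cone A :=
  LinearMap.prodMap ((tensor A A).proj k) (if n - 1 ≤ k then A.proj (k - (n - 1)) else 0)

theorem pr_same {k : ℕ} {c : Cone A} (hc : c ∈ gr A n k) : pr A n k c = c := by
  obtain ⟨z, x⟩ := c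
  obtain ⟨hz, hx⟩ := hc
  simp only at hz hx
  ext
  · exact proj_same (A := tensor A A) hz
  · rcases ss_cases hx with rfl | ⟨j, hj, hx⟩
    · simp [pr]
    · rw [← hj]
      simp [pr, proj_same hx]

theorem pr_ne {j k : ℕ} (h : j ≠ k) {c : Cone A} (hc : c ∈ gr A n j) : pr A n k c = 0 := by
  obtain ⟨z, x⟩ := c
  obtain ⟨hz, hx⟩ := hc
  simp only at hz hx
  ext
  · exact proj_ne (A := tensor A A) hz h
  · rcases ss_cases hx with rfl | ⟨i, hi, hx⟩
    · simp [pr]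
    · simp only [pr, LinearMap.prodMap_apply]
      split_ifs with hk
      · exact proj_ne hx (by omega)
      · rfl

theorem pr_top {k : ℕ} {c : Cone A} (hc : c ∈ top A n) : pr A n k c ∈ top A n := by
  have : top A n ≤ (top A n).comap (pr A n k) := by
    refine top_le fun j hj c hc => ?_
    rw [Submodule.mem_comap]
    by_cases h : j = k
    · subst h
      rw [pr_same hc]
      exact gr_le_top hj hc
    · rw [pr_ne h hc]
      exact Submodule.zero_mem _
  exact this hc

end Cone

/-- The data on which `C(ξ)` depends: a 1-connected Poincaré duality CDGA `A` of odd formal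
dimension `n` (with a basis used to write down the diagonal class) and `ξ ∈ (A ⊗ A)^{2n-2}`. -/
structure TwistData where
  A : CDGA
  n : ℕ
  P : PoincareDuality A n
  D : DualBasis P
  odd : Odd n
  oneConnected : A.IsOneConnected
  ξ : (tensor A A).gr (2 * n - 2)

namespace TwistData

variable (T : TwistData)

/-- The vector space `C(Δ^!) / C(Δ^!)^{≥ 2n-1}`. -/
def Carrier : Type := Cone T.A ⧸ Cone.top T.A T.n

noncomputable instance : AddCommGroup T.Carrier :=
  inferInstanceAs (AddCommGroup (Cone T.A ⧸ Cone.top T.A T.n))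

noncomputable instance : Module ℚ T.Carrier :=
  inferInstanceAs (Module ℚ (Cone T.A ⧸ Cone.top T.A T.n))

/-- The projection `C(Δ^!) → C(ξ)`. -/
noncomputable def toC : Cone T.A →ₗ[ℚ] T.Carrier := (Cone.top T.A T.n).mkQ

theorem toC_surjective : Function.Surjective T.toC := Submodule.mkQ_surjective _

theorem toC_eq_zero {c : Cone T.A} : T.toC c = 0 ↔ c ∈ Cone.top T.A T.n :=
  Submodule.Quotient.mk_eq_zero _

theorem toC_eq {c c' : Cone T.A} : T.toC c = T.toC c' ↔ c - c' ∈ Cone.top T.A T.n :=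
  Submodule.Quotient.eq _

/-- The product of `C(ξ)`, induced by the product `Cone.mul ξ` on the cone. -/
noncomputable def mulQ : T.Carrier →ₗ[ℚ] T.Carrier →ₗ[ℚ] T.Carrier :=
  (Cone.top T.A T.n).liftQ
    (LinearMap.flip ((Cone.top T.A T.n).liftQ ((Cone.mul T.ξ.1).compr₂ T.toC).flip (by
      intro c hc
      refine LinearMap.ext fun c' => ?_
      exact T.toC_eq_zero.2 (Cone.mul_top_right T.ξ.2 hc c'))))
    (by
      intro c hc
      refine LinearMap.ext fun c' => ?_
      obtain ⟨c', rfl⟩ := T.toC_surjective c'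
      exact T.toC_eq_zero.2 (Cone.mul_top_left T.ξ.2 hc c'))

theorem mulQ_mk (c c' : Cone T.A) : T.mulQ (T.toC c) (T.toC c') = T.toC (Cone.mul T.ξ.1 c c') := rfl

noncomputable instance : Ring T.Carrier :=
  { (inferInstance : AddCommGroup T.Carrier) with
    mul := fun a b => T.mulQ a b
    one := T.toC (1, 0)
    zero_mul := fun a => LinearMap.map_zero₂ T.mulQ a
    mul_zero := fun a => map_zero (T.mulQ a)
    left_distrib := fun a b c => map_add (T.mulQ a) b c
    right_distrib := fun a b c => LinearMap.map_add₂ T.mulQ a b c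
    one_mul := fun a => by
      obtain ⟨c, rfl⟩ := T.toC_surjective a
      change T.mulQ (T.toC (1, 0)) (T.toC c) = _
      rw [mulQ_mk]
      congr 1
      ext <;> simp [Cone.mul_apply, map_one, tm_zero_left]
    mul_one := fun a => by
      obtain ⟨c, rfl⟩ := T.toC_surjective a
      change T.mulQ (T.toC c) (T.toC (1, 0)) = _
      rw [mulQ_mk]
      congr 1
      ext <;> simp [Cone.mul_apply, map_one, tm_zero_left]
    mul_assoc := fun a b c => by
      obtain ⟨a, rfl⟩ := T.toC_surjective a
      obtain ⟨b, rfl⟩ := T.toC_surjective b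
      obtain ⟨c, rfl⟩ := T.toC_surjective c
      have h3 := Cone.three_le (P := T.P) T.odd T.oneConnected
      exact T.toC_eq.2 (Cone.mul_assoc_mod (by omega) T.oneConnected T.ξ.2 a b c) }

theorem toC_mul_toC (c c' : Cone T.A) : T.toC c * T.toC c' = T.toC (Cone.mul T.ξ.1 c c') := rfl

/-- `s s⁻ⁿ 1 · s s⁻ⁿ 1 = ξ`. -/
theorem ss_one_sq : T.toC (0, 1) * T.toC (0, 1) = T.toC (T.ξ.1, 0) := by
  have e1 : T.A.proj 0 (1 : T.A) = 1 := proj_same (SetLike.one_mem_graded T.A.gr)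
  have e2 : (tm 1 1 : TensorCarrier T.A T.A) = 1 := rfl
  rw [toC_mul_toC]
  congr 1
  ext <;> simp [Cone.mul_apply, e1, e2]

noncomputable instance : Algebra ℚ T.Carrier :=
  Algebra.ofModule (fun r a b => LinearMap.map_smul₂ T.mulQ r a b)
    (fun r a b => map_smul (T.mulQ a) r b)

/-- The degree `k` part of `C(ξ)`. -/
noncomputable def gr (k : ℕ) : Submodule ℚ T.Carrier := (Cone.gr T.A T.n k).map T.toC

instance : SetLike.GradedMonoid T.gr where
  one_mem := ⟨(1, 0), Cone.inl_mem (SetLike.one_mem_graded (tensorGr T.A T.A)), rfl⟩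
  mul_mem := by
    rintro k l _ _ ⟨c, hc, rfl⟩ ⟨c', hc', rfl⟩
    exact ⟨_, Cone.mul_mem T.ξ.2 hc hc', rfl⟩

theorem isInternal_gr : DirectSum.IsInternal T.gr := by
  refine isInternal_of_proj T.gr
    (fun k => (Cone.top T.A T.n).mapQ (Cone.top T.A T.n) (Cone.pr T.A T.n k)
      (fun c hc => Cone.pr_top hc)) ?_ ?_ ?_
  · rintro k _ ⟨c, hc, rfl⟩
    exact congrArg T.toC (Cone.pr_same hc)
  · rintro j k h _ ⟨c, hc, rfl⟩
    exact (congrArg T.toC (Cone.pr_ne h hc)).trans (map_zero _)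
  · intro c
    obtain ⟨c, rfl⟩ := T.toC_surjective c
    refine Cone.cone_induction T.n (Q := fun c => T.toC c ∈ ⨆ k, T.gr k) ?_ ?_ ?_ c
    · simp
    · intro k c hc
      exact Submodule.mem_iSup_of_mem k ⟨c, hc, rfl⟩
    · intro x y h1 h2
      rw [map_add]
      exact Submodule.add_mem _ h1 h2

noncomputable instance : GradedAlgebra T.gr :=
  { (inferInstance : SetLike.GradedMonoid T.gr), T.isInternal_gr.chooseDecomposition with }

/-- The differential of `C(ξ)`. -/
noncomputable def dQ : T.Carrier →ₗ[ℚ] T.Carrier :=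
  (Cone.top T.A T.n).mapQ (Cone.top T.A T.n) (Cone.δ T.D) (fun _ hc => Cone.δ_top T.D T.odd hc)

theorem dQ_mk (c : Cone T.A) : T.dQ (T.toC c) = T.toC (Cone.δ T.D c) := rfl

/-- The CDGA `C(ξ)`: the quotient `C(Δ^!) / C(Δ^!)^{≥ 2n-1}` with the product for which
`s s⁻ⁿ 1 · s s⁻ⁿ 1 = ξ`. -/
noncomputable def C : CDGA where
  carrier := T.Carrier
  gr := T.gr
  d := T.dQ
  d_mem := by
    rintro k _ ⟨c, hc, rfl⟩
    exact ⟨_, Cone.δ_mem T.D T.odd hc, rfl⟩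
  d_d := by
    intro c
    obtain ⟨c, rfl⟩ := T.toC_surjective c
    rw [dQ_mk, dQ_mk, Cone.δ_δ T.D T.odd, map_zero]
  leibniz := by
    rintro k _ ⟨c, hc, rfl⟩ c'
    obtain ⟨c', rfl⟩ := T.toC_surjective c'
    simp only [toC_mul_toC, dQ_mk, ← T.toC.map_smul, ← T.toC.map_add]
    exact T.toC_eq.2 (Cone.leibniz_mod T.D T.odd T.ξ.2 hc c')
  graded_comm := by
    rintro k l _ _ ⟨c, hc, rfl⟩ ⟨c', hc', rfl⟩
    simp only [toC_mul_toC, ← T.toC.map_smul]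
    rw [Cone.mul_comm_gr T.odd T.ξ.1 hc hc']

/-- The morphism `A ⊗ A → C(ξ)`, the composition of the inclusion `A ⊗ A → C(Δ^!)` with the
projection `C(Δ^!) → C(ξ)`. -/
noncomputable def incl : CDGAHom (tensor T.A T.A) T.C where
  toAlgHom := AlgHom.ofLinearMap (R := ℚ) (A := TensorCarrier T.A T.A) (B := T.Carrier)
    (T.toC ∘ₗ LinearMap.inl ℚ (TensorCarrier T.A T.A) T.A) rfl (by
      intro z z'
      change T.toC _ = T.toC _ * T.toC _
      rw [toC_mul_toC]
      congr 1
      ext <;> simp [Cone.mul_apply, tm_zero_left])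
  map_gr := fun {k a} h => ⟨(a, 0), Cone.inl_mem h, rfl⟩
  map_d := by
    intro z
    change T.toC _ = T.dQ (T.toC _)
    rw [dQ_mk]
    congr 1
    ext <;> simp [Cone.δ_apply, tm_zero_right]

end TwistData

end RHT

namespace RHT

open CDGA

/-- `ξ ∈ (A ⊗ A)^{2n-2}` represents `Φ(x)` for `x ∈ H^{n-2}(A)`, where
`Φ : H^{n-2}(A) → H^{2n-2}(A ⊗ A) / ([Δ])` sends `[a]` to the class of `a ⊗ ω` and `ω ∈ Aⁿ` is
the fundamental class, `ε(ω) = 1`: modulo coboundaries, `ξ = a ⊗ ω + Δ c` for a cocycle `c`. The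
CDGA `C(x)` is `C(ξ)` for any such `ξ`. -/
def Represents {A : CDGA} {n : ℕ} {P : PoincareDuality A n} (D : DualBasis P) (x : A.H (n - 2))
    (ξ : TensorCarrier A A) : Prop :=
  ∃ a : A.cocycles (n - 2), A.cls a = x ∧ ∃ ω ∈ A.gr n, P.ε ω = 1 ∧
    ∃ c ∈ (tensor A A).cocycles (n - 2),
      ξ - (tm a.1 ω + D.diag * c) ∈ (tensor A A).coboundaries (2 * n - 2)

/-! ### The cohomology algebra of `S² × S³` -/

/-- The vector space `ℚ⟨1, x, y, xy⟩` with `|x| = 2` and `|y| = 3`; the four coordinates of an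
element are its coefficients with respect to `1, x, y, xy`. -/
def S2S3 : Type := Fin 4 → ℚ

namespace S2S3

instance : AddCommGroup S2S3 := inferInstanceAs (AddCommGroup (Fin 4 → ℚ))

instance : Module ℚ S2S3 := inferInstanceAs (Module ℚ (Fin 4 → ℚ))

@[ext]
theorem ext4 {a b : S2S3} (h0 : a 0 = b 0) (h1 : a 1 = b 1) (h2 : a 2 = b 2) (h3 : a 3 = b 3) :
    a = b := by
  funext i
  fin_cases i
  exacts [h0, h1, h2, h3]

/-- The product of `ℚ[x] / (x²) ⊗ Λ(y)`: `x² = 0`, `y² = 0`, `x y = y x`. -/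
instance : Mul S2S3 where
  mul a b := ![a 0 * b 0, a 0 * b 1 + a 1 * b 0, a 0 * b 2 + a 2 * b 0,
    a 0 * b 3 + a 1 * b 2 + a 2 * b 1 + a 3 * b 0]

instance : One S2S3 where
  one := ![1, 0, 0, 0]

@[simp] theorem add_apply (a b : S2S3) (i : Fin 4) : (a + b) i = a i + b i := rfl
@[simp] theorem sub_apply (a b : S2S3) (i : Fin 4) : (a - b) i = a i - b i := rfl
@[simp] theorem smul_apply (q : ℚ) (a : S2S3) (i : Fin 4) : (q • a) i = q * a i := rfl
@[simp] theorem zero_apply (i : Fin 4) : (0 : S2S3) i = 0 := rfl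
@[simp] theorem neg_apply (a : S2S3) (i : Fin 4) : (-a) i = -a i := rfl
@[simp] theorem one_0 : (1 : S2S3) 0 = 1 := rfl
@[simp] theorem one_1 : (1 : S2S3) 1 = 0 := rfl
@[simp] theorem one_2 : (1 : S2S3) 2 = 0 := rfl
@[simp] theorem one_3 : (1 : S2S3) 3 = 0 := rfl
@[simp] theorem mul_0 (a b : S2S3) : (a * b) 0 = a 0 * b 0 := rfl
@[simp] theorem mul_1 (a b : S2S3) : (a * b) 1 = a 0 * b 1 + a 1 * b 0 := rfl
@[simp] theorem mul_2 (a b : S2S3) : (a * b) 2 = a 0 * b 2 + a 2 * b 0 := rfl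
@[simp] theorem mul_3 (a b : S2S3) :
    (a * b) 3 = a 0 * b 3 + a 1 * b 2 + a 2 * b 1 + a 3 * b 0 := rfl

instance : Ring S2S3 :=
  { (inferInstance : AddCommGroup S2S3) with
    mul := (· * ·)
    one := 1
    zero_mul := fun a => by ext <;> simp
    mul_zero := fun a => by ext <;> simp
    left_distrib := fun a b c => by ext <;> simp <;> ring
    right_distrib := fun a b c => by ext <;> simp <;> ring
    one_mul := fun a => by ext <;> simp
    mul_one := fun a => by ext <;> simp
    mul_assoc := fun a b c => by ext <;> simp <;> ring }

instance : Algebra ℚ S2S3 :=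
  Algebra.ofModule (fun q a b => by ext <;> simp <;> ring) (fun q a b => by ext <;> simp <;> ring)

/-- The degrees of `1, x, y, xy`. -/
def deg : Fin 4 → ℕ := ![0, 2, 3, 5]

/-- The elements of degree `k`. -/
def gr (k : ℕ) : Submodule ℚ S2S3 where
  carrier := {a | ∀ i, deg i ≠ k → a i = 0}
  add_mem' ha hb i hi := by simp [ha i hi, hb i hi]
  zero_mem' i _ := rfl
  smul_mem' q a ha i hi := by simp [ha i hi]

theorem mem_gr {k : ℕ} {a : S2S3} : a ∈ gr k ↔ ∀ i, deg i ≠ k → a i = 0 := Iff.rfl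

theorem mem_gr_iff {k : ℕ} {a : S2S3} : a ∈ gr k ↔
    (k ≠ 0 → a 0 = 0) ∧ (k ≠ 2 → a 1 = 0) ∧ (k ≠ 3 → a 2 = 0) ∧ (k ≠ 5 → a 3 = 0) := by
  rw [mem_gr, Fin.forall_fin_succ, Fin.forall_fin_succ, Fin.forall_fin_succ, Fin.forall_fin_succ]
  simp [deg, eq_comm]

/-- The basis `1, x, y, xy`. -/
noncomputable def basis : Module.Basis (Fin 4) ℚ S2S3 := Pi.basisFun ℚ (Fin 4)

theorem basis_apply (i j : Fin 4) : basis i j = if j = i then 1 else 0 := by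
  have : basis i = Pi.single i (1 : ℚ) := Pi.basisFun_apply ℚ (Fin 4) i
  rw [this, Pi.single_apply]

theorem basis_mem (i : Fin 4) : basis i ∈ gr (deg i) := by
  intro j hj
  rw [basis_apply, if_neg]
  rintro rfl
  exact hj rfl

instance : SetLike.GradedMonoid gr where
  one_mem := by
    rw [mem_gr_iff]
    simp
  mul_mem := by
    intro i j a b ha hb
    rw [mem_gr] at ha hb
    have key : ∀ s t, deg s + deg t ≠ i + j → a s * b t = 0 := by
      intro s t h
      by_cases hs : deg s = i
      · rw [hb t (by omega), mul_zero]
      · rw [ha s hs, zero_mul]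
    have d0 : deg 0 = 0 := rfl
    have d1 : deg 1 = 2 := rfl
    have d2 : deg 2 = 3 := rfl
    have d3 : deg 3 = 5 := rfl
    rw [mem_gr_iff]
    refine ⟨fun h => ?_, fun h => ?_, fun h => ?_, fun h => ?_⟩
    · rw [mul_0, key _ _ (by omega)]
    · rw [mul_1, key _ _ (by omega), key _ _ (by omega), add_zero]
    · rw [mul_2, key _ _ (by omega), key _ _ (by omega), add_zero]
    · rw [mul_3, key _ _ (by omega), key _ _ (by omega), key _ _ (by omega), key _ _ (by omega)]
      simp

theorem isInternal_gr : DirectSum.IsInternal gr := by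
  refine isInternal_of_proj gr
    (fun k => { toFun := fun a i => if deg i = k then a i else 0
                map_add' := fun a b => by
                  funext i
                  change (if _ then a i + b i else 0) = (if _ then a i else 0) + if _ then b i else 0
                  split_ifs <;> simp
                map_smul' := fun q a => by
                  funext i
                  change (if _ then q * a i else 0) = q * if _ then a i else 0
                  split_ifs <;> simp }) ?_ ?_ ?_
  · intro k a ha
    funext i
    change (if deg i = k then a i else 0) = a i
    split_ifs with h
    · rfl
    · exact (ha i h).symm
  · intro j k hjk a ha
    funext i
    change (if deg i = k then a i else 0) = 0
    split_ifs with h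
    · exact ha i (by omega)
    · rfl
  · intro a
    rw [← basis.sum_repr a]
    exact Submodule.sum_mem _ fun i _ => Submodule.smul_mem _ _
      (Submodule.mem_iSup_of_mem (deg i) (basis_mem i))

noncomputable instance : GradedAlgebra gr :=
  { (inferInstance : SetLike.GradedMonoid gr), isInternal_gr.chooseDecomposition with }

/-- The CDGA `A = (H^*(S² × S³; ℚ), 0)`. -/
noncomputable abbrev A : CDGA where
  carrier := S2S3
  gr := gr
  d := 0
  d_mem _ := Submodule.zero_mem _
  d_d _ := rfl
  leibniz _ _ := by simp
  graded_comm := by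
    intro i j a b ha hb
    have hc : a * b = b * a := by ext <;> simp <;> ring
    rcases Nat.even_or_odd (i * j) with h | h
    · rw [h.neg_one_pow, one_smul, hc]
    · have hi : ¬ Even i := Nat.not_even_iff_odd.2 (Nat.odd_mul.1 h).1
      have hj : ¬ Even j := Nat.not_even_iff_odd.2 (Nat.odd_mul.1 h).2
      rw [mem_gr_iff] at ha hb
      have a0 := ha.1 (by rintro rfl; exact hi (by decide))
      have a1 := ha.2.1 (by rintro rfl; exact hi (by decide))
      have b0 := hb.1 (by rintro rfl; exact hj (by decide))
      have b1 := hb.2.1 (by rintro rfl; exact hj (by decide))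
      have : a * b = 0 := by ext <;> simp [a0, a1, b0, b1]
      rw [← hc, this, smul_zero]

theorem A_oneConnected : A.IsOneConnected where
  nontrivial := ⟨⟨(0 : S2S3), (1 : S2S3), fun h => by simpa using congrFun h 0⟩⟩
  gr_zero := by
    intro a ha
    refine ⟨(a : S2S3) 0, ?_⟩
    have ha' := mem_gr_iff.1 ha
    change (a : S2S3) = algebraMap ℚ S2S3 ((a : S2S3) 0)
    rw [Algebra.algebraMap_eq_smul_one]
    refine ext4 ?_ ?_ ?_ ?_ <;> simp [ha']
  gr_one := by
    rw [eq_bot_iff]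
    intro a ha
    have ha' := mem_gr_iff.1 ha
    rw [Submodule.mem_bot]
    change (a : S2S3) = (0 : S2S3)
    refine ext4 ?_ ?_ ?_ ?_ <;> simp [ha']

/-- The orientation of `A`, given by `ε(xy) = 1`. -/
noncomputable def P : PoincareDuality A 5 where
  ε := (LinearMap.proj 3 : (Fin 4 → ℚ) →ₗ[ℚ] ℚ)
  ε_of_ne ha hk := (mem_gr_iff.1 ha).2.2.2 hk
  ε_d _ := rfl
  nondegenerate := by
    intro k a ha ha0
    by_contra hcon
    push Not at hcon
    apply ha0
    have hcon' : ∀ s, deg s ≤ 5 ∧ (deg (3 - s) = k → ((a : S2S3) * basis s) 3 = 0) := by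
      intro s
      have h5 : deg (3 - s) + deg s = 5 := by
        fin_cases s <;> rfl
      exact ⟨by omega, fun h => hcon (deg s) (by omega) (basis s) (basis_mem s)⟩
    have key : ∀ s, (a : S2S3) (3 - s) = ((a : S2S3) * basis s) 3 := by
      intro s
      fin_cases s <;> simp [basis_apply]
    funext i
    by_cases h : deg i = k
    · have h1 := key (3 - i)
      rw [sub_sub_cancel] at h1
      exact h1.trans ((hcon' (3 - i)).2 (by rwa [sub_sub_cancel]))
    · exact ha i h

/-- The basis `1, x, y, xy` with its dual basis `xy, y, x, 1`, so that
`Δ = 1 ⊗ xy + x ⊗ y - y ⊗ x - xy ⊗ 1`. -/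
noncomputable def D : DualBasis P where
  ι := Fin 4
  basis := basis
  dual i := basis (3 - i)
  deg := deg
  codeg i := deg (3 - i)
  deg_add_codeg i := by fin_cases i <;> rfl
  basis_mem := basis_mem
  dual_mem i := basis_mem (3 - i)
  ε_same i := by
    change (basis i * basis (3 - i) : S2S3) 3 = 1
    fin_cases i <;> simp [basis_apply]
  ε_ne i j h := by
    change (basis i * basis (3 - j) : S2S3) 3 = 0
    fin_cases i <;> fin_cases j <;> simp [basis_apply] at h ⊢

/-- `Δ = 1 ⊗ xy + x ⊗ y - y ⊗ x - xy ⊗ 1`. -/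
theorem diag_eq : D.diag = (tm (basis 0) (basis 3) + tm (basis 1) (basis 2)
    - tm (basis 2) (basis 1) - tm (basis 3) (basis 0) : TensorCarrier A A) := by
  have : D.diag = ∑ i : Fin 4, (-1 : ℚ) ^ deg i •
      (tm (basis i) (basis (3 - i)) : TensorCarrier A A) := rfl
  rw [this, Fin.sum_univ_four]
  have d0 : (-1 : ℚ) ^ deg 0 = 1 := by norm_num [deg]
  have d1 : (-1 : ℚ) ^ deg 1 = 1 := by norm_num [deg]
  have d2 : (-1 : ℚ) ^ deg 2 = -1 := by
    rw [show deg 2 = 3 from rfl]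
    norm_num
  have d3 : (-1 : ℚ) ^ deg 3 = -1 := by
    rw [show deg 3 = 5 from rfl]
    norm_num
  rw [d0, d1, d2, d3, one_smul, one_smul, neg_one_smul, neg_one_smul, ← sub_eq_add_neg,
    ← sub_eq_add_neg]
  rfl

/-- The data defining `C(ξ)` for `ξ ∈ (A ⊗ A)^8`. -/
noncomputable def twist (ξ : (tensor A A).gr 8) : TwistData where
  A := A
  n := 5
  P := P
  D := D
  odd := by decide
  oneConnected := A_oneConnected
  ξ := ξ

/-- The CDGA `C(ξ)` for `ξ ∈ (A ⊗ A)^8`. -/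
noncomputable def C (ξ : (tensor A A).gr 8) : CDGA := (twist ξ).C

/-- The morphism `A ⊗ A → C(ξ)`. -/
noncomputable def incl (ξ : (tensor A A).gr 8) : CDGAHom (tensor A A) (C ξ) := (twist ξ).incl

/-- Every class in `H³(A)` has a representative in `(A ⊗ A)^8`. -/
theorem exists_represents (x : A.H 3) :
    ∃ ξ : (tensor A A).gr 8, Represents D x ξ.1 := by
  obtain ⟨a, rfl⟩ := Submodule.Quotient.mk_surjective _ x
  refine ⟨⟨tm a.1 (basis 3), tm_mem (i := 3) (j := 5) rfl a.2.1 (basis_mem 3)⟩, a, rfl, basis 3,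
    basis_mem 3, ?_, 0, Submodule.zero_mem _, ?_⟩
  · change basis 3 3 = 1
    simp [basis_apply]
  · simp only [mul_zero, add_zero, sub_self]
    exact Submodule.zero_mem _

end S2S3

end RHT

/-! The degree 8 part of `A ⊗ A` has basis `y ⊗ xy`, `xy ⊗ y`, and the ideal `(Δ)` meets it in the
line spanned by `η = y ⊗ xy + xy ⊗ y = -Δ(1 ⊗ y)`. The functional `τ`, the difference of the two
coefficients, therefore identifies `H⁸(A ⊗ A)/([Δ])` with `ℚ`. It recovers `x` from any
representative of `Φ(x)` (`eq_iff_τ_eq`), so the theorem amounts to: `C(ξ)` and `C(ξ')` are weakly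
equivalent under `A ⊗ A` iff `τ ξ = τ ξ'`.

Equivalence forces `τ ξ = τ ξ'` (`τ_eq_of_weaklyEquivalent`). The value `τ ξ` is read off from a
secondary operation built out of the map from `A ⊗ A` alone. Let `X = x ⊗ 1 + 1 ⊗ x` and `Y = y ⊗ 1
- 1 ⊗ y`; then `ΔY = 0` and `YX = -Δ`. In a model `E` of `C(ξ)` under `A ⊗ A` the class `Δ` dies,
say `dw = Δ`, and then `wY` is closed and turns out to be exact, `ds = wY`. Since `d(w²) = 2wΔ` and
`d(sX) = wYX = -wΔ`, the element `w² + 2sX` is a cocycle of degree 8. In `C(ξ)` the element `w`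
becomes `s s⁻⁵ 1` plus a multiple of `x ⊗ x`, its square becomes `ξ`, and `sX` becomes exact,
whatever the choices (`map_square_sub_mem`). A single `E` mapping to both `C(ξ)` and `C(ξ')` thus
makes `ξ` and `ξ'` cohomologous in `C(ξ')`, whose coboundaries have `τ = 0`.

Equality of `τ` gives an equivalence (`weaklyEquivalent_of_τ_eq`). Now `ξ - ξ'` is a multiple of
`η`, which up to sign is the differential of `s s⁻⁵ y`. The span `J` of these two elements is an
acyclic ideal in both algebras (`acyclic_J`), and modulo `J` their products agree. The fibre product
of `C(ξ)` and `C(ξ')` over the common quotient projects to both by quasi-isomorphisms. A relative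
Sullivan model of `A ⊗ A → C(ξ) ×_J C(ξ')` then serves both sides.

Such a model is constructed by `exists_relativeSullivan_model`. The base is 1-connected and the map
is onto in cohomology, so it is enough to attach, again and again, generators of positive degree
that kill the kernel in cohomology, and to pass to the union. This rests on the free algebras `B ⊗
ΛU` and their derivations. -/

namespace RHT

open CDGA

/-! ### Free graded commutative algebras -/

namespace FreeCGA

section

variable (V : ℕ → Type) [∀ p, AddCommGroup (V p)] [∀ p, Module ℚ (V p)]

/-- The inclusion of the generators of degree `p`. -/
noncomputable def ι (p : ℕ) : V p →ₗ[ℚ] FreeCGA V :=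
  (RingQuot.mkAlgHom ℚ (FreeCGA.Rel V)).toLinearMap ∘ₗ TensorAlgebra.ι ℚ ∘ₗ DirectSum.lof ℚ ℕ V p

variable {V}

theorem ι_mul_ι {i j : ℕ} (v : V i) (w : V j) :
    ι V i v * ι V j w = (-1 : ℚ) ^ (i * j) • (ι V j w * ι V i v) := by
  have h := RingQuot.mkAlgHom_rel ℚ (FreeCGA.Rel.swap (V := V) i j v w)
  rw [map_smul, map_mul, map_mul] at h
  exact h

section lift

variable {T : Type} [Ring T] [Algebra ℚ T]

/-- The universal property of the free graded commutative algebra. -/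
noncomputable def lift (g : ∀ p, V p →ₗ[ℚ] T) (hg : ∀ i j (v : V i) (w : V j),
    g i v * g j w = (-1 : ℚ) ^ (i * j) • (g j w * g i v)) : FreeCGA V →ₐ[ℚ] T :=
  RingQuot.liftAlgHom ℚ
    ⟨TensorAlgebra.lift ℚ (DirectSum.toModule ℚ ℕ T g), by
      rintro _ _ ⟨i, j, v, w⟩
      simpa using hg i j v w⟩

@[simp]
theorem lift_ι (g : ∀ p, V p →ₗ[ℚ] T) (hg) (p : ℕ) (v : V p) : lift g hg (ι V p v) = g p v := by
  simp [lift, ι]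

theorem algHom_ext {f g : FreeCGA V →ₐ[ℚ] T} (h : ∀ p v, f (ι V p v) = g (ι V p v)) : f = g := by
  refine RingQuot.ringQuot_ext' (S := ℚ) (s := FreeCGA.Rel V) (f := f) (g := g)
    (w := TensorAlgebra.hom_ext (DirectSum.linearMap_ext ℚ fun p => ?_))
  ext v
  exact h p v

end lift

/-- Products of generators of total degree `k`. -/
inductive IsMonomial : ℕ → FreeCGA V → Prop
  | one : IsMonomial 0 1
  | mul_ι {k p : ℕ} {x : FreeCGA V} (hx : IsMonomial k x) (v : V p) :
      IsMonomial (k + p) (x * ι V p v)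

theorem IsMonomial.mul {k l : ℕ} {x y : FreeCGA V} (hx : IsMonomial k x) (hy : IsMonomial l y) :
    IsMonomial (k + l) (x * y) := by
  induction hy with
  | one => simpa using hx
  | mul_ι _ v ih =>
    rw [← mul_assoc, ← add_assoc]
    exact ih.mul_ι v

theorem IsMonomial.ι {p : ℕ} (v : V p) : IsMonomial p (ι V p v) := by
  simpa using IsMonomial.one.mul_ι v

variable (V) in
/-- The elements of degree `k`. -/
def gr (k : ℕ) : Submodule ℚ (FreeCGA V) := Submodule.span ℚ {x | IsMonomial k x}

theorem IsMonomial.mem {k : ℕ} {x : FreeCGA V} (hx : IsMonomial k x) : x ∈ gr V k :=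
  Submodule.subset_span hx

theorem ι_mem {p : ℕ} (v : V p) : ι V p v ∈ gr V p := (IsMonomial.ι v).mem

instance : SetLike.GradedMonoid (gr V) where
  one_mem := IsMonomial.one.mem
  mul_mem := by
    intro k l x y hx hy
    refine Submodule.span_induction₂ (p := fun x y _ _ => x * y ∈ gr V (k + l))
      ?_ ?_ ?_ ?_ ?_ ?_ ?_ hx hy
    · intro x y hx hy
      exact (IsMonomial.mul hx hy).mem
    · intro y _
      simp
    · intro x _
      simp
    · intro x y z _ _ _ h1 h2
      rw [add_mul]
      exact add_mem h1 h2
    · intro x y z _ _ _ h1 h2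
      rw [mul_add]
      exact add_mem h1 h2
    · intro r x y _ _ h
      rw [smul_mul_assoc]
      exact Submodule.smul_mem _ _ h
    · intro r x y _ _ h
      rw [mul_smul_comm]
      exact Submodule.smul_mem _ _ h

/-- A subalgebra containing the generators is everything. -/
theorem eq_top_of_ι_mem {S : Subalgebra ℚ (FreeCGA V)} (h : ∀ p v, ι V p v ∈ S) : S = ⊤ := by
  rw [eq_top_iff]
  let g : FreeCGA V →ₐ[ℚ] S := lift (T := S)
    (fun p => (ι V p).codRestrict (Subalgebra.toSubmodule S) (h p)) (by
    intro i j v w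
    exact Subtype.ext (ι_mul_ι v w))
  -- The generators lift to `S`, so the identity of `ΛV` factors through `S`.
  have : S.val.comp g = AlgHom.id ℚ _ := algHom_ext fun p v => by
    rw [AlgHom.comp_apply, lift_ι]
    rfl
  intro x _
  rw [← AlgHom.id_apply (R := ℚ) x, ← this]
  exact (g x).2

variable (V) in
/-- The coaction `v ↦ v T^{|v|}` that records degrees. -/
noncomputable def degHom : FreeCGA V →ₐ[ℚ] Polynomial (FreeCGA V) :=
  lift (T := Polynomial (FreeCGA V))
    (fun p => (LinearMap.restrictScalars ℚ (Polynomial.monomial (R := FreeCGA V) p)) ∘ₗ ι V p) (by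
    intro i j v w
    change Polynomial.monomial i (ι V i v) * Polynomial.monomial j (ι V j w) =
      (-1 : ℚ) ^ (i * j) • (Polynomial.monomial j (ι V j w) * Polynomial.monomial i (ι V i v))
    rw [Polynomial.monomial_mul_monomial, Polynomial.monomial_mul_monomial, ι_mul_ι,
      Polynomial.smul_monomial, add_comm i j])

/-- The degree appears as the exponent of `T`. This makes the degree components of `ΛV` independent
without a basis of monomials: the projection to degree `k` is the coefficient of `T^k`. -/
theorem degHom_of_mem {k : ℕ} {x : FreeCGA V} (hx : x ∈ gr V k) :
    degHom V x = Polynomial.monomial k x := by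
  refine Submodule.span_induction (p := fun x _ => degHom V x = Polynomial.monomial k x)
    ?_ ?_ ?_ ?_ hx
  · intro y hy
    clear hx
    induction hy with
    | one => rw [map_one]; rfl
    | mul_ι _ v ih =>
      rw [map_mul, ih, degHom, lift_ι]
      exact Polynomial.monomial_mul_monomial _ _ _ _
  · simp
  · intro x y _ _ h1 h2
    rw [map_add, map_add, h1, h2]
  · intro r x _ h
    rw [map_smul, h, Polynomial.smul_monomial]

/-- The sum of the graded pieces is a subalgebra containing the generators. -/
theorem mem_iSup_gr (x : FreeCGA V) : x ∈ ⨆ k, gr V k := by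
  let S : Subalgebra ℚ (FreeCGA V) := Submodule.toSubalgebra (⨆ k, gr V k)
    (Submodule.mem_iSup_of_mem 0 IsMonomial.one.mem) (by
      intro x y hx hy
      have := Submodule.mul_mem_mul hx hy
      rw [Submodule.iSup_mul] at this
      refine (iSup_le fun k => ?_ : _ ≤ ⨆ k, gr V k) this
      rw [Submodule.mul_iSup]
      refine iSup_le fun l => le_trans ?_ (le_iSup _ (k + l))
      exact Submodule.mul_le.2 fun a ha b hb => SetLike.mul_mem_graded ha hb)
  have : S = ⊤ := eq_top_of_ι_mem fun p v => Submodule.mem_iSup_of_mem p (ι_mem v)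
  change x ∈ S
  rw [this]
  trivial

theorem isInternal_gr : DirectSum.IsInternal (gr V) := by
  refine isInternal_of_proj (gr V)
    (fun k => (Polynomial.lcoeff (FreeCGA V) k).restrictScalars ℚ ∘ₗ (degHom V).toLinearMap) ?_ ?_
    mem_iSup_gr
  · intro k x hx
    simp [degHom_of_mem hx]
  · intro j k h x hx
    simp [degHom_of_mem hx, Polynomial.coeff_monomial, h]

noncomputable instance : GradedAlgebra (gr V) :=
  { (inferInstance : SetLike.GradedMonoid (gr V)), isInternal_gr.chooseDecomposition with }

theorem IsMonomial.comm_ι {k p : ℕ} {x : FreeCGA V} (hx : IsMonomial k x) (v : V p) :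
    x * FreeCGA.ι V p v = (-1 : ℚ) ^ (k * p) • (FreeCGA.ι V p v * x) := by
  induction hx with
  | one => simp
  | @mul_ι k q x _ w ih =>
    rw [mul_assoc, ι_mul_ι, mul_smul_comm, ← mul_assoc, ih, smul_mul_assoc, smul_smul, ← pow_add,
      mul_assoc]
    congr 2
    ring

theorem IsMonomial.comm {k l : ℕ} {x y : FreeCGA V} (hx : IsMonomial k x) (hy : IsMonomial l y) :
    x * y = (-1 : ℚ) ^ (k * l) • (y * x) := by
  induction hy with
  | one => simp
  | @mul_ι l q y _ w ih =>
    rw [← mul_assoc, ih, smul_mul_assoc, mul_assoc, hx.comm_ι, mul_smul_comm, smul_smul, ← pow_add,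
      mul_assoc]
    congr 2
    ring

theorem graded_comm {k l : ℕ} {x y : FreeCGA V} (hx : x ∈ gr V k) (hy : y ∈ gr V l) :
    x * y = (-1 : ℚ) ^ (k * l) • (y * x) := by
  refine Submodule.span_induction₂ (p := fun x y _ _ => x * y = (-1 : ℚ) ^ (k * l) • (y * x))
    ?_ ?_ ?_ ?_ ?_ ?_ ?_ hx hy
  · intro x y hx hy
    exact IsMonomial.comm hx hy
  · intro y _
    simp
  · intro x _
    simp
  · intro x y z _ _ _ h1 h2
    rw [add_mul, mul_add, h1, h2, smul_add]
  · intro x y z _ _ _ h1 h2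
    rw [add_mul, mul_add, h1, h2, smul_add]
  · intro r x y _ _ h
    rw [smul_mul_assoc, h, mul_smul_comm, smul_comm]
  · intro r x y _ _ h
    rw [smul_mul_assoc, mul_smul_comm, h, smul_comm]

variable (V) in
/-- The CDGA `(ΛV, 0)`. -/
noncomputable abbrev cdga : CDGA where
  carrier := FreeCGA V
  gr := gr V
  d := 0
  d_mem _ := Submodule.zero_mem _
  d_d _ := rfl
  leibniz _ _ := by simp
  graded_comm := graded_comm

end

end FreeCGA

end RHT

namespace RHT

open CDGA

theorem neg_one_pow_eq_of_even {a b : ℕ} (h : Even (a + b)) : (-1 : ℚ) ^ a = (-1) ^ b := by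
  rw [Nat.even_add] at h
  rcases Nat.even_or_odd a with ha | ha
  · rw [ha.neg_one_pow, (h.1 ha).neg_one_pow]
  · rw [ha.neg_one_pow, Odd.neg_one_pow]
    rw [← Nat.not_even_iff_odd] at ha ⊢
    exact fun hb => ha (h.2 hb)

/-! ### Relative free algebras `B ⊗ ΛU` -/

/-- The graded algebra `B ⊗ ΛU`. -/
abbrev RelFree (B : CDGA) (U : ℕ → Type) [∀ p, AddCommGroup (U p)] [∀ p, Module ℚ (U p)] : Type :=
  TensorCarrier B (FreeCGA.cdga U)

namespace RelFree

section

variable (B : CDGA) (U : ℕ → Type) [∀ p, AddCommGroup (U p)] [∀ p, Module ℚ (U p)]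

/-- The degree `k` part of `B ⊗ ΛU`. -/
noncomputable abbrev gr (k : ℕ) : Submodule ℚ (RelFree B U) := tensorGr B (FreeCGA.cdga U) k

/-- The inclusion of `B`. -/
noncomputable abbrev base : B →ₐ[ℚ] RelFree B U :=
  GradedTensorProduct.includeLeft B.gr (FreeCGA.gr U)

/-- The inclusion of `ΛU`. -/
noncomputable abbrev fiber : FreeCGA U →ₐ[ℚ] RelFree B U :=
  GradedTensorProduct.includeRight B.gr (FreeCGA.gr U)

/-- The inclusion of the generators of degree `p`. -/
noncomputable def gen (p : ℕ) : U p →ₗ[ℚ] RelFree B U := (fiber B U).toLinearMap ∘ₗ FreeCGA.ι U p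

variable {B U}

theorem base_apply (b : B) : base B U b = tm (A' := FreeCGA.cdga U) b 1 := rfl

theorem fiber_apply (x : FreeCGA U) : fiber B U x = tm (A' := FreeCGA.cdga U) 1 x := rfl

theorem gen_apply {p : ℕ} (u : U p) : gen B U p u = fiber B U (FreeCGA.ι U p u) := rfl

theorem base_mul_fiber (b : B) (x : FreeCGA U) :
    base B U b * fiber B U x = tm (A' := FreeCGA.cdga U) b x :=
  GradedTensorProduct.tmul_one_mul_one_tmul B.gr (FreeCGA.gr U) b x

theorem base_mem {k : ℕ} {b : B} (hb : b ∈ B.gr k) : base B U b ∈ gr B U k :=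
  tm_mem (A' := FreeCGA.cdga U) (add_zero k) hb (SetLike.one_mem_graded (FreeCGA.gr U))

theorem fiber_mem {k : ℕ} {x : FreeCGA U} (hx : x ∈ FreeCGA.gr U k) : fiber B U x ∈ gr B U k :=
  tm_mem (A' := FreeCGA.cdga U) (zero_add k) (SetLike.one_mem_graded B.gr) hx

theorem gen_mem {p : ℕ} (u : U p) : gen B U p u ∈ gr B U p := fiber_mem (FreeCGA.ι_mem u)

theorem graded_comm {i j : ℕ} {x y : RelFree B U} (hx : x ∈ gr B U i) (hy : y ∈ gr B U j) :
    x * y = (-1 : ℚ) ^ (i * j) • (y * x) :=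
  (tensor B (FreeCGA.cdga U)).graded_comm hx hy

theorem mul_mem {i j : ℕ} {x y : RelFree B U} (hx : x ∈ gr B U i) (hy : y ∈ gr B U j) :
    x * y ∈ gr B U (i + j) :=
  (tensorGradedMonoid (A := B) (A' := FreeCGA.cdga U)).mul_mem hx hy

/-- Products of a homogeneous element of `B` and generators, of total degree `k`. -/
inductive IsMonomial : ℕ → RelFree B U → Prop
  | base {k : ℕ} {b : B} (hb : b ∈ B.gr k) : IsMonomial k (base B U b)
  | mul_gen {k p : ℕ} {r : RelFree B U} (hr : IsMonomial k r) (u : U p) :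
      IsMonomial (k + p) (r * gen B U p u)

theorem IsMonomial.mem {k : ℕ} {r : RelFree B U} (hr : IsMonomial k r) : r ∈ gr B U k := by
  induction hr with
  | base hb => exact base_mem hb
  | mul_gen _ u ih => exact mul_mem ih (gen_mem u)

/-- `Q` need only be additive: scalars are absorbed into the coefficient of a monomial in `B`. -/
theorem gr_induction {k : ℕ} {Q : RelFree B U → Prop} (h0 : Q 0)
    (h : ∀ r, IsMonomial k r → Q r) (hadd : ∀ x y, Q x → Q y → Q (x + y)) {r : RelFree B U}
    (hr : r ∈ gr B U k) : Q r := by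
  have mon : ∀ i j, ∀ b ∈ B.gr i, ∀ m : FreeCGA U, FreeCGA.IsMonomial j m →
      IsMonomial (B := B) (U := U) (i + j) (base B U b * fiber B U m) := by
    intro i j b hb m hm
    induction hm with
    | one =>
      rw [map_one, mul_one]
      exact IsMonomial.base hb
    | mul_ι _ v ih =>
      rw [map_mul, ← mul_assoc, ← add_assoc]
      exact ih.mul_gen v
  refine tensorGr_induction (A' := FreeCGA.cdga U) (P := Q) h0 ?_ hadd hr
  intro i j hij b hb x hx
  subst hij
  have key : ∀ b ∈ B.gr i, Q (base B U b * fiber B U x) := by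
    refine Submodule.span_induction
      (p := fun x _ => ∀ b ∈ B.gr i, Q (base B U b * fiber B U x)) ?_ ?_ ?_ ?_ hx
    · intro m hm b hb
      exact h _ (mon i j b hb m hm)
    · intro b _
      rwa [map_zero, mul_zero]
    · intro x y _ _ h1 h2 b hb
      rw [map_add, mul_add]
      exact hadd _ _ (h1 b hb) (h2 b hb)
    · intro q x _ h1 b hb
      have := h1 (q • b) (Submodule.smul_mem _ _ hb)
      rwa [map_smul, smul_mul_assoc, ← mul_smul_comm, ← map_smul] at this
  rw [← base_mul_fiber]
  exact key b hb

theorem induction {Q : RelFree B U → Prop} (h0 : Q 0)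
    (h : ∀ k r, IsMonomial k r → Q r) (hadd : ∀ x y, Q x → Q y → Q (x + y)) (r : RelFree B U) :
    Q r :=
  hom_induction (A := tensor B (FreeCGA.cdga U)) h0
    (fun k _ hr => gr_induction h0 (h k) hadd hr) hadd r

/-! ### Universal property of `B ⊗ ΛU` -/

section lift

variable {M : CDGA}

theorem lift_comm {g : ∀ p, U p →ₗ[ℚ] M} (hg : ∀ p u, g p u ∈ M.gr p) (i j : ℕ) (v : U i)
    (w : U j) : g i v * g j w = (-1 : ℚ) ^ (i * j) • (g j w * g i v) :=
  M.graded_comm (hg i v) (hg j w)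

theorem freeLift_mem {g : ∀ p, U p →ₗ[ℚ] M} (hg : ∀ p u, g p u ∈ M.gr p) {k : ℕ} {x : FreeCGA U}
    (hx : x ∈ FreeCGA.gr U k) : FreeCGA.lift g (lift_comm hg) x ∈ M.gr k := by
  refine (Submodule.span_le.2 ?_ : FreeCGA.gr U k ≤
    (M.gr k).comap (FreeCGA.lift g (lift_comm hg)).toLinearMap) hx
  intro m hm
  change FreeCGA.lift g (lift_comm hg) m ∈ M.gr k
  clear hx
  induction hm with
  | one =>
    rw [map_one]
    exact SetLike.one_mem_graded M.gr
  | mul_ι _ v ih =>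
    rw [map_mul, FreeCGA.lift_ι]
    exact SetLike.mul_mem_graded ih (hg _ v)

/-- The universal property of `B ⊗ ΛU`. -/
noncomputable def lift (f : B →ₐ[ℚ] M) (hf : ∀ k, ∀ b ∈ B.gr k, f b ∈ M.gr k)
    (g : ∀ p, U p →ₗ[ℚ] M) (hg : ∀ p u, g p u ∈ M.gr p) : RelFree B U →ₐ[ℚ] M :=
  GradedTensorProduct.lift B.gr (FreeCGA.gr U) f (FreeCGA.lift g (lift_comm hg)) (by
    intro i j a b
    have h := M.graded_comm (hf i a a.2) (freeLift_mem hg b.2)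
    rw [h, mul_comm j i]
    rcases Nat.even_or_odd (i * j) with h | h
    · simp [h.neg_one_pow]
    · simp [h.neg_one_pow])

variable (f : B →ₐ[ℚ] M) (hf : ∀ k, ∀ b ∈ B.gr k, f b ∈ M.gr k)
    (g : ∀ p, U p →ₗ[ℚ] M) (hg : ∀ p u, g p u ∈ M.gr p)

@[simp]
theorem lift_base (b : B) : lift f hf g hg (base B U b) = f b := by
  rw [lift, base_apply, GradedTensorProduct.lift_tmul, map_one, mul_one]

@[simp]
theorem lift_gen {p : ℕ} (u : U p) : lift f hf g hg (gen B U p u) = g p u := by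
  rw [lift, gen_apply, fiber_apply, GradedTensorProduct.lift_tmul, map_one, one_mul, FreeCGA.lift_ι]

theorem lift_mem {k : ℕ} {r : RelFree B U} (hr : r ∈ gr B U k) : lift f hf g hg r ∈ M.gr k := by
  refine gr_induction (Q := fun r => lift f hf g hg r ∈ M.gr k) ?_ ?_ ?_ hr
  · rw [map_zero]
    exact Submodule.zero_mem _
  · intro m hm
    clear hr
    induction hm with
    | base hb =>
      rw [lift_base]
      exact hf _ _ hb
    | mul_gen _ u ih =>
      rw [map_mul, lift_gen]
      exact SetLike.mul_mem_graded ih (hg _ u)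
  · intro x y h1 h2
    rw [map_add]
    exact Submodule.add_mem _ h1 h2

end lift

theorem algHom_ext {T : Type} [Ring T] [Algebra ℚ T] {φ ψ : RelFree B U →ₐ[ℚ] T}
    (hb : ∀ b, φ (base B U b) = ψ (base B U b))
    (hg : ∀ p u, φ (gen B U p u) = ψ (gen B U p u)) (r : RelFree B U) : φ r = ψ r := by
  refine induction (Q := fun r => φ r = ψ r) ?_ ?_ ?_ r
  · rw [map_zero, map_zero]
  · intro k r hr
    induction hr with
    | base _ => exact hb _
    | mul_gen _ u ih => rw [map_mul, map_mul, ih, hg]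
  · intro x y h1 h2
    rw [map_add, map_add, h1, h2]

/-! #### Functoriality -/

section map

variable {U' U'' : ℕ → Type} [∀ p, AddCommGroup (U' p)] [∀ p, Module ℚ (U' p)]
  [∀ p, AddCommGroup (U'' p)] [∀ p, Module ℚ (U'' p)]

variable (B) in
/-- The map `B ⊗ ΛU → B ⊗ ΛU'` induced by a graded linear map `U → U'`. -/
noncomputable def map (h : ∀ p, U p →ₗ[ℚ] U' p) : RelFree B U →ₐ[ℚ] RelFree B U' :=
  lift (M := tensor B (FreeCGA.cdga U')) (base B U') (fun _ _ => base_mem)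
    (fun p => gen B U' p ∘ₗ h p) (fun _ _ => gen_mem _)

@[simp]
theorem map_base (h : ∀ p, U p →ₗ[ℚ] U' p) (b : B) : map B h (base B U b) = base B U' b :=
  lift_base (M := tensor B (FreeCGA.cdga U')) _ _ _ _ b

@[simp]
theorem map_gen (h : ∀ p, U p →ₗ[ℚ] U' p) {p : ℕ} (u : U p) :
    map B h (gen B U p u) = gen B U' p (h p u) :=
  lift_gen (M := tensor B (FreeCGA.cdga U')) _ _ _ _ u

theorem map_mem (h : ∀ p, U p →ₗ[ℚ] U' p) {k : ℕ} {r : RelFree B U} (hr : r ∈ gr B U k) :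
    map B h r ∈ gr B U' k :=
  lift_mem (M := tensor B (FreeCGA.cdga U')) _ _ _ _ hr

theorem map_map {h : ∀ p, U p →ₗ[ℚ] U' p} {h' : ∀ p, U' p →ₗ[ℚ] U'' p} {h'' : ∀ p, U p →ₗ[ℚ] U'' p}
    (e : ∀ p u, h' p (h p u) = h'' p u) (r : RelFree B U) : map B h' (map B h r) = map B h'' r :=
  algHom_ext (φ := (map B h').comp (map B h)) (ψ := map B h'')
    (fun b => by rw [AlgHom.comp_apply, map_base, map_base, map_base]) (by simp [e]) r

theorem map_id {h : ∀ p, U p →ₗ[ℚ] U p} (e : ∀ p u, h p u = u) (r : RelFree B U) :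
    map B h r = r :=
  algHom_ext (φ := map B h) (ψ := AlgHom.id ℚ _)
    (fun b => by rw [map_base, AlgHom.id_apply]) (by simp [e]) r

/-- Over a field the inclusion of generators splits linearly, and the splitting extends
multiplicatively. The resulting retraction respects degrees but no differential; it serves to detect
equalities and degrees in the smaller algebra. -/
theorem exists_map_leftInverse {h : ∀ p, U p →ₗ[ℚ] U' p} (hh : ∀ p, Function.Injective (h p)) :
    ∃ h' : ∀ p, U' p →ₗ[ℚ] U p, ∀ r : RelFree B U, map B h' (map B h r) = r := by
  choose h' hh' using fun p => (h p).exists_leftInverse_of_injective (LinearMap.ker_eq_bot.2 (hh p))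
  refine ⟨h', fun r => ?_⟩
  rw [map_map (h'' := fun p => LinearMap.id) (fun p u => LinearMap.congr_fun (hh' p) u)]
  exact map_id (fun _ _ => rfl) r

end map

/-! #### Derivations -/

section derivation

variable (δ : ∀ p, U p →ₗ[ℚ] RelFree B U)

/-- The upper triangular matrix `((-1)^p u, δ u; 0, u)` attached to a generator `u`. -/
noncomputable def genMatrix (p : ℕ) : U p →ₗ[ℚ] Matrix (Fin 2) (Fin 2) (RelFree B U) where
  toFun u := !![(-1 : ℚ) ^ p • gen B U p u, δ p u; 0, gen B U p u]
  map_add' u v := by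
    ext i j
    fin_cases i <;> fin_cases j <;> simp
  map_smul' q u := by
    ext i j
    fin_cases i <;> fin_cases j <;> simp
    exact smul_comm _ _ _

variable {δ}

/-- The upper right entry of a product of two such matrices is `(-1)^i v δw + (δv) w`, the graded
Leibniz rule. As `δ` raises degrees by one, the matrices satisfy the commutation relations of the
generators, so the universal property of `ΛU` produces the derivation as a corner of an algebra map,
and well-definedness needs no separate proof. -/
theorem genMatrix_comm (hδ : ∀ p u, δ p u ∈ gr B U (p + 1)) (i j : ℕ) (v : U i) (w : U j) :
    genMatrix δ i v * genMatrix δ j w =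
      (-1 : ℚ) ^ (i * j) • (genMatrix δ j w * genMatrix δ i v) := by
  have h1 := graded_comm (gen_mem (B := B) v) (gen_mem w)
  have h2 := graded_comm (gen_mem v) (hδ j w)
  have h3 := graded_comm (hδ i v) (gen_mem w)
  change !![_, _; _, _] * !![_, _; _, _] = _ • (!![_, _; _, _] * !![_, _; _, _])
  rw [Matrix.mul_fin_two, Matrix.mul_fin_two]
  have e1 : (-1 : ℚ) ^ (j + (i + i * j)) = (-1) ^ (i * j + (i + j)) := by
    congr 1
    ring
  have e2 : (-1 : ℚ) ^ (i + i * (j + 1)) = (-1) ^ (i * j) :=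
    neg_one_pow_eq_of_even ⟨i + i * j, by ring⟩
  have e3 : (-1 : ℚ) ^ ((i + 1) * j) = (-1) ^ (i * j + j) := by
    congr 1
    ring
  ext a b
  fin_cases a <;> fin_cases b <;>
    simp only [h1, h2, h3, smul_mul_assoc, mul_smul_comm, smul_smul, mul_zero, zero_mul, add_zero,
      zero_add, smul_zero, smul_add, ← pow_add, Matrix.smul_apply, Matrix.of_apply,
      Matrix.cons_val', Matrix.cons_val_zero, Matrix.cons_val_one, Fin.zero_eta, Fin.mk_one,
      Matrix.cons_val_fin_one, e1, e2, e3]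
  exact add_comm _ _

/-- The multiplicative extension of `genMatrix`; its upper right entry is the derivation of `ΛU`
with values in `B ⊗ ΛU` that extends `δ`. -/
noncomputable def derivMatrix (hδ : ∀ p u, δ p u ∈ gr B U (p + 1)) :
    FreeCGA U →ₐ[ℚ] Matrix (Fin 2) (Fin 2) (RelFree B U) :=
  FreeCGA.lift (genMatrix δ) (genMatrix_comm hδ)

variable (hδ : ∀ p u, δ p u ∈ gr B U (p + 1))

/-- The derivation of `ΛU` with values in `B ⊗ ΛU` that extends `δ`. -/
noncomputable def fiberDeriv : FreeCGA U →ₗ[ℚ] RelFree B U :=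
  Matrix.entryLinearMap ℚ (RelFree B U) 0 1 ∘ₗ (derivMatrix hδ).toLinearMap

theorem derivMatrix_isMonomial {k : ℕ} {x : FreeCGA U} (hx : FreeCGA.IsMonomial k x) :
    derivMatrix hδ x = !![(-1 : ℚ) ^ k • fiber B U x, fiberDeriv hδ x; 0, fiber B U x] ∧
      fiberDeriv hδ x ∈ gr B U (k + 1) := by
  -- `fiberDeriv` is by definition the upper right entry, so `θ` is forced; leaving it unnamed lets
  -- the induction produce its recursive formula.
  suffices h : ∃ θ ∈ gr B U (k + 1),
      derivMatrix hδ x = !![(-1 : ℚ) ^ k • fiber B U x, θ; 0, fiber B U x] by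
    obtain ⟨θ, hθ, h⟩ := h
    have : fiberDeriv hδ x = θ := congrFun (congrFun h 0) 1
    rw [this]
    exact ⟨h, hθ⟩
  induction hx with
  | one =>
    refine ⟨0, Submodule.zero_mem _, ?_⟩
    rw [map_one, map_one, Matrix.one_fin_two]
    simp
  | @mul_ι k p x hx v ih =>
    obtain ⟨θ, hθ, h⟩ := ih
    refine ⟨(-1 : ℚ) ^ k • (fiber B U x * δ p v) + θ * gen B U p v, ?_, ?_⟩
    · refine Submodule.add_mem _ (Submodule.smul_mem _ _ ?_) ?_
      · have := mul_mem (fiber_mem hx.mem) (hδ p v)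
        rwa [← add_assoc] at this
      · have := mul_mem hθ (gen_mem v)
        rwa [add_right_comm] at this
    · have e : derivMatrix hδ (FreeCGA.ι U p v) =
          !![(-1 : ℚ) ^ p • gen B U p v, δ p v; 0, gen B U p v] := FreeCGA.lift_ι _ _ _ _
      rw [map_mul, h, e, Matrix.mul_fin_two, map_mul, ← gen_apply]
      simp [smul_smul, pow_add, mul_comm]

theorem derivMatrix_of_mem {k : ℕ} {x : FreeCGA U} (hx : x ∈ FreeCGA.gr U k) :
    derivMatrix hδ x = !![(-1 : ℚ) ^ k • fiber B U x, fiberDeriv hδ x; 0, fiber B U x] ∧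
      fiberDeriv hδ x ∈ gr B U (k + 1) := by
  refine Submodule.span_induction (p := fun x _ =>
    derivMatrix hδ x = !![(-1 : ℚ) ^ k • fiber B U x, fiberDeriv hδ x; 0, fiber B U x] ∧
      fiberDeriv hδ x ∈ gr B U (k + 1)) ?_ ?_ ?_ ?_ hx
  · intro x hx
    exact derivMatrix_isMonomial hδ hx
  · constructor
    · rw [map_zero, map_zero, map_zero, smul_zero]
      exact Matrix.eta_fin_two 0
    · rw [map_zero]
      exact Submodule.zero_mem _
  · rintro x y _ _ ⟨h1, h2⟩ ⟨h3, h4⟩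
    constructor
    · rw [map_add, map_add, map_add, h1, h3, smul_add]
      ext a b
      fin_cases a <;> fin_cases b <;> simp
    · rw [map_add]
      exact Submodule.add_mem _ h2 h4
  · rintro q x _ ⟨h1, h2⟩
    constructor
    · rw [map_smul, map_smul, map_smul, h1, smul_comm]
      ext a b
      fin_cases a <;> fin_cases b <;> simp
    · rw [map_smul]
      exact Submodule.smul_mem _ _ h2

/-- The lower right corner carries no sign, so it is known for inhomogeneous elements as well. The
Leibniz rule `fiberDeriv_mul` needs this for its second factor. -/
theorem derivMatrix_one_one (x : FreeCGA U) : derivMatrix hδ x 1 1 = fiber B U x := by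
  refine hom_induction (A := FreeCGA.cdga U)
    (P := fun x => derivMatrix hδ x 1 1 = fiber B U x) ?_ ?_ ?_ x
  · rw [map_zero, map_zero]
    rfl
  · intro k x hx
    rw [(derivMatrix_of_mem hδ hx).1]
    rfl
  · intro x y h1 h2
    rw [map_add, map_add, ← h1, ← h2]
    rfl

theorem fiberDeriv_mem {k : ℕ} {x : FreeCGA U} (hx : x ∈ FreeCGA.gr U k) :
    fiberDeriv hδ x ∈ gr B U (k + 1) := (derivMatrix_of_mem hδ hx).2

theorem fiberDeriv_mul {k : ℕ} {x : FreeCGA U} (hx : x ∈ FreeCGA.gr U k) (y : FreeCGA U) :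
    fiberDeriv hδ (x * y) =
      fiberDeriv hδ x * fiber B U y + (-1 : ℚ) ^ k • (fiber B U x * fiberDeriv hδ y) := by
  change derivMatrix hδ (x * y) 0 1 = _
  rw [map_mul, Matrix.mul_apply, Fin.sum_univ_two, derivMatrix_one_one,
    (derivMatrix_of_mem hδ hx).1, add_comm, ← smul_mul_assoc]
  rfl

theorem fiberDeriv_ι {p : ℕ} (u : U p) : fiberDeriv hδ (FreeCGA.ι U p u) = δ p u := by
  change derivMatrix hδ _ 0 1 = _
  rw [derivMatrix, FreeCGA.lift_ι]
  rfl

theorem fiberDeriv_one : fiberDeriv hδ 1 = 0 := by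
  change derivMatrix hδ 1 0 1 = _
  rw [map_one]
  rfl

/-- The derivation of `B ⊗ ΛU` that vanishes on `B` and extends `δ`. -/
noncomputable def vertDeriv : RelFree B U →ₗ[ℚ] RelFree B U :=
  TensorProduct.lift ((LinearMap.mul ℚ (RelFree B U)).compl₁₂
    ((base B U).toLinearMap ∘ₗ B.sgn) (fiberDeriv hδ)) ∘ₗ
    (GradedTensorProduct.of ℚ B.gr (FreeCGA.gr U)).symm.toLinearMap

theorem vertDeriv_mul {i : ℕ} {b : B} (hb : b ∈ B.gr i) (x : FreeCGA U) :
    vertDeriv hδ (base B U b * fiber B U x) = (-1 : ℚ) ^ i • (base B U b * fiberDeriv hδ x) := by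
  rw [base_mul_fiber]
  change base B U (B.sgn b) * fiberDeriv hδ x = _
  rw [sgn_apply hb, map_smul, smul_mul_assoc]

theorem vertDeriv_base (b : B) : vertDeriv hδ (base B U b) = 0 := by
  have : vertDeriv hδ (base B U b) = base B U (B.sgn b) * fiberDeriv hδ 1 := rfl
  rw [this, fiberDeriv_one, mul_zero]

theorem vertDeriv_fiber (x : FreeCGA U) : vertDeriv hδ (fiber B U x) = fiberDeriv hδ x := by
  have := vertDeriv_mul hδ (SetLike.one_mem_graded B.gr) x
  rwa [map_one, one_mul, pow_zero, one_smul, one_mul] at this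

theorem vertDeriv_mem {k : ℕ} {r : RelFree B U} (hr : r ∈ gr B U k) :
    vertDeriv hδ r ∈ gr B U (k + 1) := by
  refine tensorGr_induction (A' := FreeCGA.cdga U)
    (P := fun r => vertDeriv hδ r ∈ gr B U (k + 1)) ?_ ?_ ?_ hr
  · rw [map_zero]
    exact Submodule.zero_mem _
  · intro i j hij b hb x hx
    rw [← base_mul_fiber, vertDeriv_mul hδ hb]
    have := mul_mem (base_mem hb) (fiberDeriv_mem hδ hx)
    rw [← add_assoc, hij] at this
    exact Submodule.smul_mem _ _ this
  · intro x y h1 h2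
    rw [map_add]
    exact Submodule.add_mem _ h1 h2

theorem vertDeriv_leibniz {k : ℕ} {r : RelFree B U} (hr : r ∈ gr B U k) (s : RelFree B U) :
    vertDeriv hδ (r * s) = vertDeriv hδ r * s + (-1 : ℚ) ^ k • (r * vertDeriv hδ s) := by
  refine tensorGr_induction (A' := FreeCGA.cdga U) (P := fun r =>
    vertDeriv hδ (r * s) = vertDeriv hδ r * s + (-1 : ℚ) ^ k • (r * vertDeriv hδ s)) ?_ ?_ ?_ hr
  · simp
  · intro i j hij b hb x hx
    refine tensor_induction (A' := FreeCGA.cdga U) (P := fun s => vertDeriv hδ (tm b x * s) =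
      vertDeriv hδ (tm b x) * s + (-1 : ℚ) ^ k • (tm b x * vertDeriv hδ s)) ?_ ?_ ?_ s
    · simp
    · intro i' j' b' hb' x' hx'
      subst hij
      have h1 := graded_comm (base_mem hb') (fiber_mem (B := B) hx)
      have h2 := graded_comm (base_mem hb') (fiberDeriv_mem hδ hx)
      have h3 : fiber B U x * base B U b' = (-1 : ℚ) ^ (j * i') • (base B U b' * fiber B U x) :=
        graded_comm (fiber_mem (B := B) hx) (base_mem hb')
      have e : base B U b * fiber B U x * (base B U b' * fiber B U x') =
          (-1 : ℚ) ^ (j * i') • (base B U (b * b') * fiber B U (x * x')) := by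
        rw [mul_assoc, ← mul_assoc (fiber B U x), h3, map_mul, map_mul]
        simp only [smul_mul_assoc, mul_smul_comm, mul_assoc]
      have f1 : (-1 : ℚ) ^ (j * i' + (i + i' + i' * (j + 1))) = (-1) ^ i :=
        neg_one_pow_eq_of_even ⟨j * i' + i + i', by ring⟩
      have f2 : (-1 : ℚ) ^ (j * i' + (i + i' + (j + i' * j))) = (-1) ^ (i + j + i') :=
        neg_one_pow_eq_of_even ⟨j * i' + i + i' + j, by ring⟩
      rw [← base_mul_fiber, ← base_mul_fiber, e, map_smul,
        vertDeriv_mul hδ (SetLike.mul_mem_graded hb hb'), vertDeriv_mul hδ hb,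
        vertDeriv_mul hδ hb', fiberDeriv_mul hδ hx, map_mul, mul_add, smul_add, smul_add]
      congr 1
      · rw [mul_assoc, ← mul_assoc (base B U b'), h2]
        simp only [smul_mul_assoc, mul_smul_comm, smul_smul, ← pow_add, mul_assoc, f1]
      · rw [mul_smul_comm, mul_assoc, ← mul_assoc (base B U b'), h1]
        simp only [smul_mul_assoc, mul_smul_comm, smul_smul, ← pow_add, mul_assoc, f2]
    · intro x y h1 h2
      simp only [mul_add, map_add, h1, h2, smul_add]
      abel
  · intro x y h1 h2
    simp only [add_mul, map_add, h1, h2, smul_add]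
    abel

/-- The derivation of `B ⊗ ΛU` that extends the differential of `B` and `δ`. -/
noncomputable def diff : RelFree B U →ₗ[ℚ] RelFree B U :=
  tensorD B (FreeCGA.cdga U) + vertDeriv hδ

theorem diff_mem {k : ℕ} {r : RelFree B U} (hr : r ∈ gr B U k) : diff hδ r ∈ gr B U (k + 1) :=
  Submodule.add_mem _ ((tensor B (FreeCGA.cdga U)).d_mem hr) (vertDeriv_mem hδ hr)

theorem diff_leibniz {k : ℕ} {r : RelFree B U} (hr : r ∈ gr B U k) (s : RelFree B U) :
    diff hδ (r * s) = diff hδ r * s + (-1 : ℚ) ^ k • (r * diff hδ s) := by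
  have h1 := (tensor B (FreeCGA.cdga U)).leibniz hr s
  have h2 := vertDeriv_leibniz hδ hr s
  simp only [diff, LinearMap.add_apply]
  rw [h2, add_mul, mul_add, smul_add]
  change tensorD B (FreeCGA.cdga U) (r * s) = tensorD B (FreeCGA.cdga U) r * s + _ at h1
  rw [h1]
  abel

theorem diff_base (b : B) : diff hδ (base B U b) = base B U (B.d b) := by
  refine hom_induction (P := fun b => diff hδ (base B U b) = base B U (B.d b)) ?_ ?_ ?_ b
  · simp only [map_zero]
  · intro k b hb
    simp only [diff, LinearMap.add_apply]
    rw [vertDeriv_base, add_zero, base_apply, tensorD_tm hb]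
    simp [tm_zero_right]
  · intro x y h1 h2
    simp only [map_add, h1, h2]

theorem diff_gen {p : ℕ} (u : U p) : diff hδ (gen B U p u) = δ p u := by
  simp only [diff, LinearMap.add_apply]
  rw [gen_apply, vertDeriv_fiber, fiberDeriv_ι, fiber_apply,
    tensorD_tm (SetLike.one_mem_graded B.gr)]
  have : B.d 1 = 0 := Cone.d_one
  rw [this]
  simp [tm_zero_right, tm_zero_left]

/-- The square of an odd derivation is a derivation, the mixed terms cancelling. Hence it vanishes
as soon as it vanishes on `B` and on the generators. -/
theorem diff_diff (hd : ∀ p u, diff hδ (δ p u) = 0) (r : RelFree B U) :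
    diff hδ (diff hδ r) = 0 := by
  refine induction (Q := fun r => diff hδ (diff hδ r) = 0) ?_ ?_ ?_ r
  · simp only [map_zero]
  · intro k r hr
    induction hr with
    | base hb => rw [diff_base, diff_base, B.d_d, map_zero]
    | @mul_gen k p r hr u ih =>
      rw [diff_leibniz hδ hr.mem, map_add, map_smul, diff_leibniz hδ (diff_mem hδ hr.mem),
        diff_leibniz hδ hr.mem, ih, diff_gen, hd, pow_succ]
      simp
  · intro x y h1 h2
    rw [map_add, map_add, h1, h2, add_zero]

/-- An algebra map out of `B ⊗ ΛU` that is compatible with derivations on the elements of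
`B` and on the generators is compatible with the derivations. -/
theorem map_diff {M : CDGA} {d' : M →ₗ[ℚ] M}
    (hd' : ∀ k, ∀ x ∈ M.gr k, ∀ y, d' (x * y) = d' x * y + (-1 : ℚ) ^ k • (x * d' y))
    (ψ : RelFree B U →ₐ[ℚ] M) (hψ : ∀ k, ∀ r ∈ gr B U k, ψ r ∈ M.gr k)
    (hb : ∀ b, ψ (base B U (B.d b)) = d' (ψ (base B U b)))
    (hg : ∀ p u, ψ (δ p u) = d' (ψ (gen B U p u))) (r : RelFree B U) :
    ψ (diff hδ r) = d' (ψ r) := by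
  refine induction (Q := fun r => ψ (diff hδ r) = d' (ψ r)) ?_ ?_ ?_ r
  · simp only [map_zero]
  · intro k r hr
    induction hr with
    | base _ => rw [diff_base, hb]
    | @mul_gen k p r hr u ih =>
      rw [diff_leibniz hδ hr.mem, map_add, map_smul, map_mul, map_mul, map_mul, ih, diff_gen, hg,
        hd' _ _ (hψ _ _ hr.mem)]
  · intro x y h1 h2
    simp only [map_add, h1, h2]

end derivation

end

end RelFree

end RHT

namespace RHT

open CDGA

/-! ### Cohomology of CDGAs -/

namespace CDGA

theorem proj_succ_d (A : CDGA) (k : ℕ) (a : A) : A.proj (k + 1) (A.d a) = A.d (A.proj k a) := by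
  refine hom_induction (P := fun a => A.proj (k + 1) (A.d a) = A.d (A.proj k a)) ?_ ?_ ?_ a
  · simp only [map_zero]
  · intro j a ha
    by_cases h : j = k
    · subst h
      rw [proj_same ha, proj_same (A.d_mem ha)]
    · rw [proj_ne ha h, proj_ne (A.d_mem ha) (by omega), map_zero]
  · intro x y h1 h2
    simp only [map_add, h1, h2]

theorem proj_zero_d (A : CDGA) (a : A) : A.proj 0 (A.d a) = 0 := by
  refine hom_induction (P := fun a => A.proj 0 (A.d a) = 0) ?_ ?_ ?_ a
  · simp only [map_zero]
  · intro j a ha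
    exact proj_ne (A.d_mem ha) (by omega)
  · intro x y h1 h2
    rw [map_add, map_add, h1, h2, add_zero]

/-- `LinearMap.range A.d` ignores degrees; the degree `k` component of any primitive is again a
primitive. -/
theorem exists_primitive {A : CDGA} {k : ℕ} {z : A} (hz : z ∈ A.gr (k + 1))
    (h : z ∈ LinearMap.range A.d) : ∃ a ∈ A.gr k, A.d a = z := by
  obtain ⟨a, rfl⟩ := h
  exact ⟨A.proj k a, A.proj_mem k a, by rw [← proj_succ_d, proj_same hz]⟩

theorem eq_zero_of_exact {A : CDGA} {z : A} (hz : z ∈ A.gr 0) (h : z ∈ LinearMap.range A.d) :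
    z = 0 := by
  obtain ⟨a, rfl⟩ := h
  rw [← proj_same hz, proj_zero_d]

end CDGA

namespace CDGAHom

theorem ext_apply {A B : CDGA} {f g : CDGAHom A B} (h : ∀ a, f a = g a) : f = g := by
  obtain ⟨f, _, _⟩ := f
  obtain ⟨g, _, _⟩ := g
  obtain rfl : f = g := AlgHom.ext h
  rfl

theorem cohomologyMap_cls {A B : CDGA} (f : CDGAHom A B) {k : ℕ} (a : A.cocycles k) :
    f.cohomologyMap k (A.cls a) = B.cls (f.cocyclesMap k a) := rfl

theorem cls_eq_zero {A : CDGA} {k : ℕ} (a : A.cocycles k) :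
    A.cls a = 0 ↔ a.1 ∈ LinearMap.range A.d := by
  rw [CDGA.cls, Submodule.Quotient.mk_eq_zero]
  exact ⟨fun h => h.2, fun h => ⟨a.2.1, h⟩⟩

/-- This criterion and `surjective_iff` replace classes by cocycles, so that later arguments avoid
the quotients. -/
theorem injective_iff {A B : CDGA} (f : CDGAHom A B) (k : ℕ) :
    Function.Injective (f.cohomologyMap k) ↔ ∀ a ∈ A.gr k, A.d a = 0 →
      f a ∈ LinearMap.range B.d → a ∈ LinearMap.range A.d := by
  rw [injective_iff_map_eq_zero]
  constructor
  · intro h a ha hda hfa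
    refine (cls_eq_zero ⟨a, ha, hda⟩).1 (h _ ?_)
    rw [cohomologyMap_cls]
    exact (cls_eq_zero _).2 hfa
  · intro h a
    obtain ⟨a, rfl⟩ := Submodule.Quotient.mk_surjective _ a
    intro ha
    exact (cls_eq_zero a).2 (h a.1 a.2.1 a.2.2 ((cls_eq_zero (f.cocyclesMap k a)).1 ha))

theorem surjective_iff {A B : CDGA} (f : CDGAHom A B) (k : ℕ) :
    Function.Surjective (f.cohomologyMap k) ↔ ∀ b ∈ B.gr k, B.d b = 0 →
      ∃ a ∈ A.gr k, A.d a = 0 ∧ b - f a ∈ LinearMap.range B.d := by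
  constructor
  · intro h b hb hdb
    obtain ⟨a, ha⟩ := h (B.cls ⟨b, hb, hdb⟩)
    obtain ⟨a, rfl⟩ := Submodule.Quotient.mk_surjective _ a
    refine ⟨a.1, a.2.1, a.2.2, ?_⟩
    refine (cls_eq_zero (⟨b, hb, hdb⟩ - f.cocyclesMap k a)).1 ?_
    exact sub_eq_zero.2 ha.symm
  · intro h b
    obtain ⟨b, rfl⟩ := Submodule.Quotient.mk_surjective _ b
    obtain ⟨a, ha, hda, hab⟩ := h b.1 b.2.1 b.2.2
    refine ⟨A.cls ⟨a, ha, hda⟩, ?_⟩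
    refine (sub_eq_zero.1 ((cls_eq_zero (b - f.cocyclesMap k ⟨a, ha, hda⟩)).2 hab)).symm

theorem cohomologyMap_comp {A B C : CDGA} (g : CDGAHom B C) (f : CDGAHom A B) (k : ℕ) :
    ⇑((g.comp f).cohomologyMap k) = g.cohomologyMap k ∘ f.cohomologyMap k := by
  funext a
  obtain ⟨a, rfl⟩ := Submodule.Quotient.mk_surjective _ a
  rfl

theorem IsQuasiIso.comp {A B C : CDGA} {g : CDGAHom B C} {f : CDGAHom A B} (hg : g.IsQuasiIso)
    (hf : f.IsQuasiIso) : (g.comp f).IsQuasiIso := fun k => by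
  rw [cohomologyMap_comp]
  exact (hg k).comp (hf k)

/-- A degreewise surjective morphism with acyclic kernel is a quasi-isomorphism. -/
theorem isQuasiIso_of_surjective {A B : CDGA} (f : CDGAHom A B)
    (hs : ∀ k, ∀ b ∈ B.gr k, ∃ a ∈ A.gr k, f a = b)
    (hk : ∀ a, f a = 0 → A.d a = 0 → ∃ c, f c = 0 ∧ A.d c = a) : f.IsQuasiIso := by
  intro k
  constructor
  · rw [injective_iff]
    rintro a ha hda ⟨b, hb⟩
    -- The primitive `b` need not be homogeneous, whereas surjectivity is assumed degree by degree.
    have hs' : ∃ a', f a' = b := by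
      refine hom_induction (P := fun b => ∃ a', f a' = b) ⟨0, map_zero f.toAlgHom⟩ ?_ ?_ b
      · intro k b hb
        obtain ⟨a, -, h⟩ := hs k b hb
        exact ⟨a, h⟩
      · rintro _ _ ⟨a, rfl⟩ ⟨a', rfl⟩
        exact ⟨a + a', map_add f.toAlgHom a a'⟩
    obtain ⟨a', rfl⟩ := hs'
    -- Subtracting `da'` moves the cocycle into the acyclic kernel.
    obtain ⟨c, -, hc⟩ := hk (a - A.d a') (by rw [map_sub, f.map_d, hb, sub_self])
      (by rw [map_sub, hda, A.d_d, sub_zero])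
    exact ⟨c + a', by rw [map_add, hc, sub_add_cancel]⟩
  · rw [surjective_iff]
    intro b hb hdb
    obtain ⟨a, ha, rfl⟩ := hs k b hb
    obtain ⟨c, hc0, hc⟩ := hk (A.d a) (by rw [f.map_d, hdb]) (A.d_d a)
    -- A lift of a cocycle fails to be closed by an element of the kernel, whose primitive `c`
    -- corrects it. Only the degree `k` component of `c` matters, and it lies in the kernel too.
    refine ⟨a - A.proj k c, Submodule.sub_mem _ ha (A.proj_mem k c), ?_, ?_⟩
    · rw [map_sub, ← proj_succ_d, hc, proj_same (A.d_mem ha), sub_self]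
    · have : f (A.proj k c) = B.proj k (f c) := by
        refine hom_induction (P := fun c => f (A.proj k c) = B.proj k (f c)) ?_ ?_ ?_ c
        · simp only [map_zero]
        · intro j c hc
          by_cases h : j = k
          · subst h
            rw [proj_same hc, proj_same (f.map_gr hc)]
          · rw [proj_ne hc h, proj_ne (f.map_gr hc) h, map_zero]
        · intro x y h1 h2
          simp only [map_add, h1, h2]
      rw [map_sub, this, hc0, map_zero, sub_zero, sub_self]
      exact Submodule.zero_mem _

end CDGAHom

end RHT

namespace RHT

open CDGA

/-! ### Relative free CDGAs over a CDGA `M` -/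

/-- A differential on `B ⊗ ΛU`, extending the one of `B`, together with an extension to `B ⊗ ΛU` of
the morphism `f : B → M`. -/
structure RelFreeOver {B M : CDGA} (f : CDGAHom B M) where
  U : ℕ → Type
  [addCommGroup : ∀ p, AddCommGroup (U p)]
  [module : ∀ p, Module ℚ (U p)]
  δ : ∀ p, U p →ₗ[ℚ] RelFree B U
  δ_mem : ∀ p u, δ p u ∈ RelFree.gr B U (p + 1)
  diff_δ : ∀ p u, RelFree.diff δ_mem (δ p u) = 0
  g : ∀ p, U p →ₗ[ℚ] M
  g_mem : ∀ p u, g p u ∈ M.gr p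
  lift_δ : ∀ p u, RelFree.lift f.toAlgHom (fun _ _ => f.map_gr) g g_mem (δ p u) = M.d (g p u)

attribute [instance] RelFreeOver.addCommGroup RelFreeOver.module

namespace RelFreeOver

variable {B M : CDGA} {f : CDGAHom B M}

section

variable (S : RelFreeOver f)

/-- The differential. -/
noncomputable abbrev d : RelFree B S.U →ₗ[ℚ] RelFree B S.U := RelFree.diff S.δ_mem

/-- The underlying algebra map to `M`. -/
noncomputable abbrev φ₀ : RelFree B S.U →ₐ[ℚ] M :=
  RelFree.lift f.toAlgHom (fun _ _ => f.map_gr) S.g S.g_mem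

theorem d_d (r : RelFree B S.U) : S.d (S.d r) = 0 := RelFree.diff_diff S.δ_mem S.diff_δ r

theorem φ₀_d (r : RelFree B S.U) : S.φ₀ (S.d r) = M.d (S.φ₀ r) := by
  refine RelFree.map_diff S.δ_mem (fun _ _ hx y => M.leibniz hx y) S.φ₀
    (fun _ _ => RelFree.lift_mem _ _ _ _) (fun b => ?_) (fun p u => ?_) r
  · rw [RelFree.lift_base, RelFree.lift_base]
    exact f.map_d b
  · rw [RelFree.lift_gen]
    exact S.lift_δ p u

/-- The CDGA `(B ⊗ ΛU, D)`. -/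
noncomputable abbrev E : CDGA where
  carrier := RelFree B S.U
  gr := RelFree.gr B S.U
  graded := tensorGraded (A := B) (A' := FreeCGA.cdga S.U)
  d := S.d
  d_mem := RelFree.diff_mem S.δ_mem
  d_d := S.d_d
  leibniz := RelFree.diff_leibniz S.δ_mem
  graded_comm := RelFree.graded_comm

/-- The inclusion of `B`. -/
noncomputable def incl : CDGAHom B S.E where
  toAlgHom := RelFree.base B S.U
  map_gr := RelFree.base_mem
  map_d b := (RelFree.diff_base S.δ_mem b).symm

/-- The morphism to `M`. -/
noncomputable def φ : CDGAHom S.E M where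
  toAlgHom := S.φ₀
  map_gr := RelFree.lift_mem _ _ _ _
  map_d := S.φ₀_d

theorem φ_comp_incl : S.φ.comp S.incl = f := by
  exact CDGAHom.ext_apply fun b =>
    RelFree.lift_base f.toAlgHom (fun _ _ => f.map_gr) S.g S.g_mem b

theorem map_d_of_comm {S S' : RelFreeOver f} {h : ∀ p, S.U p →ₗ[ℚ] S'.U p}
    (hh : ∀ p u, RelFree.map B h (S.δ p u) = S'.δ p (h p u)) (r : RelFree B S.U) :
    RelFree.map B h (S.d r) = S'.d (RelFree.map B h r) := by
  refine RelFree.map_diff (M := S'.E) S.δ_mem (fun _ _ hx y => S'.E.leibniz hx y) (RelFree.map B h)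
    (fun _ _ => RelFree.map_mem h) (fun b => ?_) (fun p u => ?_) r
  · rw [RelFree.map_base, RelFree.map_base]
    exact (RelFree.diff_base S'.δ_mem b).symm
  · rw [RelFree.map_gen, hh]
    exact (RelFree.diff_gen S'.δ_mem _).symm

/-! #### Killing the kernel in cohomology -/

/-- Subspaces `K p` of cocycles of degree `p + 1`, for `p ≥ 1`, that represent the kernel of
`H^{p+1}(B ⊗ ΛU) → H^{p+1}(M)`, with primitives of their images in `M`. -/
structure Kernel where
  K : ℕ → Submodule ℚ (RelFree B S.U)
  mem : ∀ p, ∀ z ∈ K p, z ∈ RelFree.gr B S.U (p + 1)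
  closed : ∀ p, ∀ z ∈ K p, S.d z = 0
  zero : K 0 = ⊥
  exact : ∀ p, ∀ z ∈ K p, z ∈ LinearMap.range S.d → z = 0
  exists_rep : ∀ p, 1 ≤ p → ∀ z ∈ RelFree.gr B S.U (p + 1), S.d z = 0 →
    S.φ₀ z ∈ LinearMap.range M.d → ∃ κ ∈ K p, z - κ ∈ LinearMap.range S.d
  m : ∀ p, K p →ₗ[ℚ] M
  m_mem : ∀ p z, m p z ∈ M.gr p
  d_m : ∀ p z, M.d (m p z) = S.φ₀ z

/-- `K` is a linear complement of the coboundaries inside the space `N` of cocycles whose image in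
`M` is exact. It therefore represents each class in the kernel exactly once. -/
theorem exists_kernel_degree (p : ℕ) : ∃ K : Submodule ℚ (RelFree B S.U),
    (∀ z ∈ K, z ∈ RelFree.gr B S.U (p + 1)) ∧ (∀ z ∈ K, S.d z = 0) ∧
    (∀ z ∈ K, z ∈ LinearMap.range S.d → z = 0) ∧
    (∀ z ∈ RelFree.gr B S.U (p + 1), S.d z = 0 → S.φ₀ z ∈ LinearMap.range M.d →
      ∃ κ ∈ K, z - κ ∈ LinearMap.range S.d) ∧
    ∃ m : K →ₗ[ℚ] M, (∀ z, m z ∈ M.gr p) ∧ ∀ z, M.d (m z) = S.φ₀ z := by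
  let dp : M.gr p →ₗ[ℚ] M := M.d ∘ₗ (M.gr p).subtype
  let N : Submodule ℚ (RelFree B S.U) := RelFree.gr B S.U (p + 1) ⊓ LinearMap.ker S.d ⊓
    (LinearMap.range dp).comap S.φ₀.toLinearMap
  let Bd : Submodule ℚ (RelFree B S.U) := S.E.coboundaries (p + 1)
  have hBd : Bd ≤ N := by
    rintro z ⟨hz, hz'⟩
    obtain ⟨a, ha, rfl⟩ := S.E.exists_primitive hz hz'
    refine ⟨⟨hz, S.d_d a⟩, ⟨S.φ₀ a, S.φ.map_gr ha⟩, ?_⟩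
    exact (S.φ₀_d a).symm
  obtain ⟨C, hC⟩ := Bd.exists_isCompl
  refine ⟨N ⊓ C, fun z hz => hz.1.1.1, fun z hz => hz.1.1.2, fun z hz hz' => ?_,
    fun z hz hdz hφ => ?_, ?_⟩
  · exact (Submodule.disjoint_def.1 hC.disjoint) z ⟨hz.1.1.1, hz'⟩ hz.2
  · obtain ⟨r, hr, c, hc, rfl⟩ := Submodule.mem_sup.1
      (hC.sup_eq_top.ge (Submodule.mem_top (x := z)))
    refine ⟨c, ⟨?_, hc⟩, ?_⟩
    · have hz : r + c ∈ N := by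
        obtain ⟨a, ha, h⟩ := M.exists_primitive (S.φ.map_gr hz) hφ
        exact ⟨⟨hz, hdz⟩, ⟨a, ha⟩, h⟩
      have := Submodule.sub_mem _ hz (hBd hr)
      rwa [add_sub_cancel_left] at this
    · rw [add_sub_cancel_right]
      exact hr.2
  -- A linear section of `d` on `M^p` makes the chosen primitives depend linearly on the cocycle.
  · obtain ⟨s, hs⟩ := dp.rangeRestrict.exists_rightInverse_of_surjective dp.range_rangeRestrict
    let t : (N ⊓ C : Submodule ℚ (RelFree B S.U)) →ₗ[ℚ] LinearMap.range dp :=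
      LinearMap.codRestrict _ (S.φ₀.toLinearMap ∘ₗ (N ⊓ C).subtype) fun z => z.2.1.2
    refine ⟨(M.gr p).subtype ∘ₗ s ∘ₗ t, fun z => (s (t z)).2, fun z => ?_⟩
    exact congrArg Subtype.val (LinearMap.congr_fun hs (t z))

/-- In degree `p = 0` the subspace is set to zero, since a Sullivan algebra has generators in
positive degrees only. The kernel in `H¹` is thus never killed; `IsReduced` takes care of it. -/
theorem nonempty_kernel : Nonempty S.Kernel := by
  choose K h1 h2 h3 h4 m h5 h6 using S.exists_kernel_degree
  refine ⟨⟨fun p => if 1 ≤ p then K p else ⊥, ?_, ?_, rfl, ?_, ?_,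
    fun p => if h : 1 ≤ p then m p ∘ₗ Submodule.inclusion (by rw [if_pos h]) else 0, ?_, ?_⟩⟩
  · intro p z hz
    split_ifs at hz
    · exact h1 p z hz
    · rw [(Submodule.mem_bot ℚ).1 hz]
      exact Submodule.zero_mem _
  · intro p z hz
    split_ifs at hz
    · exact h2 p z hz
    · rw [(Submodule.mem_bot ℚ).1 hz, map_zero]
  · intro p z hz hz'
    split_ifs at hz
    · exact h3 p z hz hz'
    · exact (Submodule.mem_bot ℚ).1 hz
  · intro p hp z hz hdz hφ
    rw [if_pos hp]
    exact h4 p z hz hdz hφ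
  · intro p z
    split_ifs with h
    · exact h5 p _
    · exact Submodule.zero_mem _
  · rintro p ⟨z, hz⟩
    split_ifs with h
    · exact h6 p _
    · rw [if_neg h] at hz
      simp [(Submodule.mem_bot ℚ).1 hz]

/-- A choice of representatives of the kernel in cohomology. -/
noncomputable def kernel : S.Kernel := S.nonempty_kernel.some

/-- The inclusion of `U` into `U ⊕ K`. -/
noncomputable abbrev nextIncl (p : ℕ) : S.U p →ₗ[ℚ] S.U p × S.kernel.K p := LinearMap.inl ℚ _ _

/-- The values of the differential on `U ⊕ K`. -/
noncomputable def nextδ (p : ℕ) :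
    S.U p × S.kernel.K p →ₗ[ℚ] RelFree B (fun p => S.U p × S.kernel.K p) :=
  (RelFree.map B S.nextIncl).toLinearMap ∘ₗ (S.δ p).coprod (S.kernel.K p).subtype

theorem nextδ_apply (p : ℕ) (u : S.U p × S.kernel.K p) :
    S.nextδ p u = RelFree.map B S.nextIncl (S.δ p u.1 + u.2) := rfl

theorem nextδ_mem (p : ℕ) (u : S.U p × S.kernel.K p) : S.nextδ p u ∈ RelFree.gr B _ (p + 1) :=
  RelFree.map_mem _ (Submodule.add_mem _ (S.δ_mem p _) (S.kernel.mem p _ u.2.2))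

theorem map_nextIncl_d (r : RelFree B S.U) : RelFree.map B S.nextIncl (S.d r) =
    RelFree.diff S.nextδ_mem (RelFree.map B S.nextIncl r) := by
  refine RelFree.map_diff (M := tensor B (FreeCGA.cdga fun p => S.U p × S.kernel.K p)) S.δ_mem
    (fun _ _ hx y => RelFree.diff_leibniz S.nextδ_mem hx y) (RelFree.map B S.nextIncl)
    (fun _ _ => RelFree.map_mem S.nextIncl) (fun b => ?_) (fun p u => ?_) r
  · rw [RelFree.map_base, RelFree.map_base, RelFree.diff_base]
  · rw [RelFree.map_gen, RelFree.diff_gen, nextδ_apply]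
    simp

theorem lift_map {S : RelFreeOver f} {U' : ℕ → Type} [∀ p, AddCommGroup (U' p)]
    [∀ p, Module ℚ (U' p)]
    {h : ∀ p, S.U p →ₗ[ℚ] U' p} {g' : ∀ p, U' p →ₗ[ℚ] M} (hg' : ∀ p u, g' p u ∈ M.gr p)
    (e : ∀ p u, g' p (h p u) = S.g p u) (r : RelFree B S.U) :
    RelFree.lift f.toAlgHom (fun _ _ => f.map_gr) g' hg' (RelFree.map B h r) = S.φ₀ r := by
  refine RelFree.algHom_ext
    (φ := (RelFree.lift f.toAlgHom (fun _ _ => f.map_gr) g' hg').comp (RelFree.map B h))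
    (ψ := S.φ₀) (fun b => ?_) (fun p u => ?_) r
  · rw [AlgHom.comp_apply, RelFree.map_base, RelFree.lift_base, RelFree.lift_base]
  · rw [AlgHom.comp_apply, RelFree.map_gen, RelFree.lift_gen, RelFree.lift_gen, e]

/-- The values on `U ⊕ K` of the morphism to `M`. -/
noncomputable def nextG (p : ℕ) : S.U p × S.kernel.K p →ₗ[ℚ] M := (S.g p).coprod (S.kernel.m p)

theorem nextG_mem (p : ℕ) (u : S.U p × S.kernel.K p) : S.nextG p u ∈ M.gr p :=
  Submodule.add_mem _ (S.g_mem p _) (S.kernel.m_mem p _)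

/-- Attaching generators that kill the kernel in cohomology. -/
noncomputable def next : RelFreeOver f where
  U p := S.U p × S.kernel.K p
  δ := S.nextδ
  δ_mem := S.nextδ_mem
  diff_δ p u := by
    rw [nextδ_apply, ← map_nextIncl_d, map_add, S.diff_δ, S.kernel.closed p _ u.2.2, add_zero,
      map_zero]
  g := S.nextG
  g_mem := S.nextG_mem
  lift_δ p u := by
    rw [nextδ_apply, lift_map (S := S) S.nextG_mem (fun p u => by simp [nextG]), map_add, S.lift_δ,
      ← S.kernel.d_m, ← map_add]
    rfl

/-- The conditions on the generators of degrees `0` and `1` that ensure that nothing has to be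
killed in cohomological degrees `0` and `1`. -/
structure IsReduced : Prop where
  zero : ∀ u : S.U 0, u = 0
  one : ∀ u : S.U 1, S.δ 1 u = 0 → u = 0

/-- If a new combination `u + κ` of degree 1 is closed, then `κ = -du` is exact. Nonzero elements of
`K` are never exact, so `κ = 0`, and the old stage gives `u = 0`. -/
theorem isReduced_next (hS : S.IsReduced) : S.next.IsReduced where
  zero := by
    rintro ⟨u, κ, hκ⟩
    have h0 : κ = 0 := by rwa [S.kernel.zero, Submodule.mem_bot] at hκ
    subst h0
    exact Prod.ext (hS.zero u) rfl
  one := by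
    rintro ⟨u, κ⟩ h
    obtain ⟨h', hh'⟩ := RelFree.exists_map_leftInverse (B := B) (h := S.nextIncl)
      (fun p => LinearMap.inl_injective)
    have h1 : S.δ 1 u + κ = 0 := by
      rw [← hh' (S.δ 1 u + κ)]
      exact (congrArg (RelFree.map B h') h).trans (map_zero _)
    have h2 : (κ : RelFree B S.U) = 0 := by
      refine S.kernel.exact 1 _ κ.2 ⟨-RelFree.gen B S.U 1 u, ?_⟩
      rw [map_neg, RelFree.diff_gen]
      exact (eq_neg_of_add_eq_zero_right h1).symm
    rw [h2, add_zero] at h1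
    exact Prod.ext (hS.one u h1) (Subtype.ext h2)

end

variable (f) in
/-- `B` itself. -/
noncomputable def base : RelFreeOver f where
  U _ := PUnit
  δ _ := 0
  δ_mem _ _ := Submodule.zero_mem _
  diff_δ _ _ := map_zero _
  g _ := 0
  g_mem _ _ := Submodule.zero_mem _
  lift_δ _ _ := by simp

variable (f) in
/-- The sequence of extensions of `B` obtained by repeatedly killing kernels in cohomology. -/
noncomputable def seq : ℕ → RelFreeOver f
  | 0 => base f
  | n + 1 => (seq n).next

theorem isReduced_seq (n : ℕ) : (seq f n).IsReduced := by
  induction n with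
  | zero => exact ⟨fun _ => rfl, fun _ _ => rfl⟩
  | succ n ih => exact isReduced_next _ ih

/-! #### The union of the sequence -/

variable (f) in
/-- All generators. -/
abbrev LimU (p : ℕ) : Type := ⨁ n, (seq f n).kernel.K p

variable (f) in
/-- The inclusion of the generators of the `n`-th extension. -/
noncomputable def limIncl : ∀ n p, (seq f n).U p →ₗ[ℚ] LimU f p
  | 0, _ => 0
  | n + 1, p => (limIncl n p).coprod (DirectSum.lof ℚ ℕ (fun n => (seq f n).kernel.K p) n)

theorem limIncl_succ (n p : ℕ) (u : (seq f n).U p) (κ : (seq f n).kernel.K p) :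
    limIncl f (n + 1) p (u, κ) =
      limIncl f n p u + DirectSum.lof ℚ ℕ (fun n => (seq f n).kernel.K p) n κ := rfl

theorem limIncl_nextIncl (n p : ℕ) (u : (seq f n).U p) :
    limIncl f (n + 1) p ((seq f n).nextIncl p u) = limIncl f n p u := by
  rw [LinearMap.inl_apply, limIncl_succ, map_zero, add_zero]

/-- Stage `m` only involves the summands with index below `m`. The component of index `n` of an
element of stage `n + 1` hence isolates the newest generator, which gives injectivity of `limIncl`.
-/
theorem limIncl_apply_of_le {m n : ℕ} (h : m ≤ n) (p : ℕ) (u : (seq f m).U p) :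
    limIncl f m p u n = 0 := by
  induction m with
  | zero => rfl
  | succ m ih =>
    obtain ⟨u, κ⟩ := u
    rw [limIncl_succ, DirectSum.add_apply, ih (by omega), DirectSum.lof_eq_of,
      DirectSum.of_eq_of_ne _ _ _ (by omega), add_zero]

theorem limIncl_injective (n p : ℕ) : Function.Injective (limIncl f n p) := by
  rw [injective_iff_map_eq_zero]
  induction n with
  | zero => exact fun _ _ => rfl
  | succ n ih =>
    rintro ⟨u, κ⟩ h
    rw [limIncl_succ] at h
    have h1 := congrArg (fun x => x n) h
    simp only [DirectSum.add_apply, limIncl_apply_of_le le_rfl, DirectSum.lof_apply, zero_add,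
      DirectSum.zero_apply] at h1
    rw [h1, map_zero, add_zero] at h
    exact Prod.ext (ih u h) h1

theorem exists_limIncl_of_le {m n : ℕ} (h : m ≤ n) (p : ℕ) (u : (seq f m).U p) :
    ∃ u', limIncl f n p u' = limIncl f m p u := by
  induction h with
  | refl => exact ⟨u, rfl⟩
  | @step n _ ih =>
    obtain ⟨u', h⟩ := ih
    exact ⟨(seq f n).nextIncl p u', by rw [limIncl_nextIncl, h]⟩

theorem exists_limIncl (p : ℕ) (u : LimU f p) : ∃ n u', limIncl f n p u' = u := by
  induction u using DirectSum.induction_on with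
  | zero => exact ⟨0, 0, map_zero _⟩
  | of n κ =>
    refine ⟨n + 1, (0, κ), ?_⟩
    rw [limIncl_succ, map_zero, zero_add]
    rfl
  | add x y hx hy =>
    obtain ⟨n, u, rfl⟩ := hx
    obtain ⟨m, v, rfl⟩ := hy
    obtain ⟨u', hu⟩ := exists_limIncl_of_le (le_max_left n m) p u
    obtain ⟨v', hv⟩ := exists_limIncl_of_le (le_max_right n m) p v
    exact ⟨max n m, u' + v', by rw [map_add, hu, hv]⟩

variable (f) in
/-- The values of the differential on the generators. -/
noncomputable def limδ (p : ℕ) : LimU f p →ₗ[ℚ] RelFree B (LimU f) :=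
  DirectSum.toModule ℚ ℕ _ fun n =>
    (RelFree.map B (limIncl f n)).toLinearMap ∘ₗ ((seq f n).kernel.K p).subtype

variable (f) in
/-- The values on the generators of the morphism to `M`. -/
noncomputable def limG (p : ℕ) : LimU f p →ₗ[ℚ] M :=
  DirectSum.toModule ℚ ℕ _ fun n => (seq f n).kernel.m p

/-- All identities in the union are checked at a finite stage by means of this compatibility and
`limG_limIncl`. -/
theorem limδ_limIncl (n p : ℕ) (u : (seq f n).U p) :
    limδ f p (limIncl f n p u) = RelFree.map B (limIncl f n) ((seq f n).δ p u) := by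
  induction n with
  | zero =>
    have h1 : limIncl f 0 p u = 0 := rfl
    have h2 : (seq f 0).δ p u = 0 := rfl
    rw [h1, h2, map_zero, map_zero]
  | succ n ih =>
    obtain ⟨u, κ⟩ := u
    have h : (seq f (n + 1)).δ p (u, κ) =
        RelFree.map B (seq f n).nextIncl ((seq f n).δ p u + κ) := rfl
    rw [limIncl_succ, map_add, ih, h]
    refine Eq.trans ?_ (RelFree.map_map (fun p u => limIncl_nextIncl n p u) _).symm
    rw [map_add, limδ, DirectSum.toModule_lof]
    rfl

theorem limG_limIncl (n p : ℕ) (u : (seq f n).U p) :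
    limG f p (limIncl f n p u) = (seq f n).g p u := by
  induction n with
  | zero => exact map_zero _
  | succ n ih =>
    obtain ⟨u, κ⟩ := u
    rw [limIncl_succ, map_add, ih, limG, DirectSum.toModule_lof]
    rfl

theorem limδ_mem (p : ℕ) (u : LimU f p) : limδ f p u ∈ RelFree.gr B (LimU f) (p + 1) := by
  obtain ⟨n, u, rfl⟩ := exists_limIncl p u
  rw [limδ_limIncl]
  exact RelFree.map_mem _ ((seq f n).δ_mem p u)

theorem limG_mem (p : ℕ) (u : LimU f p) : limG f p u ∈ M.gr p := by
  obtain ⟨n, u, rfl⟩ := exists_limIncl p u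
  rw [limG_limIncl]
  exact (seq f n).g_mem p u

theorem map_limIncl_d (n : ℕ) (r : RelFree B (seq f n).U) :
    RelFree.map B (limIncl f n) ((seq f n).d r) =
      RelFree.diff limδ_mem (RelFree.map B (limIncl f n) r) := by
  refine RelFree.map_diff (M := tensor B (FreeCGA.cdga (LimU f))) (seq f n).δ_mem
    (fun _ _ hx y => RelFree.diff_leibniz limδ_mem hx y) (RelFree.map B (limIncl f n))
    (fun _ _ => RelFree.map_mem _) (fun b => ?_) (fun p u => ?_) r
  · rw [RelFree.map_base, RelFree.map_base, RelFree.diff_base]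
  · rw [RelFree.map_gen, RelFree.diff_gen, limδ_limIncl]

variable (f) in
/-- The union of the sequence of extensions. -/
noncomputable def lim : RelFreeOver f where
  U := LimU f
  δ := limδ f
  δ_mem := limδ_mem
  diff_δ p u := by
    obtain ⟨n, u, rfl⟩ := exists_limIncl p u
    rw [limδ_limIncl, ← map_limIncl_d, (seq f n).diff_δ, map_zero]
  g := limG f
  g_mem := limG_mem
  lift_δ p u := by
    obtain ⟨n, u, rfl⟩ := exists_limIncl p u
    rw [limδ_limIncl, lift_map (S := seq f n) limG_mem (fun p u => limG_limIncl n p u),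
      (seq f n).lift_δ, limG_limIncl]

end RelFreeOver

end RHT

namespace RHT

open CDGA

/-! ### Low degrees of `B ⊗ ΛU` and the inclusion of `ΛU` -/

namespace RelFree

variable {B : CDGA} {U : ℕ → Type} [∀ p, AddCommGroup (U p)] [∀ p, Module ℚ (U p)]

theorem gr_zero (hB : ∀ b ∈ B.gr 0, ∃ q : ℚ, b = algebraMap ℚ B q) (hU : ∀ u : U 0, u = 0)
    {r : RelFree B U} (hr : r ∈ gr B U 0) : ∃ q : ℚ, r = q • 1 := by
  have key : ∀ k (r : RelFree B U), IsMonomial k r → k = 0 → ∃ q : ℚ, r = q • 1 := by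
    intro k r hr hk
    induction hr with
    | base hb =>
      subst hk
      obtain ⟨q, rfl⟩ := hB _ hb
      exact ⟨q, by rw [Algebra.algebraMap_eq_smul_one, map_smul, map_one]⟩
    | @mul_gen k p r _ u _ =>
      obtain rfl : p = 0 := by omega
      exact ⟨0, by rw [hU u, map_zero, mul_zero, zero_smul]⟩
  refine gr_induction (Q := fun r => ∃ q : ℚ, r = q • 1) ⟨0, (zero_smul _ _).symm⟩
    (fun r hr => key 0 r hr rfl) ?_ hr
  rintro _ _ ⟨q, rfl⟩ ⟨q', rfl⟩
  exact ⟨q + q', (add_smul _ _ _).symm⟩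

/-- As `B¹ = 0` and there are no generators of degree 0, a monomial of degree 1 is a scalar times a
generator. -/
theorem gr_one (hB : B.IsOneConnected) (hU : ∀ u : U 0, u = 0)
    {r : RelFree B U} (hr : r ∈ gr B U 1) : ∃ u, r = gen B U 1 u := by
  have key : ∀ k (r : RelFree B U), IsMonomial k r → k = 1 → ∃ u, r = gen B U 1 u := by
    intro k r hr hk
    cases hr with
    | base hb =>
      subst hk
      rw [hB.gr_one, Submodule.mem_bot] at hb
      exact ⟨0, by rw [hb, map_zero, map_zero]⟩
    | @mul_gen k p r hr u =>
      by_cases hp : p = 0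
      · subst hp
        exact ⟨0, by rw [hU u, map_zero, mul_zero, map_zero]⟩
      · obtain ⟨rfl, rfl⟩ : p = 1 ∧ k = 0 := by omega
        obtain ⟨q, rfl⟩ := gr_zero hB.gr_zero hU hr.mem
        exact ⟨q • u, by rw [smul_mul_assoc, one_mul, map_smul]⟩
  refine gr_induction (Q := fun r => ∃ u, r = gen B U 1 u) ⟨0, (map_zero _).symm⟩
    (fun r hr => key 1 r hr rfl) ?_ hr
  rintro _ _ ⟨u, rfl⟩ ⟨u', rfl⟩
  exact ⟨u + u', (map_add _ _ _).symm⟩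

/-- A linear form `ε` on `B` with `ε 1 ≠ 0` retracts `B ⊗ ΛU` onto `ΛU` up to the scalar `ε 1`. -/
theorem fiber_injective [Nontrivial B] : Function.Injective (fiber B U) := by
  obtain ⟨ε, hε⟩ := Module.Projective.exists_dual_ne_zero ℚ (one_ne_zero (α := B))
  rw [injective_iff_map_eq_zero]
  intro x hx
  have h1 : TensorProduct.lid ℚ (FreeCGA U) (TensorProduct.map ε LinearMap.id
      ((GradedTensorProduct.of ℚ B.gr (FreeCGA.gr U)).symm (fiber B U x))) = ε 1 • x := rfl
  rw [hx, map_zero, map_zero, map_zero] at h1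
  exact (smul_eq_zero.1 h1.symm).resolve_left hε

end RelFree

/-! ### The union is a relative Sullivan algebra and a model -/

namespace RelFreeOver

variable {B M : CDGA} {f : CDGAHom B M}

/-- The generators of degree `p` as a subspace of `B ⊗ ΛU`. -/
noncomputable def genSpace (S : RelFreeOver f) (p : ℕ) : Submodule ℚ S.E :=
  LinearMap.range (RelFree.gen B S.U p)

theorem genSpace_le (S : RelFreeOver f) (p : ℕ) : S.genSpace p ≤ S.E.gr p := by
  rintro _ ⟨u, rfl⟩
  exact RelFree.gen_mem u

/-- `B ⊗ Λ(genSpace) → B ⊗ ΛU` is an isomorphism. -/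
theorem bijective_relFreeMap [Nontrivial B] (S : RelFreeOver f) :
    Function.Bijective (relFreeMap S.incl S.genSpace S.genSpace_le) := by
  have hinj := RelFree.fiber_injective (B := B) (U := S.U)
  let F := FreeCGA.toCDGA S.E S.genSpace S.genSpace_le
  have hF : ∀ p v, F (FreeCGA.ι _ p v) = (v : S.E) := fun p v => FreeCGA.lift_ι (T := S.E)
    (fun p => (S.genSpace p).subtype)
    (fun _ _ v w => S.E.graded_comm (S.genSpace_le _ v.2) (S.genSpace_le _ w.2)) p v
  -- The generators are abstract in `ΛU` and a subspace of `E` in `IsRelativeSullivan`. The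
  -- comparison `Ψ` is injective because `F ∘ Ψ` is the inclusion of `ΛU`, and surjective because it
  -- hits the generators.
  let Ψ : FreeCGA S.U →ₐ[ℚ] FreeCGA (fun p => S.genSpace p) :=
    FreeCGA.lift (fun p => FreeCGA.ι _ p ∘ₗ (RelFree.gen B S.U p).rangeRestrict)
      fun i j v w => FreeCGA.ι_mul_ι _ _
  have hFΨ : ∀ x, F (Ψ x) = RelFree.fiber B S.U x := by
    intro x
    refine AlgHom.congr_fun (FreeCGA.algHom_ext (f := F.comp Ψ) (g := RelFree.fiber B S.U) ?_) x
    intro p v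
    rw [AlgHom.comp_apply, FreeCGA.lift_ι]
    exact hF p _
  have hΨ : Function.Bijective Ψ := by
    constructor
    · intro x y h
      exact hinj (by rw [← hFΨ, ← hFΨ, h])
    · have : Ψ.range = ⊤ := FreeCGA.eq_top_of_ι_mem fun p v => by
        obtain ⟨_, u, rfl⟩ := v
        refine ⟨FreeCGA.ι _ p u, ?_⟩
        exact FreeCGA.lift_ι _ _ _ _
      intro y
      exact (this.ge (Algebra.mem_top (x := y)) : y ∈ Ψ.range)
  let e : B ⊗[ℚ] FreeCGA S.U ≃ₗ[ℚ] B ⊗[ℚ] FreeCGA (fun p => S.genSpace p) :=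
    TensorProduct.congr (LinearEquiv.refl ℚ B) (LinearEquiv.ofBijective Ψ.toLinearMap hΨ)
  have h : relFreeMap S.incl S.genSpace S.genSpace_le ∘ₗ e.toLinearMap =
      (GradedTensorProduct.of ℚ B.gr (FreeCGA.gr S.U)).toLinearMap := by
    refine TensorProduct.ext' fun b x => ?_
    change RelFree.base B S.U b * F (Ψ x) = tm (A' := FreeCGA.cdga S.U) b x
    rw [hFΨ, RelFree.base_mul_fiber]
  have h2 : ⇑(relFreeMap S.incl S.genSpace S.genSpace_le) =
      ⇑(GradedTensorProduct.of ℚ B.gr (FreeCGA.gr S.U)) ∘ ⇑e.symm := by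
    funext y
    obtain ⟨x, rfl⟩ := e.surjective y
    rw [Function.comp_apply, LinearEquiv.symm_apply_apply]
    exact LinearMap.congr_fun h x
  rw [h2]
  exact (LinearEquiv.bijective _).comp (LinearEquiv.bijective _)

/-- A presentation of `S` as the union of an increasing sequence of reduced extensions, starting
with `B`, each of which kills the kernel in cohomology of the preceding one. -/
structure Exhaustion (S : RelFreeOver f) where
  T : ℕ → RelFreeOver f
  j : ∀ n p, (T n).U p →ₗ[ℚ] S.U p
  injective : ∀ n p, Function.Injective (j n p)
  δ_j : ∀ n p u, S.δ p (j n p u) = RelFree.map B (j n) ((T n).δ p u)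
  g_j : ∀ n p u, S.g p (j n p u) = (T n).g p u
  mono : ∀ n p u, ∃ u', j (n + 1) p u' = j n p u
  exists_j : ∀ p u, ∃ n u', j n p u' = u
  zero : ∀ p (u : (T 0).U p), u = 0
  isReduced : ∀ n, (T n).IsReduced
  δ_succ : ∀ n p u, ∃ r, S.δ p (j (n + 1) p u) = RelFree.map B (j n) r
  kill : ∀ n p, 1 ≤ p → ∀ z ∈ RelFree.gr B (T n).U (p + 1), (T n).d z = 0 →
    (T n).φ₀ z ∈ LinearMap.range M.d → ∃ u a, S.δ p u = RelFree.map B (j n) (z - (T n).d a)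

variable (f) in
/-- The union of the sequence of extensions is exhausted by them. -/
noncomputable def limExhaustion : Exhaustion (lim f) where
  T := seq f
  j := limIncl f
  injective := limIncl_injective
  δ_j := limδ_limIncl
  g_j := limG_limIncl
  mono n p u := ⟨(seq f n).nextIncl p u, limIncl_nextIncl n p u⟩
  exists_j := exists_limIncl
  zero _ _ := rfl
  isReduced := isReduced_seq
  δ_succ := by
    rintro n p ⟨u, κ⟩
    refine ⟨(seq f n).δ p u + κ, ?_⟩
    refine (limδ_limIncl (n + 1) p (u, κ)).trans ?_
    exact RelFree.map_map (fun p u => limIncl_nextIncl n p u) _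
  kill := by
    intro n p hp z hz hdz hφ
    obtain ⟨κ, hκ, a, ha⟩ := (seq f n).kernel.exists_rep p hp z hz hdz hφ
    refine ⟨DirectSum.lof ℚ ℕ (fun n => (seq f n).kernel.K p) n ⟨κ, hκ⟩, a, ?_⟩
    have h : limδ f p (DirectSum.lof ℚ ℕ (fun n => (seq f n).kernel.K p) n ⟨κ, hκ⟩) =
        RelFree.map B (limIncl f n) κ := DirectSum.toModule_lof ℚ n _
    rw [ha, sub_sub_cancel]
    exact h

section Exhaustion

variable {S : RelFreeOver f} (X : Exhaustion S)

namespace Exhaustion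

theorem map_mem_adjoin (n : ℕ) (r : RelFree B (X.T n).U) :
    RelFree.map B (X.j n) r ∈ Algebra.adjoin ℚ (Set.range (RelFree.base B S.U) ∪
      ⋃ p, (LinearMap.range (RelFree.gen B S.U p ∘ₗ X.j n p) : Set (RelFree B S.U))) := by
  refine RelFree.induction (Q := fun r => RelFree.map B (X.j n) r ∈
    Algebra.adjoin ℚ (Set.range (RelFree.base B S.U) ∪
      ⋃ p, (LinearMap.range (RelFree.gen B S.U p ∘ₗ X.j n p) : Set (RelFree B S.U)))) ?_ ?_ ?_ r
  · rw [map_zero]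
    exact Subalgebra.zero_mem _
  · intro k r hr
    induction hr with
    | base _ =>
      rw [RelFree.map_base]
      exact Algebra.subset_adjoin (Or.inl ⟨_, rfl⟩)
    | mul_gen _ u ih =>
      rw [map_mul, RelFree.map_gen]
      exact Subalgebra.mul_mem _ ih
        (Algebra.subset_adjoin (Or.inr (Set.mem_iUnion.2 ⟨_, ⟨u, rfl⟩⟩)))
  · intro x y h1 h2
    rw [map_add]
    exact Subalgebra.add_mem _ h1 h2

theorem exists_j_of_le {m n : ℕ} (h : m ≤ n) (p : ℕ) (u : (X.T m).U p) :
    ∃ u', X.j n p u' = X.j m p u := by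
  induction h with
  | refl => exact ⟨u, rfl⟩
  | @step n _ ih =>
    obtain ⟨u', h⟩ := ih
    rw [← h]
    exact X.mono n p u'

theorem exists_map_of_le {m n : ℕ} (h : m ≤ n) (r : RelFree B (X.T m).U) :
    ∃ r', RelFree.map B (X.j n) r' = RelFree.map B (X.j m) r := by
  refine RelFree.induction
    (Q := fun r => ∃ r', RelFree.map B (X.j n) r' = RelFree.map B (X.j m) r) ?_ ?_ ?_ r
  · exact ⟨0, by rw [map_zero, map_zero]⟩
  · intro k r hr
    induction hr with
    | @base k b _ => exact ⟨RelFree.base B _ b, by rw [RelFree.map_base, RelFree.map_base]⟩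
    | @mul_gen k p r _ u ih =>
      obtain ⟨r', hr⟩ := ih
      obtain ⟨u', hu⟩ := X.exists_j_of_le h p u
      exact ⟨r' * RelFree.gen B _ p u', by
        rw [map_mul, map_mul, RelFree.map_gen, RelFree.map_gen, hr, hu]⟩
  · rintro x y ⟨x', hx⟩ ⟨y', hy⟩
    exact ⟨x' + y', by rw [map_add, map_add, hx, hy]⟩

/-- An element involves finitely many generators, so it already lives at a finite stage. -/
theorem exists_map (r : RelFree B S.U) : ∃ n r', RelFree.map B (X.j n) r' = r := by
  refine RelFree.induction (Q := fun r => ∃ n r', RelFree.map B (X.j n) r' = r)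
    ⟨0, 0, map_zero _⟩ ?_ ?_ r
  · intro k r hr
    induction hr with
    | @base k b _ => exact ⟨0, RelFree.base B _ b, RelFree.map_base _ b⟩
    | @mul_gen k p r _ u ih =>
      obtain ⟨n, r, rfl⟩ := ih
      obtain ⟨m, u, rfl⟩ := X.exists_j p u
      obtain ⟨u', hu⟩ := X.exists_j_of_le (le_max_right n m) p u
      obtain ⟨r', hr⟩ := X.exists_map_of_le (le_max_left n m) r
      exact ⟨max n m, r' * RelFree.gen B _ p u', by rw [map_mul, RelFree.map_gen, hr, hu]⟩
  · rintro _ _ ⟨n, r, rfl⟩ ⟨m, s, rfl⟩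
    obtain ⟨r', hr⟩ := X.exists_map_of_le (le_max_left n m) r
    obtain ⟨s', hs⟩ := X.exists_map_of_le (le_max_right n m) s
    exact ⟨max n m, r' + s', by rw [map_add, hr, hs]⟩

include X in
theorem isReduced_total : S.IsReduced where
  zero u := by
    obtain ⟨n, u, rfl⟩ := X.exists_j 0 u
    rw [(X.isReduced n).zero u, map_zero]
  one u h := by
    obtain ⟨n, u, rfl⟩ := X.exists_j 1 u
    obtain ⟨h', hh'⟩ := RelFree.exists_map_leftInverse (B := B) (X.injective n)
    rw [X.δ_j] at h
    have h2 : (X.T n).δ 1 u = 0 := by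
      rw [← hh' ((X.T n).δ 1 u), h, map_zero]
    rw [(X.isReduced n).one u h2, map_zero]

include X in
-- The stages themselves filter the generators: those of stage `n + 1` have their differentials in
-- stage `n`.
theorem isRelativeSullivan (hB : B.IsOneConnected) : IsRelativeSullivan S.incl where
  base_nontrivial := hB.nontrivial
  base_connected b hb := hB.gr_zero b hb.1
  exists_generators := by
    have := hB.nontrivial
    refine ⟨S.genSpace, S.genSpace_le, ?_, S.bijective_relFreeMap,
      fun n p => LinearMap.range (RelFree.gen B S.U p ∘ₗ X.j n p), ?_, ?_, ?_, ?_⟩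
    · rw [eq_bot_iff]
      rintro _ ⟨u, rfl⟩
      rw [X.isReduced_total.zero u, map_zero]
      exact Submodule.zero_mem _
    · rintro n p _ ⟨u, rfl⟩
      obtain ⟨u', h⟩ := X.mono n p u
      exact ⟨u', congrArg (RelFree.gen B S.U p) h⟩
    · intro p
      apply le_antisymm
      · refine iSup_le fun n => ?_
        rintro _ ⟨u, rfl⟩
        exact ⟨X.j n p u, rfl⟩
      · rintro _ ⟨u, rfl⟩
        obtain ⟨n, u, rfl⟩ := X.exists_j p u
        exact Submodule.mem_iSup_of_mem n ⟨u, rfl⟩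
    -- Stage 0 is `B` alone, so `V(0) = 0` and the condition is empty.
    · rintro p _ ⟨u, rfl⟩
      refine ⟨0, ?_⟩
      rw [X.zero p u, map_zero, map_zero, map_zero]
    · rintro n p _ ⟨u, rfl⟩
      obtain ⟨r, hr⟩ := X.δ_succ n p u
      have h1 : S.d (RelFree.gen B S.U p (X.j (n + 1) p u)) = RelFree.map B (X.j n) r :=
        (RelFree.diff_gen S.δ_mem _).trans hr
      have h2 := X.map_mem_adjoin n r
      rw [← h1] at h2
      exact h2

theorem map_d (n : ℕ) (r : RelFree B (X.T n).U) :
    RelFree.map B (X.j n) ((X.T n).d r) = S.d (RelFree.map B (X.j n) r) :=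
  map_d_of_comm (fun p u => (X.δ_j n p u).symm) r

include X in
-- A cocycle with exact image in `M` descends to a cocycle of some stage `n`, still with exact
-- image, and a generator attached at the next stage bounds it up to a coboundary.
theorem exact_of_two_le {p : ℕ} (hp : 1 ≤ p) {z : RelFree B S.U}
    (hz : z ∈ RelFree.gr B S.U (p + 1)) (hdz : S.d z = 0)
    (hφ : S.φ₀ z ∈ LinearMap.range M.d) : z ∈ LinearMap.range S.d := by
  obtain ⟨n, z, rfl⟩ := X.exists_map z
  obtain ⟨h', hh'⟩ := RelFree.exists_map_leftInverse (B := B) (X.injective n)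
  -- The retraction onto stage `n` transports the degree, and below it transports closedness: it is
  -- applied to the image of `dz`, so it need not commute with the differential.
  have hz' : z ∈ RelFree.gr B (X.T n).U (p + 1) := by
    rw [← hh' z]
    exact RelFree.map_mem h' hz
  have hdz' : (X.T n).d z = 0 := by
    rw [← hh' ((X.T n).d z), X.map_d, hdz, map_zero]
  have hφ' : (X.T n).φ₀ z ∈ LinearMap.range M.d := by
    rwa [← lift_map (S := X.T n) S.g_mem (X.g_j n)]
  obtain ⟨u, a, h⟩ := X.kill n p hp z hz' hdz' hφ'
  refine ⟨RelFree.gen B S.U p u + RelFree.map B (X.j n) a, ?_⟩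
  rw [map_add, RelFree.diff_gen, h, ← X.map_d, ← map_add, sub_add_cancel]

include X in
-- Surjectivity is inherited from `f`, which factors through `S.φ`. Injectivity holds in degree 0
-- because only scalars occur and `M` is nonzero, in degree 1 because no nonzero element is closed,
-- and from degree 2 on by the attached generators.
theorem isQuasiIso (hB : B.IsOneConnected) (hM : Nontrivial M)
    (hf : ∀ k, Function.Surjective (f.cohomologyMap k)) : S.φ.IsQuasiIso := by
  intro k
  constructor
  · rw [CDGAHom.injective_iff]
    intro z hz hdz hφ
    match k with
    | 0 =>
      obtain ⟨q, rfl⟩ := RelFree.gr_zero hB.gr_zero X.isReduced_total.zero hz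
      have h : S.φ₀ (q • 1) = 0 := eq_zero_of_exact (S.φ.map_gr hz) hφ
      rw [map_smul, map_one, smul_eq_zero] at h
      rw [h.resolve_right one_ne_zero, zero_smul]
      exact Submodule.zero_mem _
    | 1 =>
      obtain ⟨u, rfl⟩ := RelFree.gr_one hB X.isReduced_total.zero hz
      have h : S.δ 1 u = 0 := (RelFree.diff_gen S.δ_mem u).symm.trans hdz
      rw [X.isReduced_total.one u h, map_zero]
      exact Submodule.zero_mem _
    | p + 2 => exact X.exact_of_two_le (by omega) hz hdz hφ
  · have h := hf k
    rw [← S.φ_comp_incl, CDGAHom.cohomologyMap_comp] at h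
    exact Function.Surjective.of_comp h

end Exhaustion

end Exhaustion

end RelFreeOver

/-- A morphism from a 1-connected CDGA that is surjective in cohomology has a relative Sullivan
model. -/
theorem exists_relativeSullivan_model {B M : CDGA} (f : CDGAHom B M) (hB : B.IsOneConnected)
    (hM : Nontrivial M) (hf : ∀ k, Function.Surjective (f.cohomologyMap k)) :
    ∃ (E : CDGA) (i : CDGAHom B E) (φ : CDGAHom E M),
      IsRelativeSullivan i ∧ φ.IsQuasiIso ∧ φ.comp i = f :=
  ⟨_, (RelFreeOver.lim f).incl, (RelFreeOver.lim f).φ,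
    (RelFreeOver.limExhaustion f).isRelativeSullivan hB,
    (RelFreeOver.limExhaustion f).isQuasiIso hB hM hf, RelFreeOver.φ_comp_incl _⟩

end RHT

namespace RHT

open CDGA

namespace S2S3

/-! ### The algebra `A ⊗ A` for `A = H^*(S² × S³)` -/

/-- The algebra `A ⊗ A`. -/
abbrev AA : Type := TensorCarrier A A

/-- The element `a ⊗ b`. -/
noncomputable abbrev t (a b : S2S3) : AA := tm (A := A) (A' := A) a b

/-- The element `a_i ⊗ a_j` of the basis. -/
noncomputable abbrev e (i j : Fin 4) : AA := t (basis i) (basis j)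

/-- The `i`-th coordinate. -/
def coord (i : Fin 4) : S2S3 →ₗ[ℚ] ℚ where
  toFun a := a i
  map_add' _ _ := rfl
  map_smul' _ _ := rfl

/-- The coefficient of `a_i ⊗ a_j`. -/
noncomputable def coef (i j : Fin 4) : AA →ₗ[ℚ] ℚ :=
  TensorProduct.lift ((LinearMap.mul ℚ ℚ).compl₁₂ (coord i) (coord j)) ∘ₗ
    (GradedTensorProduct.of ℚ A.gr A.gr).symm.toLinearMap

theorem coef_t (i j : Fin 4) (a b : S2S3) : coef i j (t a b) = a i * b j := rfl

theorem eq_sum_basis (a : S2S3) : a = ∑ i, a i • basis i := by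
  ext <;> simp [Fin.sum_univ_four, basis_apply]

theorem eq_sum_coef (z : AA) : z = ∑ i, ∑ j, coef i j z • e i j := by
  refine tensor_induction (A := A) (A' := A) (P := fun z => z = ∑ i, ∑ j, coef i j z • e i j)
    ?_ ?_ ?_ z
  · simp
  · intro _ _ a _ b _
    change t a b = ∑ i, ∑ j, coef i j (t a b) • e i j
    simp only [coef_t]
    have h : t a b = t (∑ i, a i • basis i) (∑ j, b j • basis j) := by
      rw [← eq_sum_basis, ← eq_sum_basis]
    conv_lhs => rw [h]
    refine (DualBasis.tm_sum_left (A := A) _ _ _).trans (Finset.sum_congr rfl fun i _ => ?_)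
    refine (DualBasis.tm_sum_right (A := A) _ _ _).trans (Finset.sum_congr rfl fun j _ => ?_)
    refine (tm_smul_right (A := A) (A' := A) _ _ _).trans ?_
    rw [mul_comm, ← smul_smul]
    rfl
  · intro x y h1 h2
    simp only [map_add, add_smul, Finset.sum_add_distrib]
    rw [← h1, ← h2]

theorem coef_of_mem {k : ℕ} {z : AA} (hz : z ∈ tensorGr A A k) {i j : Fin 4}
    (h : deg i + deg j ≠ k) : coef i j z = 0 := by
  refine tensorGr_induction (A := A) (A' := A) (P := fun z => coef i j z = 0) (map_zero _) ?_ ?_ hz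
  · intro p q hpq a ha b hb
    change coef i j (t a b) = 0
    rw [coef_t]
    by_cases hi : deg i = p
    · rw [mem_gr.1 hb j (by omega), mul_zero]
    · rw [mem_gr.1 ha i hi, zero_mul]
  · intro x y h1 h2
    rw [map_add, h1, h2, add_zero]

theorem tensorD_eq_zero (z : AA) : tensorD A A z = 0 := by
  refine tensor_induction (A := A) (A' := A) (P := fun z => tensorD A A z = 0) (map_zero _) ?_ ?_ z
  · intro i j a ha b _
    rw [tensorD_tm ha]
    change tm (0 : A) b + (-1 : ℚ) ^ i • tm a (0 : A) = 0
    rw [tm_zero_left, tm_zero_right, smul_zero, add_zero]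
  · intro x y h1 h2
    rw [map_add, h1, h2, add_zero]

/-- The diagonal class. -/
noncomputable abbrev Δ : AA := D.diag

theorem t_mul_t (a b a' b' : S2S3) {j i : ℕ} (hb : b ∈ gr j) (ha' : a' ∈ gr i) :
    t a b * t a' b' = (-1 : ℚ) ^ (j * i) • t (a * a') (b * b') :=
  tm_mul_tm (A := A) (A' := A) a hb ha' b'

theorem one_eq : basis 0 = 1 := by
  ext <;> simp [basis_apply]

theorem t_mul_one_t (a b c : S2S3) : t a b * t 1 c = t a (b * c) := by
  refine hom_induction (A := A) (P := fun b => t a b * t 1 c = t a (b * c)) ?_ ?_ ?_ b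
  · change t a 0 * _ = t a (0 * c)
    rw [zero_mul]
    change tm (A := A) (A' := A) a 0 * _ = tm (A := A) (A' := A) a 0
    rw [tm_zero_right, zero_mul]
  · intro j b hb
    rw [t_mul_t a b 1 c hb (SetLike.one_mem_graded gr), mul_zero, pow_zero, one_smul, mul_one]
  · intro x y h1 h2
    have h3 : t a (x + y) = t a x + t a y := tm_add_right (A := A) (A' := A) a x y
    have h4 : t a ((x + y) * c) = t a (x * c) + t a (y * c) := by
      rw [add_mul]
      exact tm_add_right (A := A) (A' := A) a _ _
    exact (congrArg (· * t 1 c) h3).trans ((add_mul _ _ _).trans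
      ((congrArg₂ _ h1 h2).trans h4.symm))

theorem diag_mul_one_t (a : S2S3) : Δ * t 1 a = t (basis 0) (basis 3 * a) +
    t (basis 1) (basis 2 * a) - t (basis 2) (basis 1 * a) - t (basis 3) (basis 0 * a) := by
  rw [Δ, diag_eq, sub_mul, sub_mul, add_mul, t_mul_one_t, t_mul_one_t, t_mul_one_t, t_mul_one_t]

theorem coef_diag_mul (i j : Fin 4) (a : S2S3) : coef i j (Δ * t 1 a) =
    basis 0 i * (basis 3 * a) j + basis 1 i * (basis 2 * a) j - basis 2 i * (basis 1 * a) j -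
      basis 3 i * (basis 0 * a) j := by
  rw [diag_mul_one_t, map_sub, map_sub, map_add, coef_t, coef_t, coef_t, coef_t]

/-- The coordinates of `a` on `1`, `x`, `y` reappear in `Δ(1 ⊗ a)` as coefficients of degrees 5, 7
and 8, which survive the truncation at degree 9. The coordinate on `xy` only contributes to `xy ⊗
xy`, of degree 10. -/
theorem coef_diag_mul_zero_three (a : S2S3) : coef 0 3 (Δ * t 1 a) = a 0 := by
  simp [coef_diag_mul, basis_apply]

theorem coef_diag_mul_one_three (a : S2S3) : coef 1 3 (Δ * t 1 a) = a 1 := by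
  simp [coef_diag_mul, basis_apply]

theorem coef_diag_mul_two_three (a : S2S3) : coef 2 3 (Δ * t 1 a) = -a 2 := by
  simp [coef_diag_mul, basis_apply]

theorem coef_diag_mul_three_two (a : S2S3) : coef 3 2 (Δ * t 1 a) = -a 2 := by
  simp [coef_diag_mul, basis_apply]

/-- This vector spans the ideal `(Δ)` in degree 8. -/
theorem diag_mul_y : Δ * t 1 (basis 2) = -(e 2 3 + e 3 2) := by
  have h3 : basis 3 * basis 2 = 0 := by ext <;> simp [basis_apply]
  have h2 : basis 2 * basis 2 = 0 := by ext <;> simp [basis_apply]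
  have h1 : basis 1 * basis 2 = basis 3 := by ext <;> simp [basis_apply]
  have h : ∀ a, t a 0 = 0 := fun a => tm_zero_right (A := A) (A' := A) a
  rw [diag_mul_one_t, h3, h2, h1, one_eq, one_mul, h, h]
  abel

theorem e_mem (i j : Fin 4) : e i j ∈ tensorGr A A (deg i + deg j) :=
  tm_mem (A := A) (A' := A) rfl (basis_mem i) (basis_mem j)

/-! ### The quotient of the cone -/

/-- The suspension `s s⁻⁵` raises degrees by 4, so truncation at degree 9 removes `A` from degree 5
on: among `s s⁻⁵ 1`, `s s⁻⁵ x`, `s s⁻⁵ y`, `s s⁻⁵ xy` only the last disappears. -/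
theorem mem_top_iff (c : Cone A) : c ∈ Cone.top A 5 ↔
    (∀ i j, deg i + deg j ≤ 8 → coef i j c.1 = 0) ∧ ∀ i, deg i ≤ 4 → coord i c.2 = 0 := by
  constructor
  · let S : Submodule ℚ (Cone A) :=
      { carrier := {c | (∀ i j, deg i + deg j ≤ 8 → coef i j c.1 = 0) ∧
          ∀ i, deg i ≤ 4 → coord i c.2 = 0}
        add_mem' := by
          rintro a b ⟨h1, h2⟩ ⟨h3, h4⟩
          refine ⟨fun i j h => ?_, fun i h => ?_⟩
          · rw [Prod.fst_add, map_add, h1 i j h, h3 i j h, add_zero]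
          · rw [Prod.snd_add, map_add, h2 i h, h4 i h, add_zero]
        zero_mem' := ⟨fun i j _ => map_zero _, fun i _ => map_zero _⟩
        smul_mem' := by
          rintro q a ⟨h1, h2⟩
          refine ⟨fun i j h => ?_, fun i h => ?_⟩
          · rw [Prod.smul_fst, map_smul, h1 i j h, smul_zero]
          · rw [Prod.smul_snd, map_smul, h2 i h, smul_zero] }
    have h : Cone.top A 5 ≤ S := by
      refine Cone.top_le fun k hk c hc => ?_
      obtain ⟨z, x⟩ := c
      obtain ⟨hz, hx⟩ := hc
      refine ⟨fun i j h => coef_of_mem hz (by omega), fun i h => ?_⟩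
      rcases Cone.ss_cases hx with h0 | ⟨l, hl, hx⟩
      · exact (congrArg (coord i) h0).trans (map_zero _)
      · exact mem_gr.1 hx i (by omega)
    exact fun hc => h hc
  · rintro ⟨h1, h2⟩
    obtain ⟨z, x⟩ := c
    have hz : ((z, 0) : Cone A) ∈ Cone.top A 5 := by
      have : z ∈ (Cone.top A 5).comap (LinearMap.inl ℚ (TensorCarrier A A) A) := by
        rw [eq_sum_coef z]
        refine Submodule.sum_mem _ fun i _ => Submodule.sum_mem _ fun j _ => ?_
        by_cases h : deg i + deg j ≤ 8
        · rw [h1 i j h, zero_smul]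
          exact Submodule.zero_mem _
        · exact Submodule.smul_mem _ _ (Cone.inl_top (by omega) (e_mem i j))
      exact this
    have hx : ((0, x) : Cone A) ∈ Cone.top A 5 := by
      have : x ∈ (Cone.top A 5).comap (LinearMap.inr ℚ (TensorCarrier A A) A) := by
        rw [eq_sum_basis x]
        refine Submodule.sum_mem _ fun i _ => ?_
        by_cases h : deg i ≤ 4
        · have h0 : x i = 0 := h2 i h
          rw [h0, zero_smul]
          exact Submodule.zero_mem _
        · exact Submodule.smul_mem _ _ (Cone.gr_le_top (k := deg i + 4) (by omega)
            (Cone.inr_mem rfl (basis_mem i)))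
      exact this
    simpa using Submodule.add_mem _ hz hx

theorem δ_eq (c : Cone A) : Cone.δ D c = (Δ * t 1 c.2, 0) := by
  rw [Cone.δ_apply, tensorD_eq_zero, zero_add]
  rfl

section

variable (ξ : (tensor A A).gr 8)

/-- The projection from the cone to `C(ξ)`. -/
noncomputable abbrev q : Cone A →ₗ[ℚ] C ξ := (twist ξ).toC

theorem q_surjective : Function.Surjective (q ξ) := (twist ξ).toC_surjective

theorem q_eq_zero {c : Cone A} : q ξ c = 0 ↔ c ∈ Cone.top A 5 := (twist ξ).toC_eq_zero

theorem q_eq {c c' : Cone A} : q ξ c = q ξ c' ↔ c - c' ∈ Cone.top A 5 := (twist ξ).toC_eq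

theorem d_q (c : Cone A) : (C ξ).d (q ξ c) = q ξ (Δ * t 1 c.2, 0) :=
  congrArg (q ξ) (δ_eq c)

theorem q_mul (c c' : Cone A) : q ξ c * q ξ c' = q ξ (Cone.mul ξ.1 c c') := rfl

theorem incl_apply (z : AA) : incl ξ z = q ξ (z, 0) := rfl

theorem mem_gr_C {k : ℕ} {p : C ξ} : p ∈ (C ξ).gr k ↔ ∃ c ∈ Cone.gr A 5 k, q ξ c = p := Iff.rfl

theorem proj_q (k : ℕ) (c : Cone A) : (C ξ).proj k (q ξ c) = q ξ (Cone.pr A 5 k c) := by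
  refine Cone.cone_induction 5
    (Q := fun c => (C ξ).proj k (q ξ c) = q ξ (Cone.pr A 5 k c)) ?_ ?_ ?_ c
  · simp only [map_zero]
  · intro l c hc
    have hc' : q ξ c ∈ (C ξ).gr l := ⟨c, hc, rfl⟩
    by_cases h : l = k
    · subst h
      rw [proj_same hc', Cone.pr_same hc]
    · rw [proj_ne hc' h, Cone.pr_ne h hc, map_zero]
  · intro x y h1 h2
    simp only [map_add, h1, h2]

/-- If `(z, a)` represents a cocycle of `C(ξ)`, then `a` has no components in degrees `≤ 3`. -/
theorem snd_eq_zero_of_closed {c : Cone A} (h : (C ξ).d (q ξ c) = 0) :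
    coord 0 c.2 = 0 ∧ coord 1 c.2 = 0 ∧ coord 2 c.2 = 0 := by
  rw [d_q, q_eq_zero, mem_top_iff] at h
  refine ⟨?_, ?_, ?_⟩
  · have := h.1 0 3 (by decide)
    rwa [coef_diag_mul_zero_three] at this
  · have := h.1 1 3 (by decide)
    rwa [coef_diag_mul_one_three] at this
  · have := h.1 2 3 (by decide)
    rw [coef_diag_mul_two_three] at this
    exact neg_eq_zero.1 this

/-- The `A`-component of a cocycle can only be a multiple of `xy`, which is truncated. Every cocycle
of `C(ξ)` therefore comes from `A ⊗ A`. -/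
theorem surjective_cohomologyMap_incl (k : ℕ) :
    Function.Surjective ((incl ξ).cohomologyMap k) := by
  rw [CDGAHom.surjective_iff]
  intro b hb hdb
  obtain ⟨⟨z, a⟩, hc, rfl⟩ := (mem_gr_C ξ).1 hb
  obtain ⟨h0, h1, h2⟩ := snd_eq_zero_of_closed ξ hdb
  refine ⟨z, hc.1, tensorD_eq_zero z, 0, ?_⟩
  rw [map_zero, incl_apply, ← map_sub, eq_comm, q_eq_zero, mem_top_iff]
  refine ⟨fun i j _ => ?_, fun i hi => ?_⟩
  · simp
  · fin_cases i
    · simpa using h0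
    · simpa using h1
    · simpa using h2
    · exact absurd hi (by decide)

end

end S2S3

end RHT

namespace RHT

open CDGA

namespace S2S3

/-! ### Relations in `A ⊗ A` behind the secondary operation -/

theorem e_mul_e (i j k l : Fin 4) :
    e i j * e k l = (-1 : ℚ) ^ (deg j * deg k) • t (basis i * basis k) (basis j * basis l) :=
  t_mul_t _ _ _ _ (basis_mem j) (basis_mem k)

theorem coef_ext {z z' : AA} (h : ∀ i j, coef i j z = coef i j z') : z = z' := by
  rw [eq_sum_coef z, eq_sum_coef z']
  simp only [h]

theorem coef_e (i j k l : Fin 4) :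
    coef k l (e i j) = (if k = i then 1 else 0) * (if l = j then 1 else 0) := by
  rw [coef_t, basis_apply, basis_apply]

theorem basis_three_eq : basis 1 * basis 2 = basis 3 := by
  ext <;> simp [basis_apply]

theorem t_zero_left (a : S2S3) : t 0 a = 0 := tm_zero_left (A := A) (A' := A) a

theorem t_zero_right (a : S2S3) : t a 0 = 0 := tm_zero_right (A := A) (A' := A) a

theorem basis_mul_zero (i : Fin 4) : basis i * basis 0 = basis i := by rw [one_eq, mul_one]

theorem zero_mul_basis (i : Fin 4) : basis 0 * basis i = basis i := by rw [one_eq, one_mul]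

theorem basis_one_sq : basis 1 * basis 1 = 0 := by
  ext <;> simp [basis_apply]

theorem basis_two_mul_one : basis 2 * basis 1 = basis 3 := by
  ext <;> simp [basis_apply]

theorem basis_three_mul_one : basis 3 * basis 1 = 0 := by
  ext <;> simp [basis_apply]

/-- The element `x ⊗ 1 + 1 ⊗ x`. -/
noncomputable def X : AA := e 1 0 + e 0 1

/-- The element `y ⊗ 1 - 1 ⊗ y`. -/
noncomputable def Y : AA := e 2 0 - e 0 2

theorem X_mem : X ∈ tensorGr A A 2 := Submodule.add_mem _ (e_mem 1 0) (e_mem 0 1)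

theorem Y_mem : Y ∈ tensorGr A A 3 := Submodule.sub_mem _ (e_mem 2 0) (e_mem 0 2)

theorem deg_two : deg 2 = 3 := rfl
theorem deg_one : deg 1 = 2 := rfl
theorem deg_zero : deg 0 = 0 := rfl

/-- With `dw = Δ` and `ds = wY`, this relation turns `d(sX)` into `-wΔ`, which cancels half of
`d(w²) = 2wΔ`. -/
theorem Y_mul_X : Y * X = -Δ := by
  rw [Y, X, Δ, diag_eq, sub_mul, mul_add, mul_add]
  simp only [e_mul_e, basis_mul_zero, zero_mul_basis, basis_two_mul_one, deg_zero, deg_one, deg_two]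
  norm_num
  abel

/-- `Δ(a ⊗ 1) = Δ(1 ⊗ a)`, and `Y` is the difference of the two copies of `y`. Hence `wY` is closed
when `dw = Δ`. -/
theorem diag_mul_Y : Δ * Y = 0 := by
  have h : Δ * t (basis 2) 1 = Δ * t 1 (basis 2) := D.diag_mul_left (basis_mem 2)
  rw [Y, mul_sub, e, e, one_eq, h, sub_self]

/-- `y ⊗ y` spans `(A ⊗ A)⁶`; this and `e_one_one_mul_Y`, for `x ⊗ x` in degree 4, control the
indeterminacy of `s` and `w`. -/
theorem e_two_two_mul_X : e 2 2 * X = -(Δ * t 1 (basis 2)) := by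
  rw [X, diag_mul_y, mul_add]
  simp only [e_mul_e, basis_mul_zero, basis_two_mul_one, deg_one, deg_two, deg_zero]
  norm_num
  abel

theorem e_one_one_mul_Y : e 1 1 * Y = -(Δ * t 1 (basis 1)) := by
  rw [Y, diag_mul_one_t, mul_sub]
  simp only [e_mul_e, basis_mul_zero, zero_mul_basis, basis_two_mul_one, basis_three_eq, deg_one,
    deg_two, deg_zero, basis_one_sq, basis_three_mul_one, t_zero_right]
  norm_num

theorem e_one_one_sq : e 1 1 * e 1 1 = 0 := by
  rw [e_mul_e, basis_one_sq, t_zero_left, smul_zero]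

theorem mulHom_e (i j : Fin 4) : A.mulHom (e i j) = basis i * basis j := A.mulHom_tm _ _

theorem mulHom_Y : A.mulHom Y = 0 := by
  rw [Y, map_sub, mulHom_e, mulHom_e, basis_mul_zero, zero_mul_basis, sub_self]

theorem basis_one_mul_mulHom_X : basis 1 * A.mulHom X = 0 := by
  rw [X, map_add, mulHom_e, mulHom_e, basis_mul_zero, zero_mul_basis]
  exact (mul_add _ _ _).trans (by rw [basis_one_sq, add_zero])

theorem eq_smul_of_mem_gr {k : ℕ} {a : S2S3} (ha : a ∈ gr k) {i : Fin 4}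
    (h : ∀ j, deg j = k → j = i) : a = a i • basis i := by
  conv_lhs => rw [eq_sum_basis a]
  refine Finset.sum_eq_single i (fun j _ hj => ?_) (fun h => absurd (Finset.mem_univ i) h)
  rw [ha j (fun h' => hj (h j h')), zero_smul]

theorem eq_smul_of_mem_tensorGr {k : ℕ} {z : AA} (hz : z ∈ tensorGr A A k) {i : Fin 4}
    (h : ∀ j l, deg j + deg l = k → j = i ∧ l = i) : z = coef i i z • e i i := by
  conv_lhs => rw [eq_sum_coef z]
  rw [Finset.sum_eq_single i, Finset.sum_eq_single i]
  · intro l _ hl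
    rw [coef_of_mem hz (fun h' => hl (h _ _ h').2), zero_smul]
  · exact fun h => absurd (Finset.mem_univ i) h
  · intro j _ hj
    refine Finset.sum_eq_zero fun l _ => ?_
    rw [coef_of_mem hz (fun h' => hj (h _ _ h').1), zero_smul]
  · exact fun h => absurd (Finset.mem_univ i) h

theorem diag_mul_one : Δ * t 1 1 = Δ := by
  have : t 1 1 = 1 := rfl
  rw [this, mul_one]

theorem q_mul_incl (ξ : (tensor A A).gr 8) (z y : AA) (a : S2S3) :
    q ξ (z, a) * q ξ (y, 0) = q ξ (z * y, a * A.mulHom y) := by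
  rw [q_mul]
  congr 1
  refine Prod.ext ?_ ?_
  · simp [Cone.mul_apply, tm_zero_left]
  · simp [Cone.mul_apply]

theorem q_mul_self (ξ : (tensor A A).gr 8) (z : AA) :
    q ξ (z, 1) * q ξ (z, 1) = q ξ (z * z + ξ.1, A.mulHom z + A.mulHom z) := by
  have e1 : A.proj 0 (1 : S2S3) = 1 := proj_same (A := A) (SetLike.one_mem_graded gr)
  have e2 : (tm 1 1 : TensorCarrier A A) = 1 := rfl
  rw [q_mul]
  congr 1
  refine Prod.ext ?_ ?_
  · simp only [Cone.mul_apply, e1, mul_one, e2]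
  · simp only [Cone.mul_apply, mul_one, one_mul]

/-! ### The invariant of `C(ξ)` under `A ⊗ A` -/

/-- `H⁸(A ⊗ A) / ([Δ]) ≅ ℚ`, with `y ⊗ xy ↦ 1` and `xy ⊗ y ↦ -1`. -/
noncomputable def τ : AA →ₗ[ℚ] ℚ := coef 2 3 - coef 3 2

/-- Coboundaries have the form `Δ(1 ⊗ a)` modulo degree 9, and there the coefficients of `y ⊗ xy`
and `xy ⊗ y` are both `-a 2`. -/
theorem τ_eq_zero_of_exact (ξ : (tensor A A).gr 8) {z : AA}
    (h : incl ξ z ∈ LinearMap.range (C ξ).d) : τ z = 0 := by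
  obtain ⟨c, hc⟩ := h
  obtain ⟨c, rfl⟩ := q_surjective ξ c
  rw [d_q, incl_apply, q_eq, mem_top_iff] at hc
  have h1 := hc.1 2 3 (by decide)
  have h2 := hc.1 3 2 (by decide)
  simp only [Prod.mk_sub_mk, map_sub, coef_diag_mul_two_three, coef_diag_mul_three_two] at h1 h2
  change coef 2 3 z - coef 3 2 z = 0
  linarith

section

variable {ξ : (tensor A A).gr 8} {E : CDGA} {i : CDGAHom (tensor A A) E} {φ : CDGAHom E (C ξ)}

/-- `C(ξ)⁴` is spanned by `x ⊗ x` and `s s⁻⁵ 1`. As `d(s s⁻⁵ 1) = Δ ≠ 0`, the condition on `dw`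
fixes the second coefficient to be 1 and leaves the first free. -/
theorem exists_form_of_deg_four (h : φ.comp i = incl ξ) {w : E} (hw : w ∈ E.gr 4)
    (hdw : E.d w = i Δ) : ∃ c : ℚ, φ w = q ξ (c • e 1 1, 1) := by
  obtain ⟨⟨z, a⟩, ⟨hz, ha⟩, hwc⟩ := (mem_gr_C ξ).1 (φ.map_gr hw)
  have hi : φ (i Δ) = incl ξ Δ := congrArg (fun f => f Δ) h
  have hd : (C ξ).d (q ξ (z, a)) = incl ξ Δ := by
    rw [hwc, ← φ.map_d, hdw, hi]
  rw [d_q, incl_apply, q_eq, mem_top_iff] at hd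
  have h03 := hd.1 0 3 (by decide)
  have hΔ : coef 0 3 Δ = 1 := by
    rw [← diag_mul_one, coef_diag_mul_zero_three]
    rfl
  simp only [Prod.mk_sub_mk, map_sub, coef_diag_mul_zero_three, hΔ] at h03
  have ha' : a = 1 := by
    have h0 : a ∈ gr 0 := ha
    have := eq_smul_of_mem_gr (i := 0) h0 (by decide)
    rw [this, sub_eq_zero.1 h03, one_smul, one_eq]
  refine ⟨coef 1 1 z, ?_⟩
  rw [← eq_smul_of_mem_tensorGr (i := 1) hz (by decide), ← hwc, ha']

theorem exists_primitives (hφ : φ.IsQuasiIso) (h : φ.comp i = incl ξ) :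
    ∃ w ∈ E.gr 4, E.d w = i Δ ∧ ∃ s ∈ E.gr 6, E.d s = w * i Y := by
  have hi : ∀ z, φ (i z) = incl ξ z := fun z => congrArg (fun f => f z) h
  have hdi : ∀ z, E.d (i z) = 0 := fun z => by
    rw [← i.map_d]
    exact (congrArg i.toAlgHom (tensorD_eq_zero z)).trans (map_zero _)
  have hΔ : i Δ ∈ E.gr (4 + 1) := i.map_gr D.diag_mem
  -- In `C(ξ)` the class `Δ` is bounded by `s s⁻⁵ 1`, so it is already exact in `E`.
  obtain ⟨w, hw, hdw⟩ := exists_primitive hΔ ((CDGAHom.injective_iff φ 5).1 (hφ 5).1 _ hΔ (hdi _)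
    ⟨q ξ (0, 1), by rw [hi, d_q, incl_apply, diag_mul_one]⟩)
  refine ⟨w, hw, hdw, ?_⟩
  obtain ⟨c, hc⟩ := exists_form_of_deg_four h hw hdw
  have hwY : w * i Y ∈ E.gr (6 + 1) := 
    SetLike.mul_mem_graded (i := 4) (j := 3) hw (i.map_gr Y_mem)
  -- `s s⁻⁵ 1 · Y = 0` because `μ(Y) = 0`, so `φ(wY) = c (x ⊗ x) Y = -c Δ(1 ⊗ x)`, which is bounded
  -- by `-c s s⁻⁵ x`.
  refine exists_primitive hwY ((CDGAHom.injective_iff φ 7).1 (hφ 7).1 _ hwY ?_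
    ⟨q ξ (0, -c • basis 1), ?_⟩)
  · rw [E.leibniz hw, hdi, mul_zero, smul_zero, add_zero, hdw]
    exact (map_mul i.toAlgHom Δ Y).symm.trans
      ((congrArg i.toAlgHom diag_mul_Y).trans (map_zero _))
  · rw [map_mul, hi, hc, d_q, incl_apply, q_mul_incl]
    have e1 : t 1 (-c • basis 1) = -c • t 1 (basis 1) := tm_smul_right (A := A) (A' := A) _ _ _
    have e2 : (c • e 1 1 : AA) * Y = Δ * (-c • t 1 (basis 1)) := by
      rw [smul_mul_assoc, e_one_one_mul_Y, mul_smul_comm, neg_smul, smul_neg]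
    rw [e1, e2, mulHom_Y, mul_zero]

/-- The choices have no effect on the class. The free multiple of `x ⊗ x` in `φ(w)` drops out of the
square, since `(x ⊗ x)² = 0` and `μ(x ⊗ x) = 0`. The element `φ(s)` is a combination of `y ⊗ y` and
`s s⁻⁵ x`; multiplication by `X` makes the first exact and kills the second, because `x μ(X) = 0`.
-/
theorem map_square_sub_mem (h : φ.comp i = incl ξ) {w s : E} (hw : w ∈ E.gr 4)
    (hdw : E.d w = i Δ) (hs : s ∈ E.gr 6) :
    φ (w * w + (2 : ℚ) • (s * i X)) - incl ξ ξ.1 ∈ LinearMap.range (C ξ).d := by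
  have hi : ∀ z, φ (i z) = incl ξ z := fun z => congrArg (fun f => f z) h
  obtain ⟨c, hc⟩ := exists_form_of_deg_four h hw hdw
  obtain ⟨⟨z, a⟩, ⟨hz, ha⟩, hsc⟩ := (mem_gr_C ξ).1 (φ.map_gr hs)
  have hz' : z = coef 2 2 z • e 2 2 := eq_smul_of_mem_tensorGr (i := 2) hz (by decide)
  have ha' : a = (a : S2S3) 1 • basis 1 := eq_smul_of_mem_gr (i := 1) (k := 2) ha (by decide)
  have h1 : φ (w * w) = incl ξ ξ.1 := by
    have e1 : A.mulHom (c • e 1 1) = 0 := by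
      rw [map_smul, mulHom_e, basis_one_sq, smul_zero]
    rw [map_mul, hc, q_mul_self, incl_apply, smul_mul_smul_comm, e_one_one_sq, smul_zero, zero_add,
      e1, add_zero]
  have h2 : φ (s * i X) = (C ξ).d (q ξ (0, -coef 2 2 z • basis 2)) := by
    have e1 : t 1 (-coef 2 2 z • basis 2) = -coef 2 2 z • t 1 (basis 2) :=
      tm_smul_right (A := A) (A' := A) _ _ _
    have e2 : a * A.mulHom X = 0 := by
      rw [ha']
      exact (smul_mul_assoc _ _ _).trans (by rw [basis_one_mul_mulHom_X, smul_zero])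
    have e3 : z * X = Δ * (-coef 2 2 z • t 1 (basis 2)) := by
      conv_lhs => rw [hz']
      rw [smul_mul_assoc, e_two_two_mul_X, mul_smul_comm, neg_smul, smul_neg]
    rw [map_mul, hi, ← hsc, d_q, incl_apply, q_mul_incl, e1, e2, e3]
  refine ⟨(2 : ℚ) • q ξ (0, -coef 2 2 z • basis 2), ?_⟩
  rw [map_add, map_smul, map_smul, h1, h2, add_sub_cancel_left]

theorem square_closed {w s : E} (hw : w ∈ E.gr 4) (hdw : E.d w = i Δ) (hs : s ∈ E.gr 6)
    (hds : E.d s = w * i Y) : E.d (w * w + (2 : ℚ) • (s * i X)) = 0 := by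
  have hdi : ∀ z, E.d (i z) = 0 := fun z => by
    rw [← i.map_d]
    exact (congrArg i.toAlgHom (tensorD_eq_zero z)).trans (map_zero _)
  have h1 : i Δ * w = w * i Δ := by
    rw [E.graded_comm (i.map_gr D.diag_mem) hw]
    norm_num
  have h2 : i Y * i X = -i Δ :=
    (map_mul i.toAlgHom Y X).symm.trans ((congrArg i.toAlgHom Y_mul_X).trans (map_neg _ _))
  rw [map_add, map_smul, E.leibniz hw, E.leibniz hs, hdi, hdw, hds, h1, mul_assoc, h2]
  norm_num
  rw [two_smul, add_neg_cancel]

theorem square_mem {w s : E} (hw : w ∈ E.gr 4) (hs : s ∈ E.gr 6) :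
    w * w + (2 : ℚ) • (s * i X) ∈ E.gr 8 :=
  Submodule.add_mem _ (SetLike.mul_mem_graded (i := 4) (j := 4) hw hw) (Submodule.smul_mem _ _
    (SetLike.mul_mem_graded (i := 6) (j := 2) hs (i.map_gr X_mem)))

end

/-- The cocycle `w² + 2sX` of `E` is cohomologous to `i(ξ)`, by injectivity of `φ` on `H⁸`. Its
image under `φ'` is cohomologous to `ξ'` as well as to `ξ`. -/
theorem τ_eq_of_weaklyEquivalent {ξ ξ' : (tensor A A).gr 8}
    (h : WeaklyEquivalentUnder (incl ξ) (incl ξ')) : τ ξ.1 = τ ξ'.1 := by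
  obtain ⟨E, i, -, φ, φ', hφ, hφ', h, h'⟩ := h
  obtain ⟨w, hw, hdw, s, hs, hds⟩ := exists_primitives hφ h
  have hi : φ (i ξ.1) = incl ξ ξ.1 := congrArg (fun f => f ξ.1) h
  have hi' : φ' (i ξ.1) = incl ξ' ξ.1 := congrArg (fun f => f ξ.1) h'
  have hdi : E.d (i ξ.1) = 0 := by
    rw [← i.map_d]
    exact (congrArg i.toAlgHom (tensorD_eq_zero _)).trans (map_zero _)
  have h1 := map_square_sub_mem h hw hdw hs
  -- `w` and `s` were found through `φ`, but the computation applies to any `w`, `s` of these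
  -- degrees with `dw = i(Δ)`, hence also to `φ'`.
  have h2 := map_square_sub_mem h' hw hdw hs
  obtain ⟨b, hb⟩ := (CDGAHom.injective_iff φ 8).1 (hφ 8).1
    (w * w + (2 : ℚ) • (s * i X) - i ξ.1)
    (Submodule.sub_mem _ (square_mem hw hs) (i.map_gr ξ.2))
    (by rw [map_sub, square_closed hw hdw hs hds, hdi, sub_zero]) (by rwa [map_sub, hi])
  have h3 : φ' (w * w + (2 : ℚ) • (s * i X)) - incl ξ' ξ.1 ∈ LinearMap.range (C ξ').d := by
    refine ⟨φ' b, ?_⟩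
    rw [← φ'.map_d, hb, map_sub, hi']
  have h4 := Submodule.sub_mem _ h3 h2
  rw [sub_sub_sub_cancel_left, ← map_sub] at h4
  have h5 := τ_eq_zero_of_exact ξ' h4
  rw [map_sub] at h5
  exact (sub_eq_zero.1 h5).symm

theorem A_cls_eq_iff {k : ℕ} (a b : A.cocycles k) : A.cls a = A.cls b ↔ a = b := by
  constructor
  · intro h
    have h1 := (CDGAHom.cls_eq_zero (a - b)).1 (sub_eq_zero.2 h)
    obtain ⟨c, hc⟩ := h1
    exact sub_eq_zero.1 (Subtype.ext hc.symm)
  · rintro rfl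
    rfl

/-- For `a = α y` and `ω` with `xy`-coordinate 1, the element `a ⊗ ω` has coefficient `α` at `y ⊗
xy` and 0 at `xy ⊗ y`. Multiples of `Δ` contribute equally to both coefficients and cancel in `τ`.
-/
theorem τ_of_represents {x : A.H 3} {ξ : AA} (h : Represents D x ξ) :
    ∃ a : A.cocycles 3, A.cls a = x ∧ coord 2 a.1 = τ ξ := by
  obtain ⟨a, ha, ω, hω, hε, c, -, hξ⟩ := h
  refine ⟨a, ha, ?_⟩
  obtain ⟨b, hb⟩ := hξ.2
  have h1 : ξ = t a.1 ω + Δ * c := sub_eq_zero.1 (hb.symm.trans (tensorD_eq_zero b))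
  have h2 : (a.1 : S2S3) 3 = 0 := mem_gr.1 a.2.1 3 (by decide)
  have h3 : (ω : S2S3) 3 = 1 := hε
  have h4 : Δ * c = Δ * t 1 (A.mulHom c) := D.diag_mul c
  rw [h1, h4]
  change _ = coef 2 3 _ - coef 3 2 _
  rw [map_add, map_add, coef_t, coef_t, coef_diag_mul_two_three, coef_diag_mul_three_two, h2, h3]
  change (a.1 : S2S3) 2 = _
  ring

theorem eq_iff_τ_eq {x x' : A.H 3} {ξ ξ' : AA} (h : Represents D x ξ) (h' : Represents D x' ξ') :
    x = x' ↔ τ ξ = τ ξ' := by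
  obtain ⟨a, rfl, ha⟩ := τ_of_represents h
  obtain ⟨a', rfl, ha'⟩ := τ_of_represents h'
  rw [A_cls_eq_iff, ← ha, ← ha']
  constructor
  · rintro rfl
    rfl
  · intro h
    apply Subtype.ext
    have e1 := eq_smul_of_mem_gr (i := 2) (k := 3) a.2.1 (by decide)
    have e2 := eq_smul_of_mem_gr (i := 2) (k := 3) a'.2.1 (by decide)
    have e3 : (a.1 : S2S3) 2 = (a'.1 : S2S3) 2 := h
    rw [e1, e2, e3]

end S2S3

end RHT

namespace RHT

open CDGA

/-! ### Homogeneous differential subalgebras of a product -/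

namespace CDGA

/-- Allowing every larger finite set lets the two components of a pair share one index set. -/
theorem eq_sum_proj (A : CDGA) (a : A) :
    ∃ s : Finset ℕ, ∀ s', s ⊆ s' → a = ∑ k ∈ s', A.proj k a := by
  classical
  refine ⟨(DirectSum.decompose A.gr a).support, fun s' hs => ?_⟩
  conv_lhs => rw [← DirectSum.sum_support_decompose A.gr a]
  refine Finset.sum_subset_zero_on_sdiff hs (fun k hk => ?_) (fun k _ => ?_)
  · have := (Finset.mem_sdiff.1 hk).2
    rw [DFinsupp.notMem_support_iff] at this
    simp [proj, GradedAlgebra.proj_apply, this]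
  · simp [proj, GradedAlgebra.proj_apply]

section subProd

variable {C C' : CDGA} (R : Subalgebra ℚ (C × C'))

/-- The degree `k` part of a subalgebra of a product. -/
def subProdGr (k : ℕ) : Submodule ℚ R := ((C.gr k).prod (C'.gr k)).comap R.val.toLinearMap

instance : SetLike.GradedMonoid (subProdGr R) where
  one_mem := ⟨SetLike.one_mem_graded C.gr, SetLike.one_mem_graded C'.gr⟩
  mul_mem _ _ _ _ hx hy := ⟨SetLike.mul_mem_graded hx.1 hy.1, SetLike.mul_mem_graded hx.2 hy.2⟩

/-- A subalgebra stable under the projections to the homogeneous components is graded by what it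
contains of each degree. -/
theorem isInternal_subProdGr (hp : ∀ k, ∀ x ∈ R, (C.proj k x.1, C'.proj k x.2) ∈ R) :
    DirectSum.IsInternal (subProdGr R) := by
  classical
  have hproj : ∀ k, ∀ x ∈ Subalgebra.toSubmodule R, ((C.proj k).prodMap (C'.proj k)) x ∈
      Subalgebra.toSubmodule R := hp
  refine isInternal_of_proj (subProdGr R)
    (fun k => ((C.proj k).prodMap (C'.proj k)).restrict (hproj k)) ?_ ?_ ?_
  · rintro k x ⟨h1, h2⟩
    exact Subtype.ext (Prod.ext (proj_same h1) (proj_same h2))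
  · rintro j k h x ⟨h1, h2⟩
    exact Subtype.ext (Prod.ext (proj_ne h1 h) (proj_ne h2 h))
  · intro x
    obtain ⟨s, hs⟩ := C.eq_sum_proj x.1.1
    obtain ⟨s', hs'⟩ := C'.eq_sum_proj x.1.2
    have h : x = ∑ k ∈ s ∪ s', ((C.proj k).prodMap (C'.proj k)).restrict (hproj k) x := by
      apply Subtype.ext
      rw [AddSubmonoidClass.coe_finsetSum]
      refine Prod.ext ?_ ?_
      · rw [Prod.fst_sum]
        exact hs _ Finset.subset_union_left
      · rw [Prod.snd_sum]
        exact hs' _ Finset.subset_union_right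
    rw [h]
    exact Submodule.sum_mem _ fun k _ => Submodule.mem_iSup_of_mem k
      ⟨C.proj_mem k _, C'.proj_mem k _⟩

/-- A homogeneous differential subalgebra of a product of CDGAs. -/
noncomputable def subProd (hd : ∀ x ∈ R, (C.d x.1, C'.d x.2) ∈ R)
    (hp : ∀ k, ∀ x ∈ R, (C.proj k x.1, C'.proj k x.2) ∈ R) : CDGA where
  carrier := R
  gr := subProdGr R
  graded := { (inferInstance : SetLike.GradedMonoid (subProdGr R)),
    (isInternal_subProdGr R hp).chooseDecomposition with }
  d := (C.d.prodMap C'.d).restrict (p := Subalgebra.toSubmodule R)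
    (q := Subalgebra.toSubmodule R) hd
  d_mem h := ⟨C.d_mem h.1, C'.d_mem h.2⟩
  d_d _ := Subtype.ext (Prod.ext (C.d_d _) (C'.d_d _))
  leibniz h _ := Subtype.ext (Prod.ext (C.leibniz h.1 _) (C'.leibniz h.2 _))
  graded_comm h h' := Subtype.ext (Prod.ext (C.graded_comm h.1 h'.1) (C'.graded_comm h.2 h'.2))

variable {R} (hd : ∀ x ∈ R, (C.d x.1, C'.d x.2) ∈ R)
    (hp : ∀ k, ∀ x ∈ R, (C.proj k x.1, C'.proj k x.2) ∈ R)

/-- The first projection. -/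
noncomputable def subProdFst : CDGAHom (subProd R hd hp) C where
  toAlgHom := (AlgHom.fst ℚ C C').comp R.val
  map_gr h := h.1
  map_d _ := rfl

/-- The second projection. -/
noncomputable def subProdSnd : CDGAHom (subProd R hd hp) C' where
  toAlgHom := (AlgHom.snd ℚ C C').comp R.val
  map_gr h := h.2
  map_d _ := rfl

/-- The morphism with given components. -/
noncomputable def subProdLift {B : CDGA} (f : CDGAHom B C) (f' : CDGAHom B C')
    (h : ∀ b, (f b, f' b) ∈ R) : CDGAHom B (subProd R hd hp) where
  toAlgHom := (f.toAlgHom.prod f'.toAlgHom).codRestrict R h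
  map_gr hb := ⟨f.map_gr hb, f'.map_gr hb⟩
  map_d b := Subtype.ext (Prod.ext (f.map_d b) (f'.map_d b))

end subProd

end CDGA

namespace S2S3

/-! ### The acyclic ideal generated by `s s⁻⁵ y` -/

/-- The element `y ⊗ xy + xy ⊗ y = - Δ (1 ⊗ y)`. -/
noncomputable def η : AA := e 2 3 + e 3 2

/-- The sum of `C(Δ^!)^{≥ 9}` and the span of `s s⁻⁵ y` and its differential. -/
noncomputable def J : Submodule ℚ (Cone A) :=
  Cone.top A 5 ⊔ Submodule.span ℚ {((0, basis 2) : Cone A), ((η, 0) : Cone A)}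

theorem top_le_J : Cone.top A 5 ≤ J := le_sup_left

theorem y_mem_J : ((0, basis 2) : Cone A) ∈ J :=
  Submodule.mem_sup_right (Submodule.subset_span (Or.inl rfl))

theorem η_mem_J : ((η, 0) : Cone A) ∈ J :=
  Submodule.mem_sup_right (Submodule.subset_span (Or.inr rfl))

theorem J_le {S : Submodule ℚ (Cone A)} (h : Cone.top A 5 ≤ S)
    (h1 : ((0, basis 2) : Cone A) ∈ S) (h2 : ((η, 0) : Cone A) ∈ S) : J ≤ S := by
  refine sup_le h (Submodule.span_le.2 ?_)
  rintro _ (rfl | rfl)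
  exacts [h1, h2]

theorem y_mem_gr : ((0, basis 2) : Cone A) ∈ Cone.gr A 5 7 :=
  Cone.inr_mem (j := 3) rfl (basis_mem 2)

theorem η_mem_gr : ((η, 0) : Cone A) ∈ Cone.gr A 5 8 :=
  Cone.inl_mem (Submodule.add_mem _ (e_mem 2 3) (e_mem 3 2))

theorem δ_y : Cone.δ D (0, basis 2) = (-η, 0) := by
  rw [δ_eq, diag_mul_y]
  rfl

theorem δ_J {c : Cone A} (hc : c ∈ J) : Cone.δ D c ∈ J := by
  refine (J_le (S := J.comap (Cone.δ D)) ?_ ?_ ?_) hc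
  · exact fun c hc => top_le_J (Cone.δ_top D (by decide) hc)
  · rw [Submodule.mem_comap, δ_y]
    simpa using Submodule.neg_mem _ η_mem_J
  · rw [Submodule.mem_comap, δ_eq, t_zero_right, mul_zero]
    exact Submodule.zero_mem _

theorem pr_mem_J {m k : ℕ} {c : Cone A} (hc : c ∈ Cone.gr A 5 m) (hJ : c ∈ J) :
    Cone.pr A 5 k c ∈ J := by
  by_cases h : m = k
  · subst h
    rwa [Cone.pr_same hc]
  · rw [Cone.pr_ne h hc]
    exact Submodule.zero_mem _

theorem pr_J (k : ℕ) {c : Cone A} (hc : c ∈ J) : Cone.pr A 5 k c ∈ J :=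
  (J_le (S := J.comap (Cone.pr A 5 k)) (fun _ hc => top_le_J (Cone.pr_top hc))
    (pr_mem_J y_mem_gr y_mem_J) (pr_mem_J η_mem_gr η_mem_J)) hc

theorem eq_smul_of_mem_gr_low {k : ℕ} (hk : k ≤ 1) {c : Cone A} (hc : c ∈ Cone.gr A 5 k) :
    ∃ r : ℚ, c = r • (1, 0) := by
  obtain ⟨z, a⟩ := c
  obtain ⟨hz, ha⟩ := hc
  have ha' : a = 0 := by
    rcases Cone.ss_cases ha with h | ⟨j, hj, -⟩
    · exact h
    · omega
  have hz' : z = coef 0 0 z • e 0 0 := by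
    refine eq_smul_of_mem_tensorGr (k := k) hz fun j l h => ?_
    have : ∀ j l : Fin 4, deg j + deg l ≤ 1 → j = 0 ∧ l = 0 := by decide
    exact this j l (by omega)
  refine ⟨coef 0 0 z, ?_⟩
  rw [ha']
  refine Prod.ext ?_ (smul_zero _).symm
  conv_lhs => rw [hz', e, one_eq]
  rfl

theorem cone_mul_one (ξ : AA) (c : Cone A) : Cone.mul ξ c (1, 0) = c := by
  refine Prod.ext ?_ ?_ <;> simp [Cone.mul_apply, map_one, tm_zero_left]

theorem cone_one_mul (ξ : AA) (c : Cone A) : Cone.mul ξ (1, 0) c = c := by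
  refine Prod.ext ?_ ?_ <;> simp [Cone.mul_apply, map_one, tm_zero_left]

/-- `J` is an ideal for degree reasons, for every `ξ`. The cone is spanned by the unit in degrees at
most 1, and an element of degree at least 2 carries degree at least 7 into the truncated range. -/
theorem mul_mem_J_of_gr (ξ : (tensor A A).gr 8) {m : ℕ} (hm : 7 ≤ m) {g : Cone A}
    (hg : g ∈ Cone.gr A 5 m) (hJ : g ∈ J) (c : Cone A) :
    Cone.mul ξ.1 g c ∈ J ∧ Cone.mul ξ.1 c g ∈ J := by
  refine Cone.cone_induction 5 (Q := fun c => Cone.mul ξ.1 g c ∈ J ∧ Cone.mul ξ.1 c g ∈ J)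
    ?_ ?_ ?_ c
  · rw [map_zero, LinearMap.map_zero₂]
    exact ⟨Submodule.zero_mem _, Submodule.zero_mem _⟩
  · intro k c hc
    by_cases hk : k ≤ 1
    · obtain ⟨r, rfl⟩ := eq_smul_of_mem_gr_low hk hc
      rw [map_smul, LinearMap.map_smul₂, cone_mul_one, cone_one_mul]
      exact ⟨Submodule.smul_mem _ _ hJ, Submodule.smul_mem _ _ hJ⟩
    · exact ⟨top_le_J (Cone.gr_le_top (k := m + k) (by omega) (Cone.mul_mem (n := 5) ξ.2 hg hc)),
        top_le_J (Cone.gr_le_top (k := k + m) (by omega) (Cone.mul_mem (n := 5) ξ.2 hc hg))⟩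
  · rintro x y ⟨h1, h2⟩ ⟨h3, h4⟩
    rw [map_add, LinearMap.map_add₂]
    exact ⟨Submodule.add_mem _ h1 h3, Submodule.add_mem _ h2 h4⟩

theorem mul_J_left (ξ : (tensor A A).gr 8) {g : Cone A} (hg : g ∈ J) (c : Cone A) :
    Cone.mul ξ.1 g c ∈ J :=
  (J_le (S := J.comap ((Cone.mul ξ.1).flip c))
    (fun _ hc => top_le_J (Cone.mul_top_left (n := 5) ξ.2 hc c))
    (mul_mem_J_of_gr ξ (by decide) y_mem_gr y_mem_J c).1
    (mul_mem_J_of_gr ξ (by decide) η_mem_gr η_mem_J c).1) hg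

theorem mul_J_right (ξ : (tensor A A).gr 8) {g : Cone A} (hg : g ∈ J) (c : Cone A) :
    Cone.mul ξ.1 c g ∈ J :=
  (J_le (S := J.comap (Cone.mul ξ.1 c))
    (fun _ hc => top_le_J (Cone.mul_top_right (n := 5) ξ.2 hc c))
    (mul_mem_J_of_gr ξ (by decide) y_mem_gr y_mem_J c).2
    (mul_mem_J_of_gr ξ (by decide) η_mem_gr η_mem_J c).2) hg

/-- The image of `J` in `C(ξ)` is acyclic. -/
theorem acyclic_J (ξ : (tensor A A).gr 8) {b : Cone A} (hb : b ∈ J)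
    (hd : (C ξ).d (q ξ b) = 0) : ∃ c ∈ J, (C ξ).d (q ξ c) = q ξ b := by
  obtain ⟨v, hv, g, hg, rfl⟩ := Submodule.mem_sup.1 hb
  obtain ⟨α, β, rfl⟩ := Submodule.mem_span_pair.1 hg
  -- A closed element has no `s s⁻⁵ y` component, so modulo the truncation only `β η` remains, and
  -- `η = d(-s s⁻⁵ y)`.
  have hα := (snd_eq_zero_of_closed ξ hd).2.2
  have hv2 : (v.2 : S2S3) 2 = 0 := ((mem_top_iff v).1 hv).2 2 (by decide)
  have hα0 : α = 0 := by
    have h1 : (v.2 : S2S3) 2 + (α * (basis 2 : S2S3) 2 + β * 0) = 0 := hα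
    rw [hv2, basis_apply, if_pos rfl] at h1
    linarith
  refine ⟨-β • (0, basis 2), Submodule.smul_mem _ _ y_mem_J, ?_⟩
  rw [map_smul, map_smul, d_q, diag_mul_y, hα0, zero_smul, zero_add, map_add,
    (q_eq_zero ξ).2 hv, zero_add, ← map_smul]
  congr 1
  refine Prod.ext ?_ ?_
  · change -β • -η = β • η
    rw [smul_neg, neg_smul, neg_neg]
  · change -β • (0 : S2S3) = β • (0 : S2S3)
    rw [smul_zero, smul_zero]

end S2S3

end RHT

namespace RHT

open CDGA

namespace S2S3

/-! ### 1-connectedness of `A ⊗ A` and the kernel of `τ` -/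

theorem tensor_isOneConnected : (tensor A A).IsOneConnected where
  nontrivial := ⟨⟨0, 1, fun h => by
    have h1 : coef 0 0 (e 0 0) = 1 := by simp [coef_e]
    have h2 : (e 0 0 : AA) = 1 := by
      rw [e, one_eq]
      rfl
    have h3 : (1 : AA) = 0 := h.symm
    rw [h2, h3, map_zero] at h1
    exact zero_ne_one h1⟩⟩
  gr_zero z hz := by
    refine ⟨coef 0 0 z, ?_⟩
    have h := eq_smul_of_mem_tensorGr (k := 0) (i := 0) hz (by decide)
    rw [Algebra.algebraMap_eq_smul_one]
    refine h.trans ?_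
    rw [e, one_eq]
    rfl
  gr_one := by
    rw [eq_bot_iff]
    intro z hz
    refine (Submodule.mem_bot _).2 (coef_ext fun i j => ?_)
    rw [map_zero]
    refine coef_of_mem (k := 1) hz ?_
    revert i j
    decide

/-- `(A ⊗ A)⁸` is spanned by `y ⊗ xy` and `xy ⊗ y`, and `τ` vanishes exactly where the two
coefficients agree. -/
theorem eq_smul_η {z : AA} (hz : z ∈ tensorGr A A 8) (h : τ z = 0) : z = coef 2 3 z • η := by
  have h' : coef 2 3 z = coef 3 2 z := sub_eq_zero.1 h
  have key : ∀ i j : Fin 4, (i = 2 ∧ j = 3) ∨ (i = 3 ∧ j = 2) ∨ deg i + deg j ≠ 8 := by decide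
  refine coef_ext fun i j => ?_
  rw [map_smul, η, map_add, coef_e, coef_e, smul_eq_mul]
  rcases key i j with ⟨rfl, rfl⟩ | ⟨rfl, rfl⟩ | h
  · simp
  · simp [h']
  · rw [coef_of_mem hz h]
    have h1 : coef i j (e 2 3) = 0 := coef_of_mem (k := 8) (e_mem 2 3) h
    have h2 : coef i j (e 3 2) = 0 := coef_of_mem (k := 8) (e_mem 3 2) h
    rw [← coef_e, ← coef_e, h1, h2, add_zero, mul_zero]

/-! ### Comparing `C(ξ)` and `C(ξ')` -/

section

variable {ξ ξ' : (tensor A A).gr 8}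

/-- The two products differ only in the value of `(s s⁻⁵ 1)²`, so the difference is `ξ - ξ'` times
the coefficients of `s s⁻⁵ 1` in `a` and `b`. -/
theorem mul_sub_mul_mem_J (h : ((ξ.1 - ξ'.1, 0) : Cone A) ∈ J) (a b : Cone A) :
    Cone.mul ξ.1 a b - Cone.mul ξ'.1 a b ∈ J := by
  obtain ⟨r, hr⟩ := A_oneConnected.gr_zero _ (A.proj_mem 0 a.2)
  obtain ⟨s, hs⟩ := A_oneConnected.gr_zero _ (A.proj_mem 0 b.2)
  have h1 : Cone.mul ξ.1 a b - Cone.mul ξ'.1 a b = (r * s) • (ξ.1 - ξ'.1, 0) := by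
    have h2 : tm (A := A) (A' := A) (A.proj 0 a.2 * A.proj 0 b.2) 1 = (r * s) • 1 := by
      rw [hr, hs, ← map_mul, Algebra.algebraMap_eq_smul_one, tm_smul_left]
      rfl
    refine Prod.ext ?_ ?_
    · simp only [Cone.mul_apply, Prod.fst_sub, Prod.smul_fst, h2, mul_smul_comm, mul_one, smul_sub]
      abel
    · simp only [Cone.mul_apply, Prod.snd_sub, Prod.smul_snd, sub_self, smul_zero]
  rw [h1]
  exact Submodule.smul_mem _ _ h

/-- In other words `C(ξ)` and `C(ξ')` have the same quotient algebra modulo `J`, and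
`congrSubalgebra` is their fibre product over it. -/
theorem mul_sub_mul_mem_J_of_sub_mem (h : ((ξ.1 - ξ'.1, 0) : Cone A) ∈ J) {a a' b b' : Cone A}
    (ha : a - a' ∈ J) (hb : b - b' ∈ J) : Cone.mul ξ.1 a b - Cone.mul ξ'.1 a' b' ∈ J := by
  have e1 : Cone.mul ξ.1 a b - Cone.mul ξ'.1 a' b' =
      (Cone.mul ξ.1 a b - Cone.mul ξ'.1 a b) + Cone.mul ξ'.1 (a - a') b +
        Cone.mul ξ'.1 a' (b - b') := by
    rw [map_sub, map_sub, LinearMap.sub_apply]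
    abel
  rw [e1]
  exact Submodule.add_mem _ (Submodule.add_mem _ (mul_sub_mul_mem_J h a b)
    (mul_J_left ξ' ha b)) (mul_J_right ξ' hb a')

variable (ξ ξ') in
/-- The pairs of elements of `C(ξ)` and `C(ξ')` represented by elements of the cone that are
congruent modulo `J`. -/
noncomputable def congrSubmodule : Submodule ℚ (C ξ × C ξ') :=
  (J.comap (LinearMap.fst ℚ (Cone A) (Cone A) - LinearMap.snd ℚ (Cone A) (Cone A))).map
    ((q ξ).prodMap (q ξ'))

theorem mem_congrSubmodule {p : C ξ × C ξ'} :
    p ∈ congrSubmodule ξ ξ' ↔ ∃ a b : Cone A, a - b ∈ J ∧ q ξ a = p.1 ∧ q ξ' b = p.2 := by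
  constructor
  · rintro ⟨⟨a, b⟩, h, rfl⟩
    exact ⟨a, b, h, rfl, rfl⟩
  · rintro ⟨a, b, h, h1, h2⟩
    exact ⟨(a, b), h, Prod.ext h1 h2⟩

theorem mk_mem_congrSubmodule {a b : Cone A} (h : a - b ∈ J) :
    (q ξ a, q ξ' b) ∈ congrSubmodule ξ ξ' :=
  mem_congrSubmodule.2 ⟨a, b, h, rfl, rfl⟩

theorem diag_mem_congrSubmodule (a : Cone A) : (q ξ a, q ξ' a) ∈ congrSubmodule ξ ξ' :=
  mk_mem_congrSubmodule (by rw [sub_self]; exact Submodule.zero_mem _)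

/-- The pairs of elements of `C(ξ)` and `C(ξ')` that are congruent modulo `J` form a subalgebra. -/
noncomputable def congrSubalgebra (h : ((ξ.1 - ξ'.1, 0) : Cone A) ∈ J) :
    Subalgebra ℚ (C ξ × C ξ') :=
  (congrSubmodule ξ ξ').toSubalgebra (diag_mem_congrSubmodule (1, 0)) (by
    intro p p' hp hp'
    obtain ⟨a, b, hab, h1, h2⟩ := mem_congrSubmodule.1 hp
    obtain ⟨a', b', hab', h1', h2'⟩ := mem_congrSubmodule.1 hp'
    refine mem_congrSubmodule.2 ⟨_, _, mul_sub_mul_mem_J_of_sub_mem h hab hab', ?_, ?_⟩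
    · rw [← q_mul, h1, h1']
      rfl
    · rw [← q_mul, h2, h2']
      rfl)

variable (h : ((ξ.1 - ξ'.1, 0) : Cone A) ∈ J)

include h in
theorem d_mem_congrSubalgebra (x : C ξ × C ξ') (hx : x ∈ congrSubalgebra h) :
    ((C ξ).d x.1, (C ξ').d x.2) ∈ congrSubalgebra h := by
  obtain ⟨a, b, hab, h1, h2⟩ := mem_congrSubmodule.1 hx
  rw [← h1, ← h2]
  refine mk_mem_congrSubmodule (ξ := ξ) (ξ' := ξ') (a := Cone.δ D a) (b := Cone.δ D b) ?_
  rw [← map_sub]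
  exact δ_J hab

theorem proj_mem_congrSubalgebra (k : ℕ) (x : C ξ × C ξ') (hx : x ∈ congrSubalgebra h) :
    ((C ξ).proj k x.1, (C ξ').proj k x.2) ∈ congrSubalgebra h := by
  obtain ⟨a, b, hab, h1, h2⟩ := mem_congrSubmodule.1 hx
  rw [← h1, ← h2, proj_q, proj_q]
  refine mk_mem_congrSubmodule ?_
  rw [← map_sub]
  exact pr_J k hab

/-- The CDGA of pairs of elements of `C(ξ)` and `C(ξ')` that are congruent modulo `J`. -/
noncomputable abbrev congrCDGA : CDGA :=
  subProd (congrSubalgebra h) (d_mem_congrSubalgebra h) (proj_mem_congrSubalgebra h)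

/-- Diagonal pairs show surjectivity, and the kernel is the image of `J` in `C(ξ')`, which is
acyclic. -/
theorem fst_isQuasiIso :
    (subProdFst (d_mem_congrSubalgebra h) (proj_mem_congrSubalgebra h)).IsQuasiIso := by
  refine CDGAHom.isQuasiIso_of_surjective _ ?_ ?_
  · intro k b hb
    obtain ⟨a, ha, rfl⟩ := (mem_gr_C ξ).1 hb
    exact ⟨⟨(q ξ a, q ξ' a), diag_mem_congrSubmodule a⟩, ⟨⟨a, ha, rfl⟩, ⟨a, ha, rfl⟩⟩, rfl⟩
  · rintro ⟨⟨x, y⟩, hxy⟩ hx hd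
    obtain ⟨a, b, hab, rfl, rfl⟩ := mem_congrSubmodule.1 hxy
    have ha : q ξ a = 0 := hx
    have hb : b ∈ J := by
      rw [← sub_sub_cancel a b]
      exact Submodule.sub_mem _ (top_le_J ((q_eq_zero ξ).1 ha)) hab
    obtain ⟨c, hc, hcb⟩ := acyclic_J ξ' hb (congrArg (fun p => p.1.2) hd)
    refine ⟨⟨(q ξ 0, q ξ' c), mk_mem_congrSubmodule ?_⟩, map_zero (q ξ), ?_⟩
    · rw [zero_sub]
      exact Submodule.neg_mem _ hc
    · refine Subtype.ext (Prod.ext ?_ hcb)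
      change (C ξ).d (q ξ 0) = q ξ a
      rw [ha, map_zero, map_zero]

theorem snd_isQuasiIso :
    (subProdSnd (d_mem_congrSubalgebra h) (proj_mem_congrSubalgebra h)).IsQuasiIso := by
  refine CDGAHom.isQuasiIso_of_surjective _ ?_ ?_
  · intro k b hb
    obtain ⟨a, ha, rfl⟩ := (mem_gr_C ξ').1 hb
    exact ⟨⟨(q ξ a, q ξ' a), diag_mem_congrSubmodule a⟩, ⟨⟨a, ha, rfl⟩, ⟨a, ha, rfl⟩⟩, rfl⟩
  · rintro ⟨⟨x, y⟩, hxy⟩ hy hd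
    obtain ⟨a, b, hab, rfl, rfl⟩ := mem_congrSubmodule.1 hxy
    have hb : q ξ' b = 0 := hy
    have ha : a ∈ J := by
      rw [← sub_add_cancel a b]
      exact Submodule.add_mem _ hab (top_le_J ((q_eq_zero ξ').1 hb))
    obtain ⟨c, hc, hca⟩ := acyclic_J ξ ha (congrArg (fun p => p.1.1) hd)
    refine ⟨⟨(q ξ c, q ξ' 0), mk_mem_congrSubmodule ?_⟩, map_zero (q ξ'), ?_⟩
    · rwa [sub_zero]
    · refine Subtype.ext (Prod.ext hca ?_)
      change (C ξ').d (q ξ' 0) = q ξ' b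
      rw [hb, map_zero, map_zero]

theorem one_ne_zero_C : (1 : C ξ) ≠ 0 := by
  intro h
  have h1 := ((mem_top_iff _).1 ((q_eq_zero ξ (c := (1, 0))).1 h)).1 0 0 (by decide)
  have h2 : coef 0 0 (1 : AA) = 1 := by
    have : coef 0 0 (t 1 1) = 1 := by simp [coef_t]
    exact this
  rw [h2] at h1
  exact one_ne_zero h1

theorem nontrivial_congrCDGA : Nontrivial (congrCDGA h) :=
  ⟨⟨0, 1, fun h0 => one_ne_zero_C (ξ := ξ) (congrArg (fun p => p.1.1) h0).symm⟩⟩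

end

/-- The fibre product is a roof of quasi-isomorphisms under `A ⊗ A` between `C(ξ)` and `C(ξ')`; a
relative Sullivan model of the map into it composes with both projections. -/
theorem weaklyEquivalent_of_τ_eq {ξ ξ' : (tensor A A).gr 8} (hτ : τ ξ.1 = τ ξ'.1) :
    WeaklyEquivalentUnder (incl ξ) (incl ξ') := by
  have h : ((ξ.1 - ξ'.1, 0) : Cone A) ∈ J := by
    have h1 := eq_smul_η (Submodule.sub_mem _ ξ.2 ξ'.2) (by rw [map_sub, hτ, sub_self])
    have h2 : ((ξ.1 - ξ'.1, 0) : Cone A) = coef 2 3 (ξ.1 - ξ'.1) • (η, 0) :=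
      Prod.ext h1 (smul_zero _).symm
    rw [h2]
    exact Submodule.smul_mem _ _ η_mem_J
  let f : CDGAHom (tensor A A) (congrCDGA h) :=
    subProdLift _ _ (incl ξ) (incl ξ') fun z => diag_mem_congrSubmodule (z, 0)
  have hf : ∀ k, Function.Surjective (f.cohomologyMap k) := by
    intro k
    have h1 : incl ξ = (subProdFst _ _).comp f := CDGAHom.ext_apply fun _ => rfl
    have h2 := surjective_cohomologyMap_incl ξ k
    rw [h1, CDGAHom.cohomologyMap_comp] at h2
    -- The composite with the first projection is onto in cohomology and that projection is
    -- injective there, so `f` itself is onto.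
    exact h2.of_comp_left (fst_isQuasiIso h k).1
  obtain ⟨E, i, φ, hi, hφ, hφi⟩ :=
    exists_relativeSullivan_model f tensor_isOneConnected (nontrivial_congrCDGA h) hf
  refine ⟨E, i, hi, (subProdFst _ _).comp φ, (subProdSnd _ _).comp φ, (fst_isQuasiIso h).comp hφ,
    (snd_isQuasiIso h).comp hφ, ?_, ?_⟩
  · exact (congrArg (CDGAHom.comp (subProdFst _ _)) hφi : _)
  · exact (congrArg (CDGAHom.comp (subProdSnd _ _)) hφi : _)

end S2S3

end RHT

theorem mainTheorem8 (x x' : RHT.S2S3.A.H 3)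
    (ξ ξ' : (RHT.CDGA.tensor RHT.S2S3.A RHT.S2S3.A).gr 8)
    (hξ : RHT.Represents RHT.S2S3.D x ξ.1) (hξ' : RHT.Represents RHT.S2S3.D x' ξ'.1) :
    RHT.WeaklyEquivalentUnder (RHT.S2S3.incl ξ) (RHT.S2S3.incl ξ') ↔ x = x' := by
  rw [RHT.S2S3.eq_iff_τ_eq hξ hξ']
  exact ⟨RHT.S2S3.τ_eq_of_weaklyEquivalent, RHT.S2S3.weaklyEquivalent_of_τ_eq⟩
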